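/- For a tuple $X=(x_1,\dots,x_n)$ of points of $\mathbb{R}^d$ (repetitions allowed) and a finite non-empty set $C\subset\mathbb{R}^d$ let $$\Phi(C,X)=\sum_{i=1}^{n}\min_{c\in C}\|x_i-c\|^2 ,\qquad OPT_k(X)=\inf\{\Phi(C,X): C\subset\mathbb{R}^d,\ |C|=k\}.$$ A $c$-approximate $k$-means solution for $X$ is a set $C\subset\mathbb{R}^d$ with $|C|=k$ and $\Phi(C,X)\le c\cdot OPT_k(X)$. Consider the synchronous shared-memory CREW PRAM over the reals: $N$ real-RAM processors, each knowing its own identity $0,\dots,N-1$ and having a local memory, run the same program in lockstep; both the local memories and the shared memory hold natural numbers (used for counters and addresses) and real numbers. In one time step each processor performs one elementary instruction: an arithmetic operation ($+$, truncated $-$, $\times$ on naturals; $+,-,\times,/$ on reals), a comparison, a conversion of a natural number to a real one, or a direct or indirect memory access. Several processors may read the same shared cell in the same step, but no two may write to the same shared cell in the same step. The time is the number of steps until all processors have finished. **Theorem.** There are a global constant $\tilde c>0$, a polynomial $p$ in four variables, and a single (deterministic) CREW PRAM program such that the following holds for all $0<\varepsilon<1$, all integers $n,k,d,N\ge 1$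 and all $X\in(\mathbb{R}^d)^n$. Run on $N$ processors with input $n,d,k,N,\varepsilon,X$ in the shared memory, the program never violates the exclusive-write rule, all processors finish within time $$p\!\left(n^{\varepsilon},k,d,\tfrac1\varepsilon\right)\cdot\left\lceil \frac{n^{1-\varepsilon}}{N}\right\rceil ,$$ and the shared memory then contains, in the designated output cells, a $c$-approximate $k$-means solution for $X$ with $c=\tilde c^{\,1/\varepsilon}$. -/

import Mathlib

/-! ### A synchronous CREW PRAM over the reals (unit-cost real RAM processors) -/

namespace PRAM

/-- A memory: an unbounded array of natural numbers (used for counters and addresses) and an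
unbounded array of real numbers. There is no conversion from reals to integers. -/
structure Memory where
  int : ℕ → ℕ
  real : ℕ → ℝ

def Memory.setInt (m : Memory) (a v : ℕ) : Memory :=
  { m with int := Function.update m.int a v }

noncomputable def Memory.setReal (m : Memory) (a : ℕ) (v : ℝ) : Memory :=
  { m with real := Function.update m.real a v }

/-- Elementary instructions of a processor. All the numerals `r`, `a`, `b`, `c` are constants of
the program; `r`, `a`, `b` name cells of the local memory of the processor, and the shared memory
is accessed only by `intRead`, `realRead`, `intWrite`, `realWrite`. -/
inductive Instr where
  | nop
  | intConst (r c : ℕ)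
  | intAdd (r a b : ℕ)
  | intSub (r a b : ℕ)
  | intMul (r a b : ℕ)
  | realOfInt (r a : ℕ)
  | realAdd (r a b : ℕ)
  | realSub (r a b : ℕ)
  | realMul (r a b : ℕ)
  | realDiv (r a b : ℕ)
  | intLoad (r a : ℕ)
  | intStore (a r : ℕ)
  | realLoad (r a : ℕ)
  | realStore (a r : ℕ)
  | intRead (r a : ℕ)
  | intWrite (a r : ℕ)
  | realRead (r a : ℕ)
  | realWrite (a r : ℕ)

/-- The local memory after one instruction, given the shared memory at the start of the step and
the local memory `m`. Subtraction of integers is truncated at `0`; division of reals by `0`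
gives `0`. Load and store are indirect accesses to the local memory, read is an indirect access
to the shared memory; all addresses are taken from integer cells. -/
noncomputable def Instr.exec (shared m : Memory) : Instr → Memory
  | nop => m
  | intConst r c => m.setInt r c
  | intAdd r a b => m.setInt r (m.int a + m.int b)
  | intSub r a b => m.setInt r (m.int a - m.int b)
  | intMul r a b => m.setInt r (m.int a * m.int b)
  | realOfInt r a => m.setReal r (m.int a : ℝ)
  | realAdd r a b => m.setReal r (m.real a + m.real b)
  | realSub r a b => m.setReal r (m.real a - m.real b)
  | realMul r a b => m.setReal r (m.real a * m.real b)
  | realDiv r a b => m.setReal r (m.real a / m.real b)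
  | intLoad r a => m.setInt r (m.int (m.int a))
  | intStore a r => m.setInt (m.int a) (m.int r)
  | realLoad r a => m.setReal r (m.real (m.int a))
  | realStore a r => m.setReal (m.int a) (m.real r)
  | intRead r a => m.setInt r (shared.int (m.int a))
  | intWrite _ _ => m
  | realRead r a => m.setReal r (shared.real (m.int a))
  | realWrite _ _ => m

/-- The integer cell of the shared memory written by an instruction, with the value written. -/
def Instr.intRequest (m : Memory) : Instr → Option (ℕ × ℕ)
  | intWrite a r => some (m.int a, m.int r)
  | _ => none

/-- The real cell of the shared memory written by an instruction, with the value written. -/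
def Instr.realRequest (m : Memory) : Instr → Option (ℕ × ℝ)
  | realWrite a r => some (m.int a, m.real r)
  | _ => none

/-- Tests compare two cells of the local memory. -/
inductive Test where
  | intLT (a b : ℕ)
  | realLT (a b : ℕ)

def Test.Holds (m : Memory) : Test → Prop
  | intLT a b => m.int a < m.int b
  | realLT a b => m.real a < m.real b

/-- Programs: elementary instructions, sequencing, branching, and while loops. -/
inductive Program where
  | exec (i : Instr)
  | seq (p q : Program)
  | ite (t : Test) (p q : Program)
  | loop (t : Test) (p : Program)

/-- A processor: the stack of program parts that it still has to run, and its local memory. -/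
structure Processor where
  control : List Program
  mem : Memory

open Classical in
/-- One time step of one processor. Each elementary instruction, each evaluation of a test and
each opening of a sequence takes one time step. A processor with nothing left to run idles. -/
noncomputable def Processor.step (shared : Memory) (P : Processor) : Processor :=
  match P.control with
  | [] => P
  | .exec i :: s => ⟨s, i.exec shared P.mem⟩
  | .seq p q :: s => ⟨p :: q :: s, P.mem⟩
  | .ite t p q :: s => ⟨(if t.Holds P.mem then p else q) :: s, P.mem⟩
  | .loop t p :: s => ⟨if t.Holds P.mem then p :: .loop t p :: s else s, P.mem⟩

/-- What the processor writes into the integer part of the shared memory in the next step. -/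
def Processor.intRequest (P : Processor) : Option (ℕ × ℕ) :=
  match P.control with
  | .exec i :: _ => i.intRequest P.mem
  | _ => none

/-- What the processor writes into the real part of the shared memory in the next step. -/
def Processor.realRequest (P : Processor) : Option (ℕ × ℝ) :=
  match P.control with
  | .exec i :: _ => i.realRequest P.mem
  | _ => none

/-- A configuration of a PRAM with `N` processors. -/
structure Config (N : ℕ) where
  procs : Fin N → Processor
  shared : Memory

/-- Exclusive write: no two processors write to the same cell of the shared memory in the next
step. Concurrent reads are not restricted. -/
def Config.ExclusiveWrite {N : ℕ} (c : Config N) : Prop :=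
  ∀ i j : Fin N, i ≠ j →
    (∀ x v w, (c.procs i).intRequest = some (x, v) → (c.procs j).intRequest ≠ some (x, w)) ∧
    (∀ x v w, (c.procs i).realRequest = some (x, v) → (c.procs j).realRequest ≠ some (x, w))

open Classical in
/-- One synchronous time step: all processors read the shared memory as it is at the start of the
step, then all writes take effect. (The written value is unambiguous under `ExclusiveWrite`, which
is imposed on every step of a CREW computation.) -/
noncomputable def Config.step {N : ℕ} (c : Config N) : Config N where
  procs i := (c.procs i).step c.shared
  shared :=
    { int := fun x => if h : ∃ v, ∃ i, (c.procs i).intRequest = some (x, v) then h.choose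
        else c.shared.int x
      real := fun x => if h : ∃ v, ∃ i, (c.procs i).realRequest = some (x, v) then h.choose
        else c.shared.real x }

/-- All processors have finished. -/
def Config.Halted {N : ℕ} (c : Config N) : Prop := ∀ i, (c.procs i).control = []

/-- The initial configuration: all `N` processors run the same program `A`. Integer cell `0` of
the local memory of a processor holds its identity, one of `0, …, N - 1`; all other local cells
are `0`. The input is in the shared memory. -/
def initial (A : Program) (N : ℕ) (input : Memory) : Config N where
  procs i := ⟨[A], { int := fun a => if a = 0 then i else 0, real := fun _ => 0 }⟩
  shared := input

/-- Started on the given input, program `A` on `N` processors obeys the CREW rule in every step,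
all processors have finished after `T` time steps, and `output` is then the shared memory. -/
def ComputesInTime (A : Program) (N : ℕ) (input : Memory) (T : ℕ) (output : Memory) : Prop :=
  (∀ t < T, (Config.step^[t] (initial A N input)).ExclusiveWrite) ∧
  (Config.step^[T] (initial A N input)).Halted ∧
  (Config.step^[T] (initial A N input)).shared = output

end PRAM

/-! ### The `k`-means problem -/

namespace KMeans

/-- The `k`-means cost `Φ(C, X) = ∑_{x ∈ X} min_{c ∈ C} ‖x - c‖²`. -/
noncomputable def cost {n k d : ℕ} (C : Fin k → EuclideanSpace ℝ (Fin d))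
    (X : Fin n → EuclideanSpace ℝ (Fin d)) : ℝ :=
  ∑ i, ⨅ j, ‖X i - C j‖ ^ 2

/-- The optimal `k`-means cost, over all sets of `k` (distinct) centers. -/
noncomputable def opt {n d : ℕ} (k : ℕ) (X : Fin n → EuclideanSpace ℝ (Fin d)) : ℝ :=
  ⨅ C : {C : Fin k → EuclideanSpace ℝ (Fin d) // Function.Injective C}, cost C.1 X

/-- `C` is a set of `k` (distinct) centers whose cost is at most `α` times the optimal one. -/
def IsApproxSolution {n k d : ℕ} (α : ℝ) (X : Fin n → EuclideanSpace ℝ (Fin d))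
    (C : Fin k → EuclideanSpace ℝ (Fin d)) : Prop :=
  Function.Injective C ∧ cost C X ≤ α * opt k X

/-- The shared memory at the start. Integer cells `0, 1, 2, 3` hold `n`, `d`, `k` and the number
`N` of processors. Real cell `0` holds `ε`, and real cell `1 + i * d + j` holds coordinate `j` of
point `i`. All other cells are `0`. -/
noncomputable def input {n d : ℕ} (N k : ℕ) (ε : ℝ) (X : Fin n → EuclideanSpace ℝ (Fin d)) :
    PRAM.Memory where
  int
    | 0 => n
    | 1 => d
    | 2 => k
    | 3 => N
    | _ => 0
  real
    | 0 => ε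
    | a + 1 => if h : a < n * d then
        X (finProdFinEquiv.symm ⟨a, h⟩).1 (finProdFinEquiv.symm ⟨a, h⟩).2 else 0

/-- The centers are read off from the real cells that follow the input: coordinate `l` of center
`j` is in real cell `1 + n * d + (j * d + l)`. -/
noncomputable def output (n k d : ℕ) (m : PRAM.Memory) : Fin k → EuclideanSpace ℝ (Fin d) :=
  fun j => WithLp.toLp 2 fun l => m.real (1 + n * d + ((j : ℕ) * d + l))

end KMeans

/-! ### Runs of a deterministic transition system -/

/-! Put the points at the leaves of a tree of depth `L = ⌈1/ε⌉` with branching `g = ⌈n^(1/L)⌉ ≤ n^ε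
+ 1`. Every node gets a summary of the points below it: `k` point indices with natural weights that
count the points represented. A leaf represents its point exactly. An inner node concatenates the
summaries of its `g` children, runs a local search for `k` centers on these `g * k` weighted points,
and gives each center the total weight assigned to it. If the children represent their points at a
cost of at most `α` times that of any `k` centers, the node does so with `2626 * α + 2624`
(`IsReduction.isSummary`). Hence level `t` achieves `2626 ^ t - 1`, and the root at most `(2626 ^ 2)
^ (1/ε)`.

The number of local search steps must be polynomial in `g` and `k`, whatever the real coordinates
are. A fixed number of cheapest swaps is made, from arbitrary initial centers, on `m = g * k`
weighted points. By the swap inequality `exists_pairing_sum_wcost_le`, as long as the cost exceeds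
`164` times that of a suitable discrete solution, a cheapest swap shrinks it by a factor `1 -
1/(4k)`. After `4 * k * m` swaps it has dropped by `2 ^ m > m`, so the largest single term of the
cost has become strictly smaller. That term is a weighted squared distance from a point to a point
or to an initial center, so it has at most `m * (m + k)` values, and pigeonhole bounds the number of
such phases (`wcost_le_of_best_swaps`).

Each level is handled in `Q = ⌈n/N⌉` rounds, one node per processor and round; `Q ≤ (n^ε + 1) *
⌈n^(1-ε)/N⌉` leaves the required time bound. Exclusive writing follows from lockstep: all running
times are independent of the data, so all processors write simultaneously, each into its own node.
Therefore programs are written as `Stmt`, with padded conditionals and counted loops. `wp` treats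
code without shared writes one processor at a time, `cwp` treats all processors together, and
`Stmt.time_le` reads the time off the syntax. At the end, repeated centers are replaced by fresh
points, because a solution needs `k` distinct centers. -/

namespace PRAM

/-- `T` steps of `f` lead from `a` to `b`, and `ok` holds before each of them. -/
def Steps {α : Type*} (f : α → α) (ok : α → Prop) (T : ℕ) (a b : α) : Prop :=
  f^[T] a = b ∧ ∀ t < T, ok (f^[t] a)

namespace Steps

variable {α : Type*} {f : α → α} {ok : α → Prop} {a b c : α} {S T : ℕ}

theorem single (h : ok a) : Steps f ok 1 a (f a) :=
  ⟨rfl, fun t ht => by obtain rfl : t = 0 := by omega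
                       exact h⟩

theorem trans (h₁ : Steps f ok S a b) (h₂ : Steps f ok T b c) : Steps f ok (S + T) a c := by
  refine ⟨by rw [add_comm, Function.iterate_add_apply, h₁.1, h₂.1], fun t ht => ?_⟩
  rcases lt_or_ge t S with h | h
  · exact h₁.2 t h
  · obtain ⟨u, rfl⟩ := Nat.exists_eq_add_of_le h
    rw [add_comm, Function.iterate_add_apply, h₁.1]
    exact h₂.2 u (by omega)

theorem cast (h : Steps f ok S a b) (e : S = T) : Steps f ok T a b := e ▸ h

end Steps

/-! ### Structured programs with data-independent running time -/

/-- Instructions that do not write into the shared memory. -/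
def Instr.isLocal : Instr → Bool
  | .intWrite _ _ => false
  | .realWrite _ _ => false
  | _ => true

/-- Structured programs. A conditional is padded so that both branches take the same time, and a
loop is annotated with the name of the parameter that counts its iterations. -/
inductive Stmt where
  | block (l : List Instr)
  | instr (i : Instr)
  | seq (a b : Stmt)
  | cond (t : Test) (l : List Instr)
  | loop (κ : ℕ) (t : Test) (s : Stmt)

infixr:65 " ;; " => Stmt.seq

/-- The closing `nop` gives a program to the empty list too; the time depends on the length only. -/
def blockCode : List Instr → Program
  | [] => .exec .nop
  | i :: l => .seq (.exec i) (blockCode l)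

def Stmt.code : Stmt → Program
  | block l => blockCode l
  | instr i => .exec i
  | seq a b => .seq a.code b.code
  | cond t l => .ite t (blockCode l) (blockCode (l.map fun _ => .nop))
  | loop _ t s => .loop t s.code

/-- The running time, as a function of the iteration counts. -/
def Stmt.time (β : ℕ → ℕ) : Stmt → ℕ
  | block l => 2 * l.length + 1
  | instr _ => 1
  | seq a b => 1 + (a.time β + b.time β)
  | cond _ l => 1 + (2 * l.length + 1)
  | loop κ _ s => β κ * (1 + s.time β) + 1

/-- The effect of a list of local instructions. -/
noncomputable def execs (sh : Memory) (l : List Instr) (m : Memory) : Memory :=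
  l.foldl (fun m i => i.exec sh m) m

@[simp] theorem execs_nil (sh m : Memory) : execs sh [] m = m := rfl

@[simp] theorem execs_cons (sh m : Memory) (i : Instr) (l : List Instr) :
    execs sh (i :: l) m = execs sh l (i.exec sh m) := rfl

theorem execs_map_nop (sh m : Memory) (l : List Instr) :
    execs sh (l.map fun _ => .nop) m = m := by
  induction l with
  | nil => rfl
  | cons i l ih => simpa [Instr.exec] using ih

/-! ### One processor, with the shared memory fixed -/

/-- The processor writes nothing in the next step. -/
def Processor.Idle (P : Processor) : Prop := P.intRequest = none ∧ P.realRequest = none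

/-- `p` runs in exactly `T` steps from local memory `m` to local memory `m'`, without writing into
the shared memory `sh`. -/
def Run (sh : Memory) (p : Program) (m : Memory) (T : ℕ) (m' : Memory) : Prop :=
  -- Quantifying over the rest `s` of the control stack makes runs composable.
  ∀ s, Steps (Processor.step sh) Processor.Idle T ⟨p :: s, m⟩ ⟨s, m'⟩

theorem Run.exec {sh m : Memory} {i : Instr} (h : i.isLocal = true) :
    Run sh (.exec i) m 1 (i.exec sh m) := by
  intro s
  refine Steps.single (f := Processor.step sh) ?_
  cases i <;> first | exact ⟨rfl, rfl⟩ | simp [Instr.isLocal] at h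

theorem Run.seq {sh m₁ m₂ m₃ : Memory} {p q : Program} {S T : ℕ} (hp : Run sh p m₁ S m₂)
    (hq : Run sh q m₂ T m₃) : Run sh (.seq p q) m₁ (1 + (S + T)) m₃ := fun s =>
  (Steps.single (f := Processor.step sh) (a := ⟨.seq p q :: s, m₁⟩) ⟨rfl, rfl⟩).trans
    ((hp (q :: s)).trans (hq s))

theorem Run.block {sh : Memory} : ∀ {l : List Instr} {m : Memory},
    l.all Instr.isLocal = true → Run sh (blockCode l) m (2 * l.length + 1) (execs sh l m)
  | [], m, _ => Run.exec (i := .nop) rfl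
  | i :: l, m, h => by
    simp only [List.all_cons, Bool.and_eq_true] at h
    intro s
    exact (((Run.exec h.1).seq (Run.block (l := l) h.2)) s).cast (by simp; ring)

open Classical in
theorem Run.ite {sh m m' : Memory} {t : Test} {p q : Program} {T : ℕ}
    (h : Run sh (if t.Holds m then p else q) m T m') : Run sh (.ite t p q) m (1 + T) m' :=
  fun s => (Steps.single (f := Processor.step sh) (a := ⟨.ite t p q :: s, m⟩)
    ⟨rfl, rfl⟩).trans (h s)

theorem Run.loop_end {sh m : Memory} {t : Test} {p : Program} (h : ¬ t.Holds m) :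
    Run sh (.loop t p) m 1 m := fun s => by
  have := Steps.single (f := Processor.step sh) (ok := Processor.Idle) (a := ⟨.loop t p :: s, m⟩)
    ⟨rfl, rfl⟩
  simpa [Processor.step, h] using this

theorem Run.loop_step {sh m m' m'' : Memory} {t : Test} {p : Program} {S T : ℕ}
    (h : t.Holds m) (hp : Run sh p m S m') (hl : Run sh (.loop t p) m' T m'') :
    Run sh (.loop t p) m (1 + S + T) m'' := fun s => by
  have := Steps.single (f := Processor.step sh) (ok := Processor.Idle) (a := ⟨.loop t p :: s, m⟩)
    ⟨rfl, rfl⟩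
  simp only [Processor.step, h, if_true] at this
  exact (this.trans (hp _)).trans (hl s)

/-- Started in local memory `m`, the statement `s` takes the time announced for the iteration
counts `β`, writes nothing into the shared memory, and establishes `Q`. -/
def wp (sh : Memory) (β : ℕ → ℕ) (s : Stmt) (Q : Memory → Prop) (m : Memory) : Prop :=
  ∃ m', Run sh s.code m (s.time β) m' ∧ Q m'

section
variable {sh : Memory} {β : ℕ → ℕ} {Q R : Memory → Prop} {m : Memory}

theorem wp.mono {s : Stmt} (h : wp sh β s R m) (hQ : ∀ m', R m' → Q m') : wp sh β s Q m :=
  let ⟨m', h₁, h₂⟩ := h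
  ⟨m', h₁, hQ m' h₂⟩

theorem wp_block {l : List Instr} (h : Q (execs sh l m))
    (hl : l.all Instr.isLocal = true := by rfl) : wp sh β (.block l) Q m :=
  ⟨_, Run.block hl, h⟩

theorem wp_seq {a b : Stmt} (h : wp sh β a (wp sh β b Q) m) : wp sh β (a ;; b) Q m :=
  let ⟨_, h₁, _, h₂, h₃⟩ := h
  ⟨_, h₁.seq h₂, h₃⟩

open Classical in
theorem wp_cond {t : Test} {l : List Instr} (h : Q (if t.Holds m then execs sh l m else m))
    (hl : l.all Instr.isLocal = true := by rfl) : wp sh β (.cond t l) Q m := by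
  refine ⟨_, Run.ite (T := 2 * l.length + 1) ?_, h⟩
  split_ifs with ht
  · exact Run.block hl
  · have := Run.block (sh := sh) (l := l.map fun _ => .nop) (m := m) (by simp [Instr.isLocal])
    rw [execs_map_nop] at this
    simpa using this

/-- The count `β κ` is prescribed in advance. The invariant has to decide the test in each
iteration, so that the loop runs exactly `β κ` times; this is what keeps different processors
synchronous. -/
theorem wp_loop {κ : ℕ} {t : Test} {s : Stmt} (I : ℕ → Memory → Prop)
    (hstep : ∀ i < β κ, ∀ m, I i m → t.Holds m ∧ wp sh β s (I (i + 1)) m)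
    (hend : ∀ m, I (β κ) m → ¬ t.Holds m) (h0 : I 0 m) (hQ : ∀ m, I (β κ) m → Q m) :
    wp sh β (.loop κ t s) Q m := by
  suffices ∀ c i m, i + c = β κ → I i m →
      ∃ m', Run sh (.loop t s.code) m (c * (1 + s.time β) + 1) m' ∧ I (β κ) m' by
    obtain ⟨m', h₁, h₂⟩ := this (β κ) 0 m (by simp) h0
    exact ⟨m', h₁, hQ _ h₂⟩
  intro c
  induction c with
  | zero =>
    intro i m hi hm
    obtain rfl : i = β κ := by omega
    exact ⟨m, by simpa using Run.loop_end (hend m hm), hm⟩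
  | succ c ih =>
    intro i m hi hm
    obtain ⟨ht, m₁, h₁, h₂⟩ := hstep i (by omega) m hm
    obtain ⟨m₂, h₃, h₄⟩ := ih (i + 1) m₁ (by omega) h₂
    exact ⟨m₂, fun s' => ((Run.loop_step ht h₁ h₃) s').cast (by ring), h₄⟩

end

/-! ### All processors in lockstep -/

/-- `p` runs on all processors in exactly `T` steps, obeying the exclusive-write rule, from local
memories `ms` and shared memory `sh` to `ms'` and `sh'`. -/
def CRun {N : ℕ} (p : Program) (ms : Fin N → Memory) (sh : Memory) (T : ℕ)
    (ms' : Fin N → Memory) (sh' : Memory) : Prop :=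
  ∀ s, Steps Config.step Config.ExclusiveWrite T
    (⟨fun i => ⟨p :: s, ms i⟩, sh⟩ : Config N) ⟨fun i => ⟨s, ms' i⟩, sh'⟩

theorem Config.exclusiveWrite_of_idle {N : ℕ} {c : Config N} (h : ∀ i, (c.procs i).Idle) :
    c.ExclusiveWrite := fun i j _ =>
  ⟨fun x v w hi => by simp [(h i).1] at hi, fun x v w hi => by simp [(h i).2] at hi⟩

theorem Config.step_of_idle {N : ℕ} {c : Config N} (h : ∀ i, (c.procs i).Idle) :
    c.step = ⟨fun i => (c.procs i).step c.shared, c.shared⟩ := by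
  have h₁ : ∀ i, (c.procs i).intRequest = none := fun i => (h i).1
  have h₂ : ∀ i, (c.procs i).realRequest = none := fun i => (h i).2
  simp [Config.step, h₁, h₂]

/-- While nobody writes, the shared memory is constant and the processors do not interact, so single
runs of equal length combine. -/
theorem CRun.lift {N : ℕ} {p : Program} {ms ms' : Fin N → Memory} {sh : Memory} {T : ℕ}
    (h : ∀ i, Run sh p (ms i) T (ms' i)) : CRun p ms sh T ms' sh := by
  intro s
  have key : ∀ t ≤ T, Config.step^[t] (⟨fun i => ⟨p :: s, ms i⟩, sh⟩ : Config N)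
      = ⟨fun i => (Processor.step sh)^[t] ⟨p :: s, ms i⟩, sh⟩ := by
    intro t
    induction t with
    | zero => intro _; rfl
    | succ t ih =>
      intro ht
      rw [Function.iterate_succ_apply', ih (by omega),
        Config.step_of_idle fun i => (h i s).2 t (by omega)]
      simp only [Function.iterate_succ_apply']
  refine ⟨?_, fun t ht => ?_⟩
  · rw [key T le_rfl]
    simp only [(h _ s).1]
  · rw [key t ht.le]
    exact Config.exclusiveWrite_of_idle fun i => (h i s).2 t ht

theorem Steps.config_single {N : ℕ} {c c' : Config N} (h : ∀ i, (c.procs i).Idle)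
    (hc : ⟨fun i => (c.procs i).step c.shared, c.shared⟩ = c') :
    Steps Config.step Config.ExclusiveWrite 1 c c' := by
  have := Steps.single (f := Config.step) (Config.exclusiveWrite_of_idle h)
  rwa [Config.step_of_idle h, hc] at this

theorem CRun.seq {N : ℕ} {p q : Program} {ms₁ ms₂ ms₃ : Fin N → Memory} {sh₁ sh₂ sh₃ : Memory}
    {S T : ℕ} (hp : CRun p ms₁ sh₁ S ms₂ sh₂) (hq : CRun q ms₂ sh₂ T ms₃ sh₃) :
    CRun (.seq p q) ms₁ sh₁ (1 + (S + T)) ms₃ sh₃ := fun s =>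
  (Steps.config_single (fun _ => ⟨rfl, rfl⟩) rfl).trans ((hp (q :: s)).trans (hq s))

theorem CRun.loop_end {N : ℕ} {ms : Fin N → Memory} {sh : Memory} {t : Test} {p : Program}
    (h : ∀ i, ¬ t.Holds (ms i)) : CRun (.loop t p) ms sh 1 ms sh := fun s =>
  Steps.config_single (fun _ => ⟨rfl, rfl⟩) (by simp [Processor.step, h])

theorem CRun.loop_step {N : ℕ} {ms₁ ms₂ ms₃ : Fin N → Memory} {sh₁ sh₂ sh₃ : Memory}
    {t : Test} {p : Program} {S T : ℕ} (h : ∀ i, t.Holds (ms₁ i)) (hp : CRun p ms₁ sh₁ S ms₂ sh₂)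
    (hl : CRun (.loop t p) ms₂ sh₂ T ms₃ sh₃) :
    CRun (.loop t p) ms₁ sh₁ (1 + S + T) ms₃ sh₃ := fun s =>
  ((Steps.config_single (c' := ⟨fun i => ⟨p :: .loop t p :: s, ms₁ i⟩, sh₁⟩)
    (fun _ => ⟨rfl, rfl⟩) (by simp [Processor.step, h])).trans (hp _)).trans (hl s)

/-- `Config.step` picks the written value by `choose`; distinct addresses leave only one candidate.
The new memory is therefore described only by what `f` does on and off the written cells. -/
theorem CRun.intWrite {N : ℕ} {ms : Fin N → Memory} {sh : Memory} {a r : ℕ}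
    (h : Function.Injective fun i => (ms i).int a) :
    ∃ f : ℕ → ℕ, CRun (.exec (.intWrite a r)) ms sh 1 ms ⟨f, sh.real⟩ ∧
      (∀ i, f ((ms i).int a) = (ms i).int r) ∧
      ∀ x, (∀ i, (ms i).int a ≠ x) → f x = sh.int x := by
  classical
  refine ⟨fun x => if h : ∃ v, ∃ i, some ((ms i).int a, (ms i).int r) = some (x, v) then h.choose
        else sh.int x, fun s => ?_, fun i => ?_, fun x hx => ?_⟩
  · have := Steps.single (f := Config.step) (ok := Config.ExclusiveWrite)
      (a := (⟨fun i => ⟨.exec (.intWrite a r) :: s, ms i⟩, sh⟩ : Config N)) ?_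
    · convert this using 1
      simp only [Config.step, Processor.intRequest, Processor.realRequest, Instr.intRequest,
        Instr.realRequest, Processor.step, Instr.exec]
      simp
    · intro i j hij
      refine ⟨fun x v w hi hj => hij ?_, fun x v w hi => ?_⟩
      · simp only [Processor.intRequest, Instr.intRequest, Option.some.injEq, Prod.mk.injEq]
          at hi hj
        exact h (hi.1.trans hj.1.symm)
      · cases hi
  · have hex : ∃ v, ∃ j, some ((ms j).int a, (ms j).int r) = some ((ms i).int a, v) :=
      ⟨_, i, rfl⟩
    simp only [dif_pos hex]
    obtain ⟨j, hj⟩ := hex.choose_spec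
    have h₁ : (ms j).int a = (ms i).int a := congrArg Prod.fst (Option.some.inj hj)
    exact (congrArg Prod.snd (Option.some.inj hj)).symm.trans (by rw [h h₁])
  · refine dif_neg ?_
    rintro ⟨v, i, hi⟩
    simp only [Option.some.injEq, Prod.mk.injEq] at hi
    exact hx i hi.1

theorem CRun.realWrite {N : ℕ} {ms : Fin N → Memory} {sh : Memory} {a r : ℕ}
    (h : Function.Injective fun i => (ms i).int a) :
    ∃ f : ℕ → ℝ, CRun (.exec (.realWrite a r)) ms sh 1 ms ⟨sh.int, f⟩ ∧
      (∀ i, f ((ms i).int a) = (ms i).real r) ∧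
      ∀ x, (∀ i, (ms i).int a ≠ x) → f x = sh.real x := by
  classical
  refine ⟨fun x => if h : ∃ v, ∃ i, some ((ms i).int a, (ms i).real r) = some (x, v) then h.choose
        else sh.real x, fun s => ?_, fun i => ?_, fun x hx => ?_⟩
  · have := Steps.single (f := Config.step) (ok := Config.ExclusiveWrite)
      (a := (⟨fun i => ⟨.exec (.realWrite a r) :: s, ms i⟩, sh⟩ : Config N)) ?_
    · convert this using 1
      simp only [Config.step, Processor.intRequest, Processor.realRequest, Instr.intRequest,
        Instr.realRequest, Processor.step, Instr.exec]
      simp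
    · intro i j hij
      refine ⟨fun x v w hi => ?_, fun x v w hi hj => hij ?_⟩
      · cases hi
      · simp only [Processor.realRequest, Instr.realRequest, Option.some.injEq, Prod.mk.injEq]
          at hi hj
        exact h (hi.1.trans hj.1.symm)
  · have hex : ∃ v, ∃ j, some ((ms j).int a, (ms j).real r) = some ((ms i).int a, v) :=
      ⟨_, i, rfl⟩
    simp only [dif_pos hex]
    obtain ⟨j, hj⟩ := hex.choose_spec
    have h₁ : (ms j).int a = (ms i).int a := congrArg Prod.fst (Option.some.inj hj)
    exact (congrArg Prod.snd (Option.some.inj hj)).symm.trans (by rw [h h₁])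
  · refine dif_neg ?_
    rintro ⟨v, i, hi⟩
    simp only [Option.some.injEq, Prod.mk.injEq] at hi
    exact hx i hi.1

/-- Started on all processors in lockstep, the statement `s` takes the time announced for the
iteration counts `β`, obeys the exclusive-write rule, and establishes `Q`. -/
def cwp {N : ℕ} (β : ℕ → ℕ) (s : Stmt) (Q : (Fin N → Memory) → Memory → Prop)
    (ms : Fin N → Memory) (sh : Memory) : Prop :=
  ∃ ms' sh', CRun s.code ms sh (s.time β) ms' sh' ∧ Q ms' sh'

section
variable {N : ℕ} {β : ℕ → ℕ} {Q R : (Fin N → Memory) → Memory → Prop} {ms : Fin N → Memory}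
  {sh : Memory}

theorem cwp.mono {s : Stmt} (h : cwp β s R ms sh) (hQ : ∀ ms' sh', R ms' sh' → Q ms' sh') :
    cwp β s Q ms sh :=
  let ⟨_, _, h₁, h₂⟩ := h
  ⟨_, _, h₁, hQ _ _ h₂⟩

theorem cwp_lift {s : Stmt} (I : Fin N → Memory → Prop) (h : ∀ i, wp sh β s (I i) (ms i))
    (hQ : ∀ ms', (∀ i, I i (ms' i)) → Q ms' sh) : cwp β s Q ms sh := by
  choose ms' h₁ h₂ using h
  exact ⟨ms', sh, CRun.lift h₁, hQ _ h₂⟩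

theorem cwp_seq {a b : Stmt} (h : cwp β a (cwp β b Q) ms sh) : cwp β (a ;; b) Q ms sh :=
  let ⟨_, _, h₁, _, _, h₂, h₃⟩ := h
  ⟨_, _, h₁.seq h₂, h₃⟩

theorem cwp_intWrite {a r : ℕ} (h : Function.Injective fun i => (ms i).int a)
    (hQ : ∀ f : ℕ → ℕ, (∀ i, f ((ms i).int a) = (ms i).int r) →
      (∀ x, (∀ i, (ms i).int a ≠ x) → f x = sh.int x) → Q ms ⟨f, sh.real⟩) :
    cwp β (.instr (.intWrite a r)) Q ms sh :=
  let ⟨f, h₁, h₂, h₃⟩ := CRun.intWrite (r := r) (sh := sh) h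
  ⟨_, _, h₁, hQ f h₂ h₃⟩

theorem cwp_realWrite {a r : ℕ} (h : Function.Injective fun i => (ms i).int a)
    (hQ : ∀ f : ℕ → ℝ, (∀ i, f ((ms i).int a) = (ms i).real r) →
      (∀ x, (∀ i, (ms i).int a ≠ x) → f x = sh.real x) → Q ms ⟨sh.int, f⟩) :
    cwp β (.instr (.realWrite a r)) Q ms sh :=
  let ⟨f, h₁, h₂, h₃⟩ := CRun.realWrite (r := r) (sh := sh) h
  ⟨_, _, h₁, hQ f h₂ h₃⟩

theorem cwp_loop {κ : ℕ} {t : Test} {s : Stmt} (I : ℕ → (Fin N → Memory) → Memory → Prop)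
    (hstep : ∀ i < β κ, ∀ ms sh, I i ms sh →
      (∀ j, t.Holds (ms j)) ∧ cwp β s (I (i + 1)) ms sh)
    (hend : ∀ ms sh, I (β κ) ms sh → ∀ j, ¬ t.Holds (ms j)) (h0 : I 0 ms sh)
    (hQ : ∀ ms sh, I (β κ) ms sh → Q ms sh) : cwp β (.loop κ t s) Q ms sh := by
  suffices ∀ c i ms sh, i + c = β κ → I i ms sh →
      ∃ ms' sh', CRun (.loop t s.code) ms sh (c * (1 + s.time β) + 1) ms' sh' ∧
        I (β κ) ms' sh' by
    obtain ⟨ms', sh', h₁, h₂⟩ := this (β κ) 0 ms sh (by simp) h0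
    exact ⟨ms', sh', h₁, hQ _ _ h₂⟩
  intro c
  induction c with
  | zero =>
    intro i ms sh hi hm
    obtain rfl : i = β κ := by omega
    exact ⟨ms, sh, by simpa using CRun.loop_end (hend ms sh hm), hm⟩
  | succ c ih =>
    intro i ms sh hi hm
    obtain ⟨ht, ms₁, sh₁, h₁, h₂⟩ := hstep i (by omega) ms sh hm
    obtain ⟨ms₂, sh₂, h₃, h₄⟩ := ih (i + 1) ms₁ sh₁ (by omega) h₂
    exact ⟨ms₂, sh₂, fun s' => ((CRun.loop_step ht h₁ h₃) s').cast (by ring), h₄⟩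

theorem ComputesInTime.of_cwp {s : Stmt} {input : Memory}
    (h : cwp β s Q (fun i : Fin N => { int := fun a => if a = 0 then i else 0, real := fun _ => 0 })
      input) :
    ∃ m ms', ComputesInTime s.code N input (s.time β) m ∧ Q ms' m := by
  obtain ⟨ms', sh', h₁, h₂⟩ := h
  have h := h₁ []
  refine ⟨sh', ms', ⟨h.2, fun i => ?_, ?_⟩, h₂⟩
  · have := h.1
    rw [initial, this]
  · have := h.1
    rw [initial, this]

end

end PRAM

/-! ### Local search by single swaps for discrete `k`-means -/

namespace KMeans

open Finset Function

section LocalSearch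

variable {E ι κ : Type*} [PseudoMetricSpace E] [Fintype ι] [Fintype κ]

/-- The squared distance from a point to the nearest of the centers `s`. -/
noncomputable def sqDist (s : κ → E) (x : E) : ℝ := ⨅ j, dist x (s j) ^ 2

/-- The `k`-means cost of the centers `s` for the points `x` with weights `w`. -/
noncomputable def wcost (w : ι → ℝ) (x : ι → E) (s : κ → E) : ℝ := ∑ u, w u * sqDist s (x u)

theorem sqDist_nonneg {E κ : Type*} [PseudoMetricSpace E] (s : κ → E) (x : E) : 0 ≤ sqDist s x :=
  Real.iInf_nonneg fun _ => sq_nonneg _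

theorem sqDist_le (s : κ → E) (x : E) (j : κ) : sqDist s x ≤ dist x (s j) ^ 2 :=
  ciInf_le (Set.finite_range _).bddBelow j

theorem exists_sqDist_eq [Nonempty κ] (s : κ → E) (x : E) : ∃ j, sqDist s x = dist x (s j) ^ 2 :=
  let ⟨j, hj⟩ := exists_eq_ciInf_of_finite (f := fun j => dist x (s j) ^ 2)
  ⟨j, hj.symm⟩

theorem wcost_nonneg {κ : Type*} {w : ι → ℝ} (hw : ∀ u, 0 ≤ w u) (x : ι → E) (s : κ → E) :
    0 ≤ wcost w x s :=
  sum_nonneg fun u _ => mul_nonneg (hw u) (sqDist_nonneg _ _)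

/-- The swap pairing: every `q` is matched with some `f q` that no other `q'` has as its image
under `η`, and nothing is used more than twice. -/
theorem exists_swap_pairing [DecidableEq κ] (η : κ → κ) :
    ∃ f : κ → κ, (∀ p, #{q | f q = p} ≤ 2) ∧ ∀ q q', η q' = f q → q' = q := by
  classical
  set A : Finset κ := {q | ∀ q', η q' = η q → q' = q} with hA
  set Z : Finset κ := (univ.image η)ᶜ with hZ
  -- On `Aᶜ` the map `η` is at least two-to-one, so its image misses at least half as many elements
  -- as `Aᶜ` has. Thus the elements of `Aᶜ` can be placed on `Z`, at most two on each, while `q ∈ A`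
  -- is matched with `η q`.
  have hcard : #Aᶜ ≤ #(Z ×ˢ (univ : Finset (Fin 2))) := by
    have h1 : 2 * #(Aᶜ.image η) ≤ #Aᶜ := by
      refine mul_card_image_le_card _ _ fun p hp => ?_
      obtain ⟨q, hq, rfl⟩ := mem_image.1 hp
      have hq' : ∃ q', η q' = η q ∧ q' ≠ q := by simpa [hA] using hq
      obtain ⟨q', h, hne⟩ := hq'
      refine one_lt_card.2 ⟨q, by simp [hq], q', ?_, hne.symm⟩
      simp only [mem_filter, h, and_true, hA, mem_compl, mem_univ, true_and]
      exact fun hall => hne (hall q rfl).symm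
    have h2 : #(univ.image η) ≤ #A + #(Aᶜ.image η) := by
      rw [← union_compl A, image_union]
      exact (card_union_le _ _).trans (Nat.add_le_add_right card_image_le _)
    have h3 := card_add_card_compl (univ.image η)
    have h4 := card_add_card_compl A
    rw [card_product, card_univ, Fintype.card_fin]
    change #(univ.image η) + #Z = _ at h3
    omega
  obtain ⟨e⟩ : Nonempty ((Aᶜ : Finset κ) ↪ (Z ×ˢ (univ : Finset (Fin 2)) : Finset _)) :=
    Function.Embedding.nonempty_of_card_le (by simpa only [Fintype.card_coe] using hcard)
  have hmem : ∀ q (h : q ∈ Aᶜ), (e ⟨q, h⟩).1.1 ∈ Z := fun q h =>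
    (mem_product.1 (e ⟨q, h⟩).2).1
  refine ⟨fun q => if h : q ∈ Aᶜ then (e ⟨q, h⟩).1.1 else η q, fun p => ?_, fun q q' h => ?_⟩
  · by_cases hp : p ∈ Z
    · have : #{q | (if h : q ∈ Aᶜ then (e ⟨q, h⟩).1.1 else η q) = p} ≤
          #(univ : Finset (Fin 2)) := by
        refine card_le_card_of_injOn
          (fun q => if h : q ∈ Aᶜ then (e ⟨q, h⟩).1.2 else 0) (by simp) ?_
        have key : ∀ q, (if h : q ∈ Aᶜ then (e ⟨q, h⟩).1.1 else η q) = p → q ∈ Aᶜ := by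
          intro q hq
          by_contra h
          rw [dif_neg h] at hq
          exact (mem_compl.1 hp) (mem_image.2 ⟨q, mem_univ _, hq⟩)
        intro q hq q' hq' hqq
        simp only [coe_filter, mem_univ, true_and, Set.mem_ofPred_eq] at hq hq'
        have h := key q hq
        have h' := key q' hq'
        simp only [dif_pos h, dif_pos h'] at hq hq' hqq
        have : (⟨q, h⟩ : (Aᶜ : Finset κ)) = ⟨q', h'⟩ :=
          e.injective (Subtype.ext (Prod.ext (hq.trans hq'.symm) hqq))
        simpa using this
      simpa using this
    · refine (card_le_one.2 fun q hq q' hq' => ?_).trans one_le_two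
      have key : ∀ q, (if h : q ∈ Aᶜ then (e ⟨q, h⟩).1.1 else η q) = p → q ∈ A ∧ η q = p := by
        intro q hq
        by_cases h : q ∈ Aᶜ
        · rw [dif_pos h] at hq
          exact absurd (hq ▸ hmem q h) hp
        · rw [dif_neg h] at hq
          exact ⟨by simpa using h, hq⟩
      obtain ⟨h1, h2⟩ := key q (by simpa using hq)
      obtain ⟨h3, h4⟩ := key q' (by simpa using hq')
      exact (mem_filter.1 h3).2 q (h2.trans h4.symm)
  · by_cases hq : q ∈ Aᶜ
    · simp only [dif_pos hq] at h
      exact absurd (mem_image.2 ⟨q', mem_univ _, h⟩) (mem_compl.1 (hmem q hq))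
    · simp only [dif_neg hq] at h
      have : q ∈ A := by simpa using hq
      exact (mem_filter.1 this).2 q' h

/-- The swaps put in `o q` for `s (f q)`, and the costs are summed point by point. A point whose
nearest centers are `a u` in `s` and `b u` in `o` is served by its center in `o` for `q = b u`. For
other `q` it can lose only if `a u` is removed, which happens at most twice. It then moves to `η (b
u)`, the center of `s` nearest to `o (b u)`, which the pairing does not remove. -/
theorem exists_pairing_sum_wcost_le [DecidableEq κ] [Nonempty κ] {w : ι → ℝ} (hw : ∀ u, 0 ≤ w u)
    (x : ι → E) (s o : κ → E) :
    ∃ f : κ → κ, ∑ q, wcost w x (update s (f q) (o q)) ≤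
      Fintype.card κ * wcost w x s + 41 * wcost w x o - wcost w x s / 2 := by
  choose a ha using fun u => exists_sqDist_eq s (x u)
  choose b hb using fun u => exists_sqDist_eq o (x u)
  choose η hη using fun q => exists_sqDist_eq s (o q)
  obtain ⟨f, hf, hfη⟩ := exists_swap_pairing η
  refine ⟨f, ?_⟩
  have main : ∀ u, ∑ q, sqDist (update s (f q) (o q)) (x u) ≤
      Fintype.card κ * sqDist s (x u) + 41 * sqDist o (x u) - sqDist s (x u) / 2 := by
    intro u
    set S := sqDist s (x u)
    set O := sqDist o (x u)
    have hS : 0 ≤ S := sqDist_nonneg _ _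
    have hO : 0 ≤ O := sqDist_nonneg _ _
    have hq : ∀ q, sqDist (update s (f q) (o q)) (x u) ≤
        S + (if q = b u then O - S else 0) + (if f q = a u then 20 * O + S / 4 else 0) := by
      intro q
      have hpos : 0 ≤ (if f q = a u then 20 * O + S / 4 else 0) := by split_ifs <;> positivity
      by_cases h1 : q = b u
      · have := sqDist_le (update s (f q) (o q)) (x u) (f q)
        rw [update_self] at this
        have h2 : O = dist (x u) (o q) ^ 2 := h1 ▸ hb u
        rw [if_pos h1]
        linarith
      rw [if_neg h1, add_zero]
      by_cases h2 : f q = a u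
      · rw [if_pos h2]
        have hne : η (b u) ≠ f q := fun h => h1 (hfη _ _ h).symm
        have h3 := sqDist_le (update s (f q) (o q)) (x u) (η (b u))
        rw [update_of_ne hne] at h3
        have h4 : dist (o (b u)) (s (η (b u))) ≤ dist (o (b u)) (s (a u)) := by
          have := (hη (b u)).symm.trans_le (sqDist_le s (o (b u)) (a u))
          exact (sq_le_sq₀ dist_nonneg dist_nonneg).1 this
        have h5 : dist (x u) (s (η (b u))) ≤
            2 * dist (x u) (o (b u)) + dist (x u) (s (a u)) := by
          have t1 := dist_triangle (x u) (o (b u)) (s (η (b u)))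
          have t2 := dist_triangle (o (b u)) (x u) (s (a u))
          rw [dist_comm (o (b u)) (x u)] at t2
          linarith
        have h6 := pow_le_pow_left₀ dist_nonneg h5 2
        have e1 : S = dist (x u) (s (a u)) ^ 2 := ha u
        have e2 : O = dist (x u) (o (b u)) ^ 2 := hb u
        rw [e1, e2]
        -- `(2a + b)² ≤ 20a² + b² + b²/4` amounts to `0 ≤ (8a - b)² / 4`.
        nlinarith [sq_nonneg (8 * dist (x u) (o (b u)) - dist (x u) (s (a u)))]
      · rw [if_neg h2, add_zero]
        have := sqDist_le (update s (f q) (o q)) (x u) (a u)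
        rw [update_of_ne (Ne.symm h2)] at this
        exact this.trans (ha u).ge
    refine (sum_le_sum fun q _ => hq q).trans ?_
    rw [sum_add_distrib, sum_add_distrib, sum_ite_eq' univ (b u), if_pos (mem_univ _),
      ← sum_filter, sum_const, sum_const, nsmul_eq_mul, nsmul_eq_mul, card_univ]
    have h2 : ((#{q | f q = a u} : ℕ) : ℝ) ≤ 2 := by exact_mod_cast hf (a u)
    -- `k S + (O - S) + 2 (20 O + S/4) = k S + 41 O - S/2`.
    nlinarith [mul_le_mul_of_nonneg_right h2 (by positivity : (0 : ℝ) ≤ 20 * O + S / 4)]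
  unfold wcost
  rw [sum_comm]
  calc ∑ u, ∑ q, w u * sqDist (update s (f q) (o q)) (x u)
      = ∑ u, w u * ∑ q, sqDist (update s (f q) (o q)) (x u) := by simp only [mul_sum]
    _ ≤ ∑ u, w u * (Fintype.card κ * sqDist s (x u) + 41 * sqDist o (x u) - sqDist s (x u) / 2) :=
        sum_le_sum fun u _ => mul_le_mul_of_nonneg_left (main u) (hw u)
    _ = _ := by
        rw [mul_sum, mul_sum, sum_div, ← sum_add_distrib, ← sum_sub_distrib]
        exact sum_congr rfl fun u _ => by ring

/-- Moving every center to the nearest data point costs a factor of at most `4`. -/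
theorem exists_discrete [Nonempty ι] [Nonempty κ] {w : ι → ℝ} (hw : ∀ u, 0 ≤ w u) (x : ι → E)
    (C : κ → E) : ∃ o : κ → ι, wcost w x (x ∘ o) ≤ 4 * wcost w x C := by
  choose o ho using fun j => Finite.exists_min fun u => dist (x u) (C j)
  refine ⟨o, ?_⟩
  unfold wcost
  rw [mul_sum]
  refine sum_le_sum fun u _ => ?_
  obtain ⟨j, hj⟩ := exists_sqDist_eq C (x u)
  have h1 := sqDist_le (x ∘ o) (x u) j
  -- The data point replacing `C j` is at least as close to `C j` as `x u` is.
  have h2 : dist (x u) (x (o j)) ≤ 2 * dist (x u) (C j) := by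
    have := dist_triangle_right (x u) (x (o j)) (C j)
    linarith [ho j u]
  have h3 := pow_le_pow_left₀ dist_nonneg h2 2
  have h4 : sqDist (x ∘ o) (x u) ≤ 4 * sqDist C (x u) := by
    rw [hj]
    simp only [comp_apply] at h1
    nlinarith
  nlinarith [mul_le_mul_of_nonneg_left h4 (hw u)]

theorem one_sub_inv_pow_le_half {a : ℕ} (ha : 0 < a) : (1 - 1 / (a : ℝ)) ^ a ≤ 1 / 2 := by
  have ha' : (1 : ℝ) ≤ a := by exact_mod_cast ha
  have h0 : 0 ≤ 1 - 1 / (a : ℝ) := by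
    rw [sub_nonneg, div_le_one (by linarith)]
    exact ha'
  have h1 : 1 - 1 / (a : ℝ) ≤ Real.exp (-(1 / a)) := by
    have := Real.add_one_le_exp (-(1 / (a : ℝ)))
    linarith
  refine (pow_le_pow_left₀ h0 h1 a).trans ?_
  rw [← Real.exp_nat_mul]
  have : (a : ℝ) * -(1 / a) = -1 := by field_simp
  rw [this, Real.exp_neg, inv_eq_one_div]
  have := Real.exp_one_gt_d9
  exact one_div_le_one_div_of_le (by norm_num) (by linarith)

/-- The number of iterations of the local search for `m` points and `k` centers. -/
def numSwaps (k m : ℕ) : ℕ := (m * (m + k) + 1) * (4 * k * m)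

/-- Sufficiently many best swaps lead from any initial centers to a good solution. -/
theorem wcost_le_of_best_swaps [DecidableEq κ] [Nonempty ι] [Nonempty κ] {w : ι → ℝ}
    (hw : ∀ u, 0 ≤ w u) (x : ι → E) (s : ℕ → κ → E) {T : ℕ}
    (hT : T = numSwaps (Fintype.card κ) (Fintype.card ι))
    (hs : ∀ t < T, ∃ p u, s (t + 1) = update (s t) p (x u))
    (hbest : ∀ t < T, ∀ p u, wcost w x (s (t + 1)) ≤ wcost w x (update (s t) p (x u)))
    (C : κ → E) : wcost w x (s T) ≤ 656 * wcost w x C := by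
  obtain ⟨o, ho⟩ := exists_discrete hw x C
  suffices h : wcost w x (s T) ≤ 164 * wcost w x (x ∘ o) by linarith
  set m := Fintype.card ι
  set k := Fintype.card κ
  have hm : 0 < m := Fintype.card_pos
  have hk : 0 < k := Fintype.card_pos
  have hkR : (1 : ℝ) ≤ k := by exact_mod_cast hk
  set O := wcost w x (x ∘ o)
  have hO : 0 ≤ O := wcost_nonneg hw _ _
  set S : ℕ → ℝ := fun t => wcost w x (s t) with hS
  -- The best swap is at most as expensive as each of the `k` paired swaps.
  have hstep : ∀ t < T, k * S (t + 1) ≤ k * S t + 41 * O - S t / 2 := by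
    intro t ht
    obtain ⟨f, hf⟩ := exists_pairing_sum_wcost_le hw x (s t) (x ∘ o)
    refine le_trans ?_ hf
    calc (k : ℝ) * S (t + 1) = ∑ _q : κ, S (t + 1) := by simp [k]
      _ ≤ _ := sum_le_sum fun q _ => hbest t ht (f q) (o q)
  by_contra! hcon
  -- A cost of at most `164 * O` would persist, since `(k - 1/2) * 164 + 41 ≤ 164 * k`. So if the
  -- final cost is larger, all earlier ones are.
  have hbig : ∀ i ≤ T, 164 * O < S (T - i) := by
    intro i
    induction i with
    | zero => intro _; exact hcon
    | succ i ih =>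
      intro hi
      have h1 := ih (by omega)
      have h2 := hstep (T - (i + 1)) (by omega)
      rw [show T - (i + 1) + 1 = T - i by omega] at h2
      by_contra! h3
      nlinarith
  have hbig' : ∀ t ≤ T, 164 * O < S t := fun t ht => by
    have := hbig (T - t) (by omega)
    rwa [show T - (T - t) = t by omega] at this
  set r : ℝ := 1 - 1 / ((4 * k : ℕ) : ℝ) with hr
  have hr0 : 0 ≤ r := by
    rw [hr, sub_nonneg, div_le_one (by positivity)]
    push_cast
    linarith
  -- Now `41 * O < S t / 4`, so half of the gain `S t / 2` remains.
  have hdec : ∀ t < T, S (t + 1) ≤ r * S t := by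
    intro t ht
    have h1 := hstep t ht
    have h2 := hbig' t ht.le
    have h3 : (k : ℝ) * (r * S t) = k * S t - S t / 4 := by
      rw [hr]
      push_cast
      field_simp
    have h4 : (k : ℝ) * S (t + 1) ≤ k * (r * S t) := by linarith
    exact le_of_mul_le_mul_left h4 (by linarith)
  have hdec' : ∀ i t, t + i ≤ T → S (t + i) ≤ r ^ i * S t := by
    intro i
    induction i with
    | zero => intro t _; simp
    | succ i ih =>
      intro t ht
      calc S (t + (i + 1)) ≤ r * S (t + i) := hdec (t + i) (by omega)
        _ ≤ r * (r ^ i * S t) := mul_le_mul_of_nonneg_left (ih t (by omega)) hr0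
        _ = _ := by ring
  -- The largest term `v t` of the cost is within a factor `m` of the cost but has only few possible
  -- values.
  choose z hz using fun t => Finite.exists_max fun u => w u * sqDist (s t) (x u)
  set v : ℕ → ℝ := fun t => w (z t) * sqDist (s t) (x (z t)) with hv
  have hv1 : ∀ t, v t ≤ S t := fun t =>
    single_le_sum (f := fun u => w u * sqDist (s t) (x u))
      (fun u _ => mul_nonneg (hw u) (sqDist_nonneg _ _)) (mem_univ (z t))
  have hv2 : ∀ t, S t ≤ m * v t := fun t => by
    calc S t ≤ ∑ _u : ι, v t := sum_le_sum fun u _ => hz t u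
      _ = _ := by simp [m]
  -- In `4 * k * m` swaps the cost shrinks by at least `2 ^ m`, more than the factor `m` by which it
  -- can exceed its largest term.
  have hτ : ∀ i t, 0 < i → t + i * (4 * k * m) ≤ T → v (t + i * (4 * k * m)) < v t := by
    intro i t hi ht
    have hpos : 0 < S t := by
      have := hbig' t (by omega)
      linarith
    have h1 := hdec' _ t ht
    have h2 : r ^ (i * (4 * k * m)) ≤ (1 / 2) ^ m := by
      calc r ^ (i * (4 * k * m)) ≤ r ^ (4 * k * m) :=
            pow_le_pow_of_le_one hr0 (by rw [hr]; simp) (by nlinarith [Nat.zero_le (4 * k * m)])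
        _ = (r ^ (4 * k)) ^ m := by rw [pow_mul]
        _ ≤ (1 / 2) ^ m :=
            pow_le_pow_left₀ (pow_nonneg hr0 _) (one_sub_inv_pow_le_half (by omega)) _
    have h3 : (1 / 2 : ℝ) ^ m * m < 1 := by
      have : (m : ℝ) < 2 ^ m := by exact_mod_cast Nat.lt_two_pow_self
      rw [one_div, inv_pow, inv_mul_lt_iff₀ (by positivity)]
      linarith
    have hm' : (0 : ℝ) < m := by exact_mod_cast hm
    have h4 : v (t + i * (4 * k * m)) ≤ (1 / 2) ^ m * S t :=
      (hv1 _).trans (h1.trans (mul_le_mul_of_nonneg_right h2 hpos.le))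
    have h5 : (1 / 2) ^ m * S t ≤ (1 / 2 : ℝ) ^ m * m * v t := by
      rw [mul_assoc]
      exact mul_le_mul_of_nonneg_left (hv2 t) (by positivity)
    have h6 : 0 < v t := by
      by_contra! h
      nlinarith [hv2 t]
    nlinarith
  -- At all times every center is a data point or an initial center.
  set V : Finset ℝ := univ.image fun y : ι × (ι ⊕ κ) =>
    w y.1 * dist (x y.1) (Sum.elim x (s 0) y.2) ^ 2 with hV
  have hVcard : #V ≤ m * (m + k) := by
    refine card_image_le.trans ?_
    simp [m, k]
  have hsmem : ∀ t ≤ T, ∀ p, ∃ y : ι ⊕ κ, s t p = Sum.elim x (s 0) y := by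
    intro t
    induction t with
    | zero => exact fun _ p => ⟨.inr p, rfl⟩
    | succ t ih =>
      intro ht p
      obtain ⟨p', u, h⟩ := hs t (by omega)
      by_cases hp : p = p'
      · exact ⟨.inl u, by rw [h, hp, update_self, Sum.elim_inl]⟩
      · rw [h, update_of_ne hp]
        exact ih (by omega) p
  have hvmem : ∀ t ≤ T, v t ∈ V := by
    intro t ht
    obtain ⟨j, hj⟩ := exists_sqDist_eq (s t) (x (z t))
    obtain ⟨y, hy⟩ := hsmem t ht j
    exact mem_image.2 ⟨(z t, y), mem_univ _, by simp only [hv, hj, hy]⟩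
  have hle : ∀ i < m * (m + k) + 1, i * (4 * k * m) ≤ T := fun i hi => by
    rw [hT]
    exact Nat.mul_le_mul_right _ (by omega)
  -- The `m * (m + k) + 1` phase boundaries are too many for strictly decreasing values in `V`.
  obtain ⟨i, hi, j, hj, hne, heq⟩ := exists_ne_map_eq_of_card_lt_of_maps_to
    (s := range (m * (m + k) + 1)) (t := V) (f := fun i => v (i * (4 * k * m)))
    (by rw [card_range]; omega) (fun i hi => hvmem _ (hle i (by simpa using hi)))
  have key : ∀ i j, i < j → j < m * (m + k) + 1 →
      v (j * (4 * k * m)) < v (i * (4 * k * m)) := by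
    intro i j hij hj
    have := hτ (j - i) (i * (4 * k * m)) (by omega)
    rw [← add_mul, show i + (j - i) = j by omega] at this
    exact this (hle j hj)
  rw [mem_range] at hi hj
  rcases lt_or_gt_of_ne hne with h | h
  · exact (key i j h hj).ne' heq
  · exact (key j i h hi).ne heq

end LocalSearch

end KMeans

/-! ### Summaries of sets of points by weighted points -/

namespace KMeans

open Finset Function

/-- The first index below `k` at which `D` is minimal. -/
noncomputable def near (D : ℕ → ℝ) : ℕ → ℕ
  | 0 => 0
  | i + 1 => open Classical in if i = 0 ∨ D i < D (near D i) then i else near D i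

/-- Ties go to the first index. The strict inequality is what later detects repeated centers: `j` is
a repetition if the nearest center to center `j` has a smaller index. -/
theorem near_spec (D : ℕ → ℝ) {k : ℕ} (hk : 0 < k) :
    near D k < k ∧ (∀ j < k, D (near D k) ≤ D j) ∧ ∀ j < near D k, D (near D k) < D j := by
  induction k, hk using Nat.le_induction with
  | base => simp [near]
  | succ k hk ih =>
    obtain ⟨h1, h2, h3⟩ := ih
    have hk' : k ≠ 0 := by omega
    simp only [near, hk', false_or]
    split_ifs with h
    · exact ⟨by omega, fun j hj => (Nat.lt_succ_iff_lt_or_eq.1 hj).elim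
        (fun hj => h.le.trans (h2 j hj)) fun hj => hj ▸ le_rfl, fun j hj => h.trans_le (h2 j hj)⟩
    · exact ⟨by omega, fun j hj => (Nat.lt_succ_iff_lt_or_eq.1 hj).elim (h2 j)
        fun hj => by rw [hj]; exact not_lt.1 h, h3⟩

variable {E : Type*} [PseudoMetricSpace E]

/-- The weighted points with indices `f 0, f 2, …` and weights `f 1, f 3, …` (`M` of them)
represent the points of `P`, at a cost of at most `α` times that of any `k` centers. -/
def IsSummary (pt : ℕ → E) (k M : ℕ) (α : ℝ) (P : Finset ℕ) (f : ℕ → ℕ) : Prop :=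
  ∃ σ : ℕ → ℕ, (∀ i ∈ P, σ i < M) ∧ (∀ j < M, f (2 * j + 1) = #{i ∈ P | σ i = j}) ∧
    ∀ C : Fin k → E, ∑ i ∈ P, dist (pt i) (pt (f (2 * σ i))) ^ 2 ≤
      α * ∑ i ∈ P, sqDist C (pt i)

variable {pt : ℕ → E} {k M m g : ℕ} {α : ℝ} {P : Finset ℕ} {f F : ℕ → ℕ}

theorem IsSummary.congr (h : IsSummary pt k M α P f) (hf : ∀ x < 2 * M, F x = f x) :
    IsSummary pt k M α P F := by
  obtain ⟨σ, h1, h2, h3⟩ := h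
  refine ⟨σ, h1, fun j hj => by rw [hf _ (by omega), h2 j hj], fun C => ?_⟩
  refine (sum_congr rfl fun i hi => ?_).trans_le (h3 C)
  rw [hf _ (by have := h1 i hi; omega)]

theorem IsSummary.mono {α' : ℝ} (h : IsSummary pt k M α P f) (hα : α ≤ α') :
    IsSummary pt k M α' P f := by
  obtain ⟨σ, h1, h2, h3⟩ := h
  exact ⟨σ, h1, h2, fun C => (h3 C).trans (mul_le_mul_of_nonneg_right hα
    (sum_nonneg fun _ _ => sqDist_nonneg _ _))⟩

/-- Only the weights have to vanish; the indices stored in an empty node are irrelevant. -/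
theorem isSummary_empty (hf : ∀ j < M, f (2 * j + 1) = 0) : IsSummary pt k M α ∅ f :=
  ⟨fun _ => 0, by simp, fun j hj => by simp [hf j hj], by simp⟩

theorem isSummary_singleton {q : ℕ} (hM : 0 < M) (hα : 0 ≤ α) (h0 : f 0 = q) (h1 : f 1 = 1)
    (hf : ∀ j < M, j ≠ 0 → f (2 * j + 1) = 0) : IsSummary pt k M α {q} f := by
  refine ⟨fun _ => 0, by simpa, fun j hj => ?_, fun C => ?_⟩
  · by_cases h : j = 0
    · subst h
      simpa using h1
    · simpa [filter_singleton, Ne.symm h] using hf j hj h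
  · simpa [h0] using mul_nonneg hα (sqDist_nonneg C (pt q))

/-- Summaries of the parts of a partition are concatenated to a summary of the whole. -/
theorem IsSummary.concat (c : ℕ → ℕ) (hc : ∀ i ∈ P, c i < g)
    (h : ∀ r < g, IsSummary pt k M α {i ∈ P | c i = r} fun x => F (2 * (r * M) + x)) :
    IsSummary pt k (g * M) α P F := by
  choose! σ h1 h2 h3 using h
  have hσ : ∀ i ∈ P, σ (c i) i < M := fun i hi => h1 (c i) (hc i hi) i (by simp [hi])
  -- Item `r * M + j` of the concatenation is item `j` of part `r`; division by `M` recovers both.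
  refine ⟨fun i => c i * M + σ (c i) i, fun i hi => ?_, fun u hu => ?_, fun C => ?_⟩
  · calc c i * M + σ (c i) i < (c i + 1) * M := by
          have := hσ i hi
          linarith
      _ ≤ g * M := Nat.mul_le_mul_right _ (hc i hi)
  · have hM : 0 < M := Nat.pos_of_ne_zero fun h => by simp [h] at hu
    have hr : u / M < g := (Nat.div_lt_iff_lt_mul hM).2 hu
    have := h2 (u / M) hr (u % M) (Nat.mod_lt _ hM)
    beta_reduce at this
    rw [show 2 * (u / M * M) + (2 * (u % M) + 1) = 2 * u + 1 by
      have := Nat.div_add_mod u M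
      rw [mul_comm M] at this
      omega] at this
    rw [this, filter_filter]
    congr 1
    refine filter_congr fun i hi => ⟨?_, ?_⟩
    · rintro ⟨h4, h5⟩
      beta_reduce
      rw [h4, h5, mul_comm]
      exact Nat.div_add_mod u M
    · intro h4
      beta_reduce at h4
      have h5 := hσ i hi
      have h6 : u / M = c i := by
        rw [← h4, mul_comm, Nat.mul_add_div hM, Nat.div_eq_of_lt h5, add_zero]
      have h7 : u % M = σ (c i) i := by
        rw [← h4, mul_comm, Nat.mul_add_mod, Nat.mod_eq_of_lt h5]
      rw [h6, h7]
      exact ⟨rfl, rfl⟩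
  · rw [← sum_fiberwise_of_maps_to (s := P) (t := range g) (g := c)
      (fun i hi => mem_range.2 (hc i hi)),
      ← sum_fiberwise_of_maps_to (s := P) (t := range g) (g := c)
      (fun i hi => mem_range.2 (hc i hi)), mul_sum]
    refine sum_le_sum fun r hr => le_trans (le_of_eq ?_) (h3 r (mem_range.1 hr) C)
    refine sum_congr rfl fun i hi => ?_
    simp only [(mem_filter.1 hi).2]
    rw [mul_add]

/-- The cost of the centers with indices `c 0, …, c (k - 1)` for the `m` weighted points `F`. -/
noncomputable def itemCost (D : ℕ → ℕ → ℝ) (k m : ℕ) (F c : ℕ → ℕ) : ℝ :=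
  ∑ u ∈ range m, (F (2 * u + 1) : ℝ) *
    D (F (2 * u)) (c (near (fun j => D (F (2 * u)) (c j)) k))

/-- `c'` is obtained from `c` by a cheapest swap. -/
def BestSwap (D : ℕ → ℕ → ℝ) (k m : ℕ) (F c c' : ℕ → ℕ) : Prop :=
  (∃ p < k, ∃ u < m, c' = update c p (F (2 * u))) ∧
    ∀ p < k, ∀ u < m, itemCost D k m F c' ≤ itemCost D k m F (update c p (F (2 * u)))

/-- `f` describes `k` centers obtained by local search from the `m` weighted points `F`, weighted
by the total weights of the points assigned to them. -/
def IsReduction (D : ℕ → ℕ → ℝ) (k m : ℕ) (F f : ℕ → ℕ) : Prop :=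
  ∃ s : ℕ → ℕ → ℕ, (∀ t < numSwaps k m, BestSwap D k m F (s t) (s (t + 1))) ∧
    ∀ j < k, f (2 * j) = s (numSwaps k m) j ∧
      f (2 * j + 1) = ∑ u ∈ range m,
        if near (fun j => D (F (2 * u)) (s (numSwaps k m) j)) k = j then F (2 * u + 1) else 0

theorem IsReduction.congr {D : ℕ → ℕ → ℝ} {f' : ℕ → ℕ} (h : IsReduction D k m F f)
    (hf : ∀ x < 2 * k, f' x = f x) : IsReduction D k m F f' := by
  obtain ⟨s, h1, h2⟩ := h
  refine ⟨s, h1, fun j hj => ?_⟩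
  rw [hf _ (by omega), hf _ (by omega)]
  exact h2 j hj

theorem sqDist_eq_near (hk : 0 < k) (c : ℕ → ℕ) (a : ℕ) :
    sqDist (fun j : Fin k => pt (c j)) (pt a) =
      dist (pt a) (pt (c (near (fun j => dist (pt a) (pt (c j)) ^ 2) k))) ^ 2 := by
  obtain ⟨h1, h2, _⟩ := near_spec (fun j => dist (pt a) (pt (c j)) ^ 2) hk
  have : Nonempty (Fin k) := ⟨⟨0, hk⟩⟩
  exact le_antisymm (sqDist_le (fun j : Fin k => pt (c j)) (pt a) ⟨_, h1⟩)
    (le_ciInf fun j => h2 j j.2)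

theorem itemCost_eq_wcost (hk : 0 < k) (F c : ℕ → ℕ) :
    itemCost (fun a b => dist (pt a) (pt b) ^ 2) k m F c =
      wcost (fun u : Fin m => (F (2 * u + 1) : ℝ)) (fun u => pt (F (2 * u)))
        fun j : Fin k => pt (c j) := by
  unfold itemCost wcost
  rw [sum_range]
  exact sum_congr rfl fun u _ => by rw [sqDist_eq_near hk]

/-- Let `A` be the cost of `C`. Moving the points to their representatives costs at most `α A`, so
`C` costs at most `2 α A + 2 A` for the representatives, and the local search at most `656` times
this. The detour from a point over its representative to the new center doubles both parts: `2 α + 2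
* 656 * (2 α + 2) = 2626 α + 2624`. -/
theorem IsReduction.isSummary (hk : 0 < k) (hm : 0 < m)
    (hf : IsReduction (fun a b => dist (pt a) (pt b) ^ 2) k m F f)
    (hF : IsSummary pt k m α P F) : IsSummary pt k k (2626 * α + 2624) P f := by
  obtain ⟨s, hs, hfs⟩ := hf
  obtain ⟨σ, h1, h2, h3⟩ := hF
  set T := numSwaps k m
  set c := s T
  set ν : ℕ → ℕ := fun u => near (fun j => dist (pt (F (2 * u))) (pt (c j)) ^ 2) k with hν
  have hνk : ∀ u, ν u < k := fun u => (near_spec _ hk).1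
  have : Nonempty (Fin k) := ⟨⟨0, hk⟩⟩
  have : Nonempty (Fin m) := ⟨⟨0, hm⟩⟩
  have hupd : ∀ (c : ℕ → ℕ) p (hp : p < k) a, (fun j : Fin k => pt (update c p a j)) =
      update (fun j : Fin k => pt (c j)) ⟨p, hp⟩ (pt a) := by
    intro c p hp a
    ext1 j
    by_cases h : j = ⟨p, hp⟩
    · simp [h]
    · have : (j : ℕ) ≠ p := fun h' => h (Fin.ext h')
      simp [h, this]
  have hLS := fun C => wcost_le_of_best_swaps (E := E) (w := fun u : Fin m => (F (2 * u + 1) : ℝ))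
    (fun u => Nat.cast_nonneg _) (fun u => pt (F (2 * u))) (fun t (j : Fin k) => pt (s t j))
    (T := T) (by simp [T]) (fun t ht => by
      obtain ⟨p, hp, u, hu, h⟩ := (hs t ht).1
      exact ⟨⟨p, hp⟩, ⟨u, hu⟩, by simp only [h, hupd _ p hp]⟩)
    (fun t ht p u => by
      have := (hs t ht).2 p p.2 u u.2
      rwa [itemCost_eq_wcost hk, itemCost_eq_wcost hk, hupd _ p p.2] at this) C
  -- A weighted sum over the items is an unweighted sum over the points they represent.
  have hsum : ∀ φ : ℕ → ℝ, ∑ u : Fin m, (F (2 * u + 1) : ℝ) * φ u = ∑ i ∈ P, φ (σ i) := by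
    intro φ
    rw [← sum_range (fun u => (F (2 * u + 1) : ℝ) * φ u),
      ← sum_fiberwise_of_maps_to (s := P) (t := range m) (g := σ)
      (fun i hi => mem_range.2 (h1 i hi))]
    refine sum_congr rfl fun u hu => ?_
    rw [h2 u (mem_range.1 hu), ← nsmul_eq_mul, ← sum_const]
    exact sum_congr rfl fun i hi => by rw [(mem_filter.1 hi).2]
  refine ⟨fun i => ν (σ i), fun i _ => hνk _, fun j hj => ?_, fun C => ?_⟩
  · rw [(hfs j hj).2, ← sum_filter,
      card_eq_sum_card_fiberwise (f := σ) (t := {u ∈ range m | ν u = j})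
      (fun i hi => by
        have := mem_filter.1 hi
        exact mem_filter.2 ⟨mem_range.2 (h1 i this.1), this.2⟩)]
    refine sum_congr rfl fun u hu => ?_
    have hu := mem_filter.1 hu
    rw [h2 u (mem_range.1 hu.1), filter_filter]
    congr 1
    refine filter_congr fun i _ => ⟨fun h => ⟨?_, h⟩, fun h => h.2⟩
    change ν (σ i) = j
    rw [h, hu.2]
  · set A := ∑ i ∈ P, sqDist C (pt i)
    have e1 := h3 C
    have e2 := hLS C
    unfold wcost at e2
    rw [hsum fun u => sqDist (fun j : Fin k => pt (s T j)) (pt (F (2 * u))),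
      hsum fun u => sqDist C (pt (F (2 * u)))] at e2
    have e3 : ∀ a b c : E, dist a c ^ 2 ≤ 2 * dist a b ^ 2 + 2 * dist b c ^ 2 := by
      intro a b c
      have := pow_le_pow_left₀ dist_nonneg (dist_triangle a b c) 2
      nlinarith [sq_nonneg (dist a b - dist b c)]
    have e4 : ∑ i ∈ P, sqDist C (pt (F (2 * σ i))) ≤
        2 * ∑ i ∈ P, dist (pt i) (pt (F (2 * σ i))) ^ 2 + 2 * A := by
      rw [mul_sum, mul_sum, ← sum_add_distrib]
      refine sum_le_sum fun i _ => ?_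
      obtain ⟨j, hj⟩ := exists_sqDist_eq C (pt i)
      have e5 := sqDist_le C (pt (F (2 * σ i))) j
      have e6 := e3 (pt (F (2 * σ i))) (pt i) (C j)
      rw [dist_comm (pt (F (2 * σ i))) (pt i)] at e6
      linarith
    have e7 : ∑ i ∈ P, dist (pt i) (pt (f (2 * ν (σ i)))) ^ 2 ≤
        2 * ∑ i ∈ P, dist (pt i) (pt (F (2 * σ i))) ^ 2 +
        2 * ∑ i ∈ P, sqDist (fun j : Fin k => pt (s T j)) (pt (F (2 * σ i))) := by
      rw [mul_sum, mul_sum, ← sum_add_distrib]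
      refine sum_le_sum fun i _ => ?_
      rw [sqDist_eq_near hk, (hfs _ (hνk _)).1]
      exact e3 _ _ _
    linarith

end KMeans

/-! ### The program of one processor -/

namespace PRAM

open Finset KMeans

section Memory

variable (m : Memory) (a b v : ℕ) (x : ℝ)

@[simp] theorem Memory.setInt_int : (m.setInt a v).int b = if b = a then v else m.int b := by
  simp [Memory.setInt, Function.update_apply]

@[simp] theorem Memory.setInt_real : (m.setInt a v).real = m.real := rfl

@[simp] theorem Memory.setReal_real : (m.setReal a x).real b = if b = a then x else m.real b := by
  simp [Memory.setReal, Function.update_apply]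

@[simp] theorem Memory.setReal_int : (m.setReal a x).int = m.int := rfl

end Memory

/-- The quantities on which the control flow depends: the sizes of the input, the number of
levels, the branching, and the number of rounds in which `N` processors handle `n` nodes. -/
structure Par where
  (n d k N L g Q : ℕ)

/-- The constants and parameters that every processor keeps in its integer cells `1, …, 19`. -/
def Par.val (p : Par) : ℕ → ℕ
  | 1 => 1
  | 2 => 0
  | 3 => 100
  | 4 => p.n
  | 5 => p.d
  | 6 => p.k
  | 7 => p.N
  | 8 => p.L
  | 9 => p.g
  | 10 => p.Q
  | 11 => p.g * p.k
  | 12 => numSwaps p.k (p.g * p.k)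
  | 13 => p.g * (p.Q * p.N)
  | 14 => 2 * p.k
  | 15 => p.k * p.d
  | 16 => 4
  | 17 => 2
  | _ => 0

/-- The local memory holds the parameters, and `0` in real cell `0`. -/
structure Env (p : Par) (m : Memory) : Prop where
  int : ∀ a, 1 ≤ a → a < 20 → m.int a = p.val a
  real : m.real 0 = 0

theorem Env.congr {p : Par} {m m' : Memory} (h : Env p m) (hi : ∀ a < 20, m'.int a = m.int a)
    (hr : m'.real 0 = m.real 0) : Env p m' :=
  ⟨fun a h₁ h₂ => (hi a h₂).trans (h.int a h₁ h₂), hr.trans h.real⟩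

theorem Env.all {p : Par} {m : Memory} (h : Env p m) :
    m.int 1 = 1 ∧ m.int 2 = 0 ∧ m.int 3 = 100 ∧ m.int 4 = p.n ∧ m.int 5 = p.d ∧ m.int 6 = p.k ∧
    m.int 7 = p.N ∧ m.int 8 = p.L ∧ m.int 9 = p.g ∧ m.int 10 = p.Q ∧ m.int 11 = p.g * p.k ∧
    m.int 12 = numSwaps p.k (p.g * p.k) ∧ m.int 13 = p.g * (p.Q * p.N) ∧ m.int 14 = 2 * p.k ∧
    m.int 15 = p.k * p.d ∧ m.int 16 = 4 ∧ m.int 17 = 2 ∧ m.real 0 = 0 := by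
  have := fun a h₁ h₂ => h.int a h₁ h₂
  refine ⟨this 1 ?_ ?_, this 2 ?_ ?_, this 3 ?_ ?_, this 4 ?_ ?_, this 5 ?_ ?_, this 6 ?_ ?_,
    this 7 ?_ ?_, this 8 ?_ ?_, this 9 ?_ ?_, this 10 ?_ ?_, this 11 ?_ ?_, this 12 ?_ ?_,
    this 13 ?_ ?_, this 14 ?_ ?_, this 15 ?_ ?_, this 16 ?_ ?_, this 17 ?_ ?_, h.real⟩ <;>
  norm_num

/-- `m'` differs from `m` only in the integer cells `20, …, hi - 1` and in the real cells
`1, …, hr - 1`. -/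
structure Frame (hi hr : ℕ) (m m' : Memory) : Prop where
  int : ∀ a, a < 20 ∨ hi ≤ a → m'.int a = m.int a
  real : ∀ a, a = 0 ∨ hr ≤ a → m'.real a = m.real a

namespace Frame

variable {hi hr hi' hr' : ℕ} {m m' m'' : Memory} {p : Par}

theorem refl (m : Memory) : Frame hi hr m m := ⟨fun _ _ => rfl, fun _ _ => rfl⟩

theorem trans (h : Frame hi hr m m') (h' : Frame hi' hr' m' m'') (h₁ : hi' ≤ hi)
    (h₂ : hr' ≤ hr) : Frame hi hr m m'' :=
  ⟨fun a ha => (h'.int a (by omega)).trans (h.int a ha),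
   fun a ha => (h'.real a (by omega)).trans (h.real a ha)⟩

theorem env (h : Frame hi hr m m') (hm : Env p m) : Env p m' :=
  hm.congr (fun a ha => h.int a (.inl ha)) (h.real 0 (.inl rfl))

theorem setInt {r v : ℕ} (h : Frame hi hr m m') (h₁ : 20 ≤ r) (h₂ : r < hi) :
    Frame hi hr m (m'.setInt r v) :=
  ⟨fun a ha => by rw [Memory.setInt_int, if_neg (by omega), h.int a ha], h.real⟩

end Frame

/-- The instruction writes only to fixed integer cells `20, …, hi - 1` and to fixed real cells
`1, …, hr - 1` of the local memory. -/
def Instr.within (hi hr : ℕ) : Instr → Bool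
  | .intConst r _ | .intAdd r _ _ | .intSub r _ _ | .intMul r _ _ | .intLoad r _ | .intRead r _ =>
    Nat.ble 20 r && Nat.blt r hi
  | .realOfInt r _ | .realAdd r _ _ | .realSub r _ _ | .realMul r _ _ | .realDiv r _ _
  | .realLoad r _ | .realRead r _ => Nat.ble 1 r && Nat.blt r hr
  | .nop => true
  | _ => false

/-- Integer cells are allotted in bands: `distS` changes 20–29, `nearS` also 30–39, `costS` also
40–49. A called statement therefore preserves the variables of its caller, and for straight-line
code `rfl` proves the frame condition. -/
theorem Frame.execs {hi hr : ℕ} {sh m m' : Memory} {l : List Instr} (h : Frame hi hr m m')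
    (hl : l.all (Instr.within hi hr) = true) : Frame hi hr m (execs sh l m') := by
  induction l generalizing m' with
  | nil => exact h
  | cons i l ih =>
    simp only [List.all_cons, Bool.and_eq_true] at hl
    refine ih ⟨fun a ha => ?_, fun a ha => ?_⟩ hl.2
    · rw [← h.int a ha]
      have := hl.1
      cases i <;> simp [Instr.within, Instr.exec] at this ⊢ <;> omega
    · rw [← h.real a ha]
      have := hl.1
      cases i <;> simp [Instr.within, Instr.exec] at this ⊢ <;> omega

/-- Repeat `s` for all values of the integer cell `r` below the parameter `κ`. -/
def Stmt.forLT (κ r : ℕ) (s : Stmt) : Stmt :=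
  .block [.intConst r 0] ;; .loop κ (.intLT r κ) (s ;; .block [.intAdd r r 1])

/-- The name `κ` of a parameter is also the number of the cell holding it, so the test compares the
counter with the prescribed count. By `hset` the invariant must not depend on the counter cell. -/
theorem wp_forLT {sh m : Memory} {p : Par} {Q : Memory → Prop} {κ r : ℕ} {s : Stmt}
    (hκ : 1 ≤ κ ∧ κ < 20) (I : ℕ → Memory → Prop)
    (hE : ∀ i m, I i m → Env p m) (hset : ∀ i m v, I i m → I i (m.setInt r v))
    (hbody : ∀ i < p.val κ, ∀ m, I i m → m.int r = i →
      wp sh p.val s (fun m' => I (i + 1) m' ∧ m'.int r = i) m)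
    (h0 : I 0 m) (hQ : ∀ m', I (p.val κ) m' → Q m') : wp sh p.val (.forLT κ r s) Q m := by
  have hE1 : ∀ i m, I i m → m.int 1 = 1 := fun i m h => (hE i m h).all.1
  refine wp_seq (wp_block ?_)
  refine wp_loop (fun i m => I i m ∧ m.int r = i) ?_ ?_ ?_ fun m h => hQ m h.1
  · rintro i hi m ⟨h₁, h₂⟩
    refine ⟨?_, wp_seq ((hbody i hi m h₁ h₂).mono ?_)⟩
    · simp only [Test.Holds, h₂, (hE i m h₁).int κ hκ.1 hκ.2, hi]
    · rintro m' ⟨h₃, h₄⟩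
      refine wp_block ⟨hset _ _ _ h₃, ?_⟩
      simp [Instr.exec, h₄, hE1 _ _ h₃]
  · rintro m ⟨h₁, h₂⟩
    simp only [Test.Holds, h₂, (hE _ m h₁).int κ hκ.1 hκ.2, lt_irrefl, not_false_eq_true]
  · exact ⟨hset _ _ _ h0, by simp [Instr.exec]⟩

/-- The squared distance of the points with indices `a` and `b`. -/
noncomputable def sqd (sh : Memory) (d a b : ℕ) : ℝ :=
  ∑ l ∈ range d, (sh.real (1 + (a * d + l)) - sh.real (1 + (b * d + l))) ^ 2

/-- Real cell `1` becomes the squared distance of the points given by integer cells `40`, `30`. -/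
def distS : Stmt :=
  .block [.intMul 20 40 5, .intAdd 20 20 1, .intMul 21 30 5, .intAdd 21 21 1, .realAdd 1 0 0] ;;
  .forLT 5 22 (.block [.realRead 2 20, .realRead 3 21, .realSub 2 2 3, .realMul 2 2 2,
    .realAdd 1 1 2, .intAdd 20 20 1, .intAdd 21 21 1])

theorem wp_distS {sh m : Memory} {p : Par} (hm : Env p m) :
    wp sh p.val distS (fun m' => Frame 30 10 m m' ∧
      m'.real 1 = sqd sh p.d (m.int 40) (m.int 30)) m := by
  obtain ⟨e1, e2, e3, e4, e5, e6, e7, e8, e9, e10, e11, e12, e13, e14, e15, e16, e17, er⟩ := hm.all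
  refine wp_seq (wp_block ?_)
  refine wp_forLT (by norm_num) (fun i m' => Frame 30 10 m m' ∧
    m'.int 20 = 1 + (m.int 40 * p.d + i) ∧ m'.int 21 = 1 + (m.int 30 * p.d + i) ∧
    m'.real 1 = ∑ l ∈ range i, (sh.real (1 + (m.int 40 * p.d + l)) -
      sh.real (1 + (m.int 30 * p.d + l))) ^ 2) (fun i m' h => h.1.env hm) ?_ ?_ ?_ ?_
  · rintro i m' v ⟨h1, h2, h3, h4⟩
    exact ⟨h1.setInt (by norm_num) (by norm_num), by simp [h2, h3, h4]⟩
  · rintro i - m' ⟨h1, h2, h3, h4⟩ h5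
    have E1 := (h1.env hm).all.1
    refine wp_block ⟨⟨h1.execs rfl, ?_⟩, ?_⟩ <;>
    simp [Instr.exec, h2, h3, h4, h5, E1, sum_range_succ, add_assoc, sq]
  · refine ⟨(Frame.refl m).execs rfl, ?_⟩
    simp [Instr.exec, e5, e1, er, add_comm]
  · rintro m' ⟨h1, h2, h3, h4⟩
    exact ⟨h1, h4⟩

end PRAM

/-! ### Nearest center and cost of the current centers -/

namespace PRAM

open Finset KMeans

/-- The indices of the current centers are in the integer cells `100, 102, …`. -/
def Memory.centers (m : Memory) (j : ℕ) : ℕ := m.int (100 + 2 * j)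

theorem Frame.centers {hi hr : ℕ} {m m' : Memory} (h : Frame hi hr m m')
    (hhi : hi ≤ 100 := by norm_num) : m'.centers = m.centers :=
  funext fun j => h.int _ (by omega)

/-- Integer cell `33` becomes the index of the center nearest to the point given by integer cell
`40`, and real cell `10` the squared distance. -/
def nearS : Stmt :=
  .forLT 6 31 (.block [.intAdd 32 31 31, .intAdd 32 3 32, .intLoad 30 32] ;; distS ;;
    .cond (.realLT 1 10) [.realAdd 10 1 0, .intAdd 33 31 2] ;;
    .cond (.intLT 31 1) [.realAdd 10 1 0, .intAdd 33 31 2])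

/-- The strict comparison gives ties to the first index, as in `near`. Real cell `10` starts with
arbitrary contents; the second conditional makes index `0` the candidate regardless of them. -/
theorem wp_nearS {sh m : Memory} {p : Par} (hm : Env p m) (hk : 0 < p.k) :
    wp sh p.val nearS (fun m' => Frame 40 20 m m' ∧
      m'.int 33 = near (fun j => sqd sh p.d (m.int 40) (m.centers j)) p.k ∧
      m'.real 10 = sqd sh p.d (m.int 40) (m.centers (m'.int 33))) m := by
  classical
  set D : ℕ → ℝ := fun j => sqd sh p.d (m.int 40) (m.centers j) with hD
  refine wp_forLT (by norm_num) (fun i m' => Frame 40 20 m m' ∧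
    (0 < i → m'.int 33 = near D i ∧ m'.real 10 = D (near D i)))
    (fun i m' h => h.1.env hm) ?_ ?_ ?_ ?_
  · rintro i m' v ⟨h1, h2⟩
    exact ⟨h1.setInt (by norm_num) (by norm_num), by simpa using h2⟩
  · rintro i - m' ⟨h1, h2⟩ h3
    have e3 := (h1.env hm).all.2.2.1
    refine wp_seq (wp_block (wp_seq ((wp_distS ((h1.execs rfl).env hm)).mono ?_)))
    rintro m₁ ⟨h4, h5⟩
    set m₀ := execs sh [Instr.intAdd 32 31 31, Instr.intAdd 32 3 32, Instr.intLoad 30 32] m'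
      with hm₀
    have h6 : Frame 40 20 m m₀ := h1.execs rfl
    have h7 : m₁.real 1 = D i := by
      rw [h5, h6.int 40 (by norm_num), hD]
      congr 1
      simp [hm₀, Instr.exec, e3, h3, Memory.centers, ← two_mul]
      rw [if_neg (by omega), if_neg (by omega), h1.int _ (by omega)]
    have h8 : Frame 40 20 m m₁ := h6.trans h4 (by norm_num) (by norm_num)
    have h9 : m₁.int 31 = i := by
      rw [h4.int 31 (by norm_num), hm₀]
      simp [Instr.exec, h3]
    have h10 : m₁.int 33 = m'.int 33 := by
      rw [h4.int 33 (by norm_num), hm₀]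
      simp [Instr.exec]
    have h11 : m₁.real 10 = m'.real 10 := by
      rw [h4.real 10 (by norm_num), hm₀]
      simp [Instr.exec]
    obtain ⟨f1, f2, -⟩ := (h8.env hm).all
    have f3 := (h8.env hm).real
    refine wp_seq (wp_cond (wp_cond ?_))
    by_cases hi : i = 0
    · subst hi
      split_ifs with c1 c2 c2
      all_goals try (exact absurd (by simp [Test.Holds, Instr.exec, f1, h9]) c2)
      all_goals refine ⟨⟨?_, fun _ => ?_⟩, ?_⟩
      all_goals try exact (h8.execs rfl).execs rfl
      all_goals try exact h8.execs rfl
      all_goals simp [Instr.exec, near, f2, f3, h7, h9]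
    · obtain ⟨g1, g2⟩ := h2 (by omega)
      have g3 : D (near D i) = m₁.real 10 := by rw [h11, g2]
      rw [if_neg]
      · split_ifs with c1
        all_goals simp only [Test.Holds, h7] at c1
        all_goals simp only [near, hi, false_or, g3, c1, if_true, if_false]
        · refine ⟨⟨h8.execs rfl, fun _ => ?_⟩, ?_⟩
          all_goals simp [Instr.exec, f2, f3, h7, h9]
        · exact ⟨⟨h8, fun _ => ⟨h10.trans g1, trivial⟩⟩, h9⟩
      · split_ifs <;> simp [Test.Holds, Instr.exec, f1, h9, hi]
  · exact ⟨Frame.refl m, by simp⟩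
  · rintro m' ⟨h1, h2⟩
    obtain ⟨h3, h4⟩ := h2 hk
    exact ⟨h1, h3, by rw [h3]; exact h4⟩

/-- Real cell `20` becomes the cost of the current centers for the weighted points stored in the
shared memory from the address in integer cell `90` on. -/
def costS : Stmt :=
  .block [.realAdd 20 0 0, .intAdd 42 90 2] ;;
  .forLT 11 43 (.block [.intRead 40 42, .intAdd 42 42 1, .intRead 41 42, .intAdd 42 42 1] ;;
    nearS ;; .block [.realOfInt 21 41, .realMul 21 21 10, .realAdd 20 20 21])

/-- The weighted points stored from the address in integer cell `90` on. -/
def items (sh m : Memory) (x : ℕ) : ℕ := sh.int (m.int 90 + x)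

theorem wp_costS {sh m : Memory} {p : Par} (hm : Env p m) (hk : 0 < p.k) :
    wp sh p.val costS (fun m' => Frame 50 30 m m' ∧
      m'.real 20 = itemCost (sqd sh p.d) p.k (p.g * p.k) (items sh m) m.centers) m := by
  obtain ⟨e1, e2, -⟩ := hm.all
  have er := hm.real
  set F := items sh m with hF
  refine wp_seq (wp_block (wp_forLT (by norm_num) (fun i m' => Frame 50 30 m m' ∧
    m'.int 42 = m.int 90 + 2 * i ∧
    m'.real 20 = itemCost (sqd sh p.d) p.k i F m.centers)
    (fun i m' h => h.1.env hm) ?_ ?_ ?_ ?_))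
  · rintro i m' v ⟨h1, h2, h3⟩
    exact ⟨h1.setInt (by norm_num) (by norm_num), by simpa using h2, by simpa using h3⟩
  · rintro i - m' ⟨h1, h2, h3⟩ h4
    have E1 := (h1.env hm).all.1
    refine wp_seq (wp_block (wp_seq ((wp_nearS ((h1.execs rfl).env hm) hk).mono ?_)))
    rintro m₁ ⟨h5, h6, h7⟩
    set m₀ := execs sh [Instr.intRead 40 42, Instr.intAdd 42 42 1, Instr.intRead 41 42,
      Instr.intAdd 42 42 1] m' with hm₀
    have h8 : Frame 50 30 m m₀ := h1.execs rfl
    have h9 : Frame 50 30 m m₁ := h8.trans h5 (by norm_num) (by norm_num)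
    have h10 : m₀.int 40 = F (2 * i) := by simp [hm₀, Instr.exec, h2, hF, items]
    have h11 : m₁.int 41 = F (2 * i + 1) := by
      rw [h5.int 41 (by norm_num)]
      simp [hm₀, Instr.exec, h2, hF, items, E1, add_assoc]
    have h12 : m₁.int 42 = m.int 90 + 2 * (i + 1) := by
      rw [h5.int 42 (by norm_num)]
      simp [hm₀, Instr.exec, h2, E1, add_assoc, mul_add]
    have h13 : m₁.int 43 = i := by
      rw [h5.int 43 (by norm_num)]
      simp [hm₀, Instr.exec, h4]
    have h14 : m₁.real 20 = itemCost (sqd sh p.d) p.k i F m.centers := by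
      rw [h5.real 20 (by norm_num), ← h3]
      simp [hm₀, Instr.exec]
    rw [h6, h10, h8.centers] at h7
    refine wp_block ⟨⟨h9.execs rfl, ?_⟩, ?_⟩
    · simp [Instr.exec, h12, h11, h14, h7, itemCost, sum_range_succ]
    · simp [Instr.exec, h13]
  · refine ⟨(Frame.refl m).execs rfl, ?_⟩
    simp [Instr.exec, e2, er, itemCost]
  · rintro m' ⟨h1, h2, h3⟩
    exact ⟨h1, h3⟩

end PRAM

/-! ### A cheapest swap -/

namespace PRAM

open Finset KMeans

theorem centers_setInt (m : Memory) (p v : ℕ) :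
    (m.setInt (100 + 2 * p) v).centers = Function.update m.centers p v := by
  funext j
  simp [Memory.centers, Function.update_apply]

theorem centers_setInt_of_lt {m : Memory} {r v : ℕ} (hr : r < 100) :
    (m.setInt r v).centers = m.centers := by
  funext j
  simp only [Memory.centers, Memory.setInt_int]
  rw [if_neg (by omega)]

theorem sqd_nonneg (sh : Memory) (d a b : ℕ) : 0 ≤ sqd sh d a b :=
  sum_nonneg fun _ _ => sq_nonneg _

theorem itemCost_sqd_nonneg (sh : Memory) (d k M : ℕ) (F c : ℕ → ℕ) :
    0 ≤ itemCost (sqd sh d) k M F c :=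
  sum_nonneg fun _ _ => mul_nonneg (Nat.cast_nonneg _) (sqd_nonneg _ _ _ _)

/-- Replace a center by one of the weighted points, in a cheapest way. -/
def sweepS : Stmt :=
  .block [.realAdd 30 0 0, .intAdd 53 3 2] ;;
  .forLT 6 50 (.block [.intAdd 51 90 2, .intLoad 54 53] ;;
    .forLT 11 52 (.block [.intRead 57 51, .intStore 53 57] ;; costS ;;
      .block [.intStore 53 54, .realOfInt 31 1, .realAdd 20 20 31, .realDiv 31 31 20] ;;
      .cond (.realLT 30 31) [.realAdd 30 31 0, .intAdd 55 53 2, .intAdd 56 57 2] ;;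
      .block [.intAdd 51 51 17]) ;;
    .block [.intAdd 53 53 17]) ;;
  .block [.intStore 55 56]

/-- The best swap among the swaps in `S` is recorded, with score `score`. -/
structure Recorded (k M : ℕ) (F : ℕ → ℕ) (score : ℕ → ℕ → ℝ) (S : ℕ → ℕ → Prop) (m : Memory) :
    Prop where
  le : ∀ p < k, ∀ u < M, S p u → score p u ≤ m.real 30
  mem : m.real 30 = 0 ∨ ∃ p < k, ∃ u < M,
    m.real 30 = score p u ∧ m.int 55 = 100 + 2 * p ∧ m.int 56 = F (2 * u)

theorem Recorded.congr {k M : ℕ} {F : ℕ → ℕ} {score : ℕ → ℕ → ℝ} {S S' : ℕ → ℕ → Prop}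
    {m m' : Memory} (h : Recorded k M F score S m)
    (hS : ∀ p < k, ∀ u < M, S' p u → S p u) (h30 : m'.real 30 = m.real 30)
    (h55 : m'.int 55 = m.int 55) (h56 : m'.int 56 = m.int 56) : Recorded k M F score S' m' :=
  ⟨fun p hp u hu hs => h30 ▸ h.le p hp u hu (hS p hp u hu hs), by rw [h30, h55, h56]; exact h.mem⟩

/-- Instead of minimizing the cost, the sweep maximizes the score `1 / (cost + 1)`. Scores are
positive, so the initial value `0` is beaten by the first swap and no infinite start value is
needed. Each swap is tried in place and then undone. -/
theorem wp_sweepS {sh m : Memory} {p : Par} (hm : Env p m) (hk : 0 < p.k) (hg : 0 < p.g) :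
    wp sh p.val sweepS (fun m' => (∀ a, a < 20 ∨ 60 ≤ a ∧ a < 100 → m'.int a = m.int a) ∧
      m'.real 0 = 0 ∧
      BestSwap (sqd sh p.d) p.k (p.g * p.k) (items sh m) m.centers m'.centers) m := by
  obtain ⟨e1, e2, e3, -⟩ := hm.all
  have er := hm.real
  set F := items sh m with hF
  set M := p.g * p.k with hM
  have hM0 : 0 < M := Nat.mul_pos hg hk
  set cost : ℕ → ℕ → ℝ := fun q u =>
    itemCost (sqd sh p.d) p.k M F (Function.update m.centers q (F (2 * u))) with hcost
  have hcost0 : ∀ q u, 0 ≤ cost q u := fun q u => itemCost_sqd_nonneg _ _ _ _ _ _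
  set score : ℕ → ℕ → ℝ := fun q u => 1 / (cost q u + 1) with hscore
  have hscore0 : ∀ q u, 0 < score q u := fun q u => by
    have := hcost0 q u
    simp only [hscore]
    positivity
  refine wp_seq (wp_block (wp_seq (wp_forLT (by norm_num) (fun i m' => Frame 60 40 m m' ∧
    m'.int 53 = 100 + 2 * i ∧ Recorded p.k M F score (fun q _ => q < i) m')
    (fun i m' h => h.1.env hm) ?_ ?_ ?_ ?_)))
  · rintro i m' v ⟨h1, h2, h3⟩
    exact ⟨h1.setInt (by norm_num) (by norm_num), by simpa using h2,
      h3.congr (fun _ _ _ _ h => h) (by simp) (by simp) (by simp)⟩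
  · rintro i hi m' ⟨h1, h2, h3⟩ h4
    have hi : i < p.k := hi
    have E2 := (h1.env hm).all.2.1
    refine wp_seq (wp_block (wp_seq (wp_forLT (by norm_num) (fun u m' => Frame 60 40 m m' ∧
      m'.int 53 = 100 + 2 * i ∧ m'.int 51 = m.int 90 + 2 * u ∧ m'.int 54 = m.centers i ∧
      m'.int 50 = i ∧ Recorded p.k M F score (fun q v => q < i ∨ q = i ∧ v < u) m')
      (fun i m' h => h.1.env hm) ?_ ?_ ?_ ?_)))
    · rintro u m' v ⟨h1, h2, h3, h4, h5, h6⟩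
      exact ⟨h1.setInt (by norm_num) (by norm_num), by simpa using h2, by simpa using h3,
        by simpa using h4, by simpa using h5,
        h6.congr (fun _ _ _ _ h => h) (by simp) (by simp) (by simp)⟩
    · clear h1 h2 h3 h4 E2 m'
      rintro u hu m' ⟨h1, h2, h3, h4, h5, h6⟩ h7
      have hu : u < M := hu
      set m₀ := (m'.setInt 57 (F (2 * u))).setInt (100 + 2 * i) (F (2 * u)) with hm₀
      refine wp_seq (wp_block ?_)
      have hex : execs sh [Instr.intRead 57 51, Instr.intStore 53 57] m' = m₀ := by
        simp [Instr.exec, h2, h3, hm₀, hF, items]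
      rw [hex]
      have f1 : ∀ a, a < 50 ∨ 58 ≤ a → a ≠ 100 + 2 * i → m₀.int a = m'.int a := by
        intro a ha ha'
        simp only [hm₀, Memory.setInt_int]
        rw [if_neg ha', if_neg (by omega)]
      have f2 : Env p m₀ := (h1.env hm).congr (fun a ha => f1 a (by omega) (by omega)) rfl
      have f3 : m₀.centers = Function.update m.centers i (F (2 * u)) := by
        rw [hm₀, centers_setInt, centers_setInt_of_lt (by norm_num), h1.centers]
      have f4 : items sh m₀ = F := by
        funext x
        simp only [items, hF]
        rw [f1 90 (by norm_num) (by omega), h1.int 90 (by norm_num)]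
      refine wp_seq ((wp_costS f2 hk).mono ?_)
      rintro m₁ ⟨h8, h9⟩
      rw [f4, f3] at h9
      change m₁.real 20 = cost i u at h9
      have g1 : ∀ a, 50 ≤ a → a < 57 → m₁.int a = m'.int a := by
        intro a ha ha'
        rw [h8.int a (by omega)]
        simp only [hm₀, Memory.setInt_int]
        rw [if_neg (by omega), if_neg (by omega)]
      have g2 : m₁.int 57 = F (2 * u) := by
        rw [h8.int 57 (by norm_num)]
        simp only [hm₀, Memory.setInt_int]
        rw [if_neg (by omega), if_pos trivial]
      have g3 : m₁.real 30 = m'.real 30 := h8.real 30 (by norm_num)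
      obtain ⟨E1, E2, -⟩ := (h8.env f2).all
      have Er := (h8.env f2).real
      have E17 := (h8.env f2).all.2.2.2.2.2.2.2.2.2.2.2.2.2.2.2.2.1
      refine wp_seq (wp_block ?_)
      -- The original center is back in its cell.
      set m₂ := m₁.setInt (100 + 2 * i) (m.centers i) with hm₂
      have k1 : Frame 60 40 m m₂ := by
        refine ⟨fun a ha => ?_, fun a ha => ?_⟩
        · by_cases ha' : a = 100 + 2 * i
          · rw [hm₂, ha', Memory.setInt_int, if_pos rfl, Memory.centers]
          · rw [hm₂, Memory.setInt_int, if_neg ha', h8.int a (by omega),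
              f1 a (by omega) ha', h1.int a ha]
        · rw [hm₂, Memory.setInt_real, h8.real a (by omega)]
          exact h1.real a ha
      have k2 : ∀ a < 100, m₂.int a = m₁.int a := fun a ha => by
        rw [hm₂, Memory.setInt_int, if_neg (by omega)]
      set m₃ := execs sh [Instr.realOfInt 31 1, Instr.realAdd 20 20 31, Instr.realDiv 31 31 20] m₂
        with hm₃
      have hex : execs sh [Instr.intStore 53 54, Instr.realOfInt 31 1, Instr.realAdd 20 20 31,
          Instr.realDiv 31 31 20] m₁ = m₃ := by
        simp only [execs_cons, Instr.exec, g1 53 (by norm_num) (by norm_num),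
          g1 54 (by norm_num) (by norm_num), h2, h4, hm₃, hm₂]
      rw [hex]
      have k3 : Frame 60 40 m m₃ := k1.execs rfl
      have k4 : ∀ a < 100, m₃.int a = m₁.int a := fun a ha => by
        rw [← k2 a ha]
        simp [hm₃, Instr.exec]
      have k5 : m₃.real 31 = score i u := by
        have l1 : m₂.int 1 = 1 := by rw [k2 1 (by norm_num), E1]
        have l2 : m₂.real 20 = cost i u := h9
        simp [hm₃, Instr.exec, l1, l2, hscore]
      have k6 : m₃.real 30 = m'.real 30 := by
        simp [hm₃, Instr.exec, g3, hm₂]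
      have k7 : m₃.real 0 = 0 := by rw [k3.real 0 (by norm_num), er]
      refine wp_seq (wp_cond (wp_block ?_))
      have key : ∀ m₄ : Memory, Frame 60 40 m m₄ → (∀ a, 50 ≤ a → a < 55 → m₄.int a = m'.int a) →
          Recorded p.k M F score (fun q v => q < i ∨ q = i ∧ v < u + 1) m₄ →
          ((Frame 60 40 m (execs sh [Instr.intAdd 51 51 17] m₄) ∧
            (execs sh [Instr.intAdd 51 51 17] m₄).int 53 = 100 + 2 * i ∧
            (execs sh [Instr.intAdd 51 51 17] m₄).int 51 = m.int 90 + 2 * (u + 1) ∧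
            (execs sh [Instr.intAdd 51 51 17] m₄).int 54 = m.centers i ∧
            (execs sh [Instr.intAdd 51 51 17] m₄).int 50 = i ∧
            Recorded p.k M F score (fun q v => q < i ∨ q = i ∧ v < u + 1)
              (execs sh [Instr.intAdd 51 51 17] m₄)) ∧
            (execs sh [Instr.intAdd 51 51 17] m₄).int 52 = u) := by
        intro m₄ q1 q2 q3
        have E17 := (q1.env hm).all.2.2.2.2.2.2.2.2.2.2.2.2.2.2.2.2.1
        refine ⟨⟨q1.execs rfl, ?_, ?_, ?_, ?_, q3.congr (fun _ _ _ _ h => h) ?_ ?_ ?_⟩, ?_⟩ <;>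
        simp [Instr.exec, q2, h2, h3, h4, h5, h7, E17, mul_add, add_assoc]
      have hsplit : ∀ q v, (q < i ∨ q = i ∧ v < u + 1) → (q < i ∨ q = i ∧ v < u) ∨ q = i ∧ v = u := by
        intro q v h
        omega
      split_ifs with hc
      · simp only [Test.Holds, k5, k6] at hc
        refine key _ (k3.execs rfl) ?_ ⟨fun q hq v hv hS => ?_, .inr ⟨i, hi, u, hu, ?_, ?_, ?_⟩⟩
        · intro a ha ha'
          simp only [execs_cons, execs_nil, Instr.exec, Memory.setInt_int]
          rw [if_neg (by omega), if_neg (by omega), Memory.setReal_int, k4 a (by omega),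
            g1 a ha (by omega)]
        · have : (execs sh [Instr.realAdd 30 31 0, Instr.intAdd 55 53 2, Instr.intAdd 56 57 2]
            m₃).real 30 = score i u := by simp [Instr.exec, k5, k7]
          rw [this]
          rcases hsplit q v hS with h | ⟨rfl, rfl⟩
          · exact (h6.le q hq v hv h).trans hc.le
          · exact le_rfl
        · simp [Instr.exec, k5, k7]
        · simp [Instr.exec, k4, E2, g1, h2]
        · simp [Instr.exec, k4, E2, g2]
      · simp only [Test.Holds, k5, k6, not_lt] at hc
        refine key _ k3 (fun a ha ha' => by rw [k4 a (by omega), g1 a ha (by omega)])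
          ⟨fun q hq v hv hS => ?_, ?_⟩
        · rw [k6]
          rcases hsplit q v hS with h | ⟨rfl, rfl⟩
          · exact h6.le q hq v hv h
          · exact hc
        · rw [k6, k4 55 (by norm_num), k4 56 (by norm_num), g1 55 (by norm_num) (by norm_num),
            g1 56 (by norm_num) (by norm_num)]
          exact h6.mem
    · refine ⟨h1.execs rfl, ?_, ?_, ?_, ?_, h3.congr (fun q _ v _ h => ?_) ?_ ?_ ?_⟩
      · simp [Instr.exec, h2]
      · simp [Instr.exec, h1.int 90, E2]
      · simp [Instr.exec, h2]
        rw [if_neg (by omega), h1.int _ (by omega), Memory.centers]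
      · simp [Instr.exec, h4]
      · omega
      · simp [Instr.exec]
      · simp [Instr.exec]
      · simp [Instr.exec]
    · rintro m₁ ⟨q1, q2, q3, q4, q5, q6⟩
      have E17 := (q1.env hm).all.2.2.2.2.2.2.2.2.2.2.2.2.2.2.2.2.1
      refine wp_block ⟨⟨q1.execs rfl, ?_, q6.congr (fun q hq v hv h => ?_) ?_ ?_ ?_⟩, ?_⟩
      · simp [Instr.exec, q2, E17, mul_add, add_assoc]
      · have hv : v < p.val 11 := hv
        omega
      · simp [Instr.exec]
      · simp [Instr.exec]
      · simp [Instr.exec]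
      · simp [Instr.exec, q5]
  · refine ⟨(Frame.refl m).execs rfl, ?_, ⟨fun q hq u hu h => absurd h (Nat.not_lt_zero _), .inl ?_⟩⟩
    · simp [Instr.exec, e3, e2]
    · simp [Instr.exec, er]
  · rintro m' ⟨h1, h2, h3⟩
    -- The recorded score is not the start value `0`, since it is at least the positive score of
    -- swap `(0, 0)`.
    obtain ⟨q, hq, u, hu, r1, r2, r3⟩ := h3.mem.resolve_left fun h0 =>
      (hscore0 0 0).not_ge (h0 ▸ h3.le 0 hk 0 hM0 hk)
    refine wp_block ?_
    have hex : execs sh [Instr.intStore 55 56] m' = m'.setInt (100 + 2 * q) (F (2 * u)) := by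
      simp [Instr.exec, r2, r3]
    rw [hex]
    refine ⟨fun a ha => ?_, ?_, ?_⟩
    · rw [Memory.setInt_int, if_neg (by omega), h1.int a (by omega)]
    · rw [Memory.setInt_real, h1.real 0 (by norm_num), er]
    · rw [centers_setInt, h1.centers]
      refine ⟨⟨q, hq, u, hu, rfl⟩, fun q' hq' u' hu' => ?_⟩
      have h4 := h3.le q' hq' u' hu' hq'
      rw [r1] at h4
      have h5 := (one_div_le_one_div (by linarith [hcost0 q' u']) (by linarith [hcost0 q u])).1 h4
      exact le_of_add_le_add_right h5

end PRAM

/-! ### Weights, inner nodes and leaves -/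

namespace PRAM

open Finset KMeans

/-- The integer cells `101, 103, …` become the total weights of the points assigned to the
centers. -/
def weightsS : Stmt :=
  .forLT 6 61 (.block [.intAdd 62 2 2, .intAdd 63 90 2] ;;
    .forLT 11 64 (.block [.intRead 40 63, .intAdd 63 63 1, .intRead 65 63, .intAdd 63 63 1] ;;
      nearS ;; .cond (.intLT 33 61) [.intAdd 65 2 2] ;; .cond (.intLT 61 33) [.intAdd 65 2 2] ;;
      .block [.intAdd 62 62 65]) ;;
    .block [.intAdd 66 61 61, .intAdd 66 66 3, .intAdd 66 66 1, .intStore 66 62])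

/-- The total weight of the first `M` points that are assigned to center `j`. -/
noncomputable def assigned (D : ℕ → ℕ → ℝ) (k : ℕ) (F c : ℕ → ℕ) (j M : ℕ) : ℕ :=
  ∑ u ∈ range M, if near (fun j => D (F (2 * u)) (c j)) k = j then F (2 * u + 1) else 0

/-- Tests only know `<`: the weight is cleared if the nearest index is below `j` or above `j`, so it
survives exactly in case of equality. -/
theorem wp_weightsS {sh m : Memory} {p : Par} (hm : Env p m) (hk : 0 < p.k) :
    wp sh p.val weightsS (fun m' => (∀ a, a < 20 ∨ 70 ≤ a ∧ a < 100 → m'.int a = m.int a) ∧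
      m'.real 0 = 0 ∧ m'.centers = m.centers ∧ ∀ j < p.k, m'.int (101 + 2 * j) =
        assigned (sqd sh p.d) p.k (items sh m) m.centers j (p.g * p.k)) m := by
  set F := items sh m with hF
  set W := assigned (sqd sh p.d) p.k F m.centers with hW
  have er := hm.real
  refine wp_forLT (by norm_num) (fun j m' =>
    (∀ a, a < 20 ∨ 70 ≤ a ∧ a < 100 → m'.int a = m.int a) ∧ m'.real 0 = 0 ∧
      m'.centers = m.centers ∧ ∀ i < j, m'.int (101 + 2 * i) = W i (p.g * p.k))
    (fun i m' h => hm.congr (fun a ha => h.1 a (.inl ha)) (h.2.1.trans er.symm)) ?_ ?_ ?_ ?_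
  · rintro j m' v ⟨h1, h2, h3, h4⟩
    refine ⟨fun a ha => ?_, h2, (centers_setInt_of_lt (by norm_num)).trans h3, fun i hi => ?_⟩
    · rw [Memory.setInt_int, if_neg (by omega), h1 a ha]
    · rw [Memory.setInt_int, if_neg (by omega), h4 i hi]
  · rintro j hj m' ⟨h1, h2, h3, h4⟩ h5
    have hm' : Env p m' := hm.congr (fun a ha => h1 a (.inl ha)) (h2.trans er.symm)
    obtain ⟨E1, E2, E3, -⟩ := hm'.all
    refine wp_seq (wp_block (wp_seq (wp_forLT (by norm_num) (fun u m'' => Frame 70 40 m' m'' ∧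
      m''.int 63 = m.int 90 + 2 * u ∧ m''.int 61 = j ∧ m''.int 62 = W j u)
      (fun i m' h => h.1.env hm') ?_ ?_ ?_ ?_)))
    · rintro u m'' v ⟨q1, q2, q3, q4⟩
      exact ⟨q1.setInt (by norm_num) (by norm_num), by simpa using q2, by simpa using q3,
        by simpa using q4⟩
    · rintro u - m'' ⟨q1, q2, q3, q4⟩ q5
      have F1 := (q1.env hm').all.1
      refine wp_seq (wp_block (wp_seq ((wp_nearS ((q1.execs rfl).env hm') hk).mono ?_)))
      rintro m₁ ⟨r1, r2, -⟩
      set m₀ := execs sh [Instr.intRead 40 63, Instr.intAdd 63 63 1, Instr.intRead 65 63,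
        Instr.intAdd 63 63 1] m'' with hm₀
      have s1 : Frame 70 40 m' m₀ := q1.execs rfl
      have s2 : Frame 70 40 m' m₁ := s1.trans r1 (by norm_num) (by norm_num)
      have s3 : m₀.int 40 = F (2 * u) := by simp [hm₀, Instr.exec, q2, hF, items]
      have s4 : m₁.int 65 = F (2 * u + 1) := by
        rw [r1.int 65 (by norm_num)]
        simp [hm₀, Instr.exec, q2, hF, items, F1, add_assoc]
      have s5 : m₁.int 63 = m.int 90 + 2 * (u + 1) := by
        rw [r1.int 63 (by norm_num)]
        simp [hm₀, Instr.exec, q2, F1, add_assoc, mul_add]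
      have s6 : m₁.int 64 = u := by
        rw [r1.int 64 (by norm_num)]
        simp [hm₀, Instr.exec, q5]
      have s7 : m₁.int 61 = j := by
        rw [r1.int 61 (by norm_num)]
        simp [hm₀, Instr.exec, q3]
      have s8 : m₁.int 62 = W j u := by
        rw [r1.int 62 (by norm_num)]
        simp [hm₀, Instr.exec, q4]
      rw [s3, s1.centers, h3] at r2
      have G2 := (s2.env hm').all.2.1
      refine wp_seq (wp_cond (wp_seq (wp_cond (wp_block ?_))))
      have key : ∀ m₂ : Memory, Frame 70 40 m' m₂ →
          (∀ a, 61 ≤ a → a < 65 → m₂.int a = m₁.int a) →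
          m₂.int 65 = (if m₁.int 33 = j then F (2 * u + 1) else 0) →
          (Frame 70 40 m' (execs sh [Instr.intAdd 62 62 65] m₂) ∧
            (execs sh [Instr.intAdd 62 62 65] m₂).int 63 = m.int 90 + 2 * (u + 1) ∧
            (execs sh [Instr.intAdd 62 62 65] m₂).int 61 = j ∧
            (execs sh [Instr.intAdd 62 62 65] m₂).int 62 = W j (u + 1)) ∧
            (execs sh [Instr.intAdd 62 62 65] m₂).int 64 = u := by
        intro m₂ t1 t2 t3
        refine ⟨⟨t1.execs rfl, ?_, ?_, ?_⟩, ?_⟩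
        · simp [Instr.exec, t2, s5]
        · simp [Instr.exec, t2, s7]
        · simp [Instr.exec, t2, t3, s8, hW, assigned, sum_range_succ, r2]
        · simp [Instr.exec, t2, s6]
      have hx : ∀ m₂ : Memory, ∀ a, a ≠ 65 →
          (execs sh [Instr.intAdd 65 2 2] m₂).int a = m₂.int a := by
        intro m₂ a ha
        simp [Instr.exec, ha]
      have hy : ∀ m₂ : Memory, (execs sh [Instr.intAdd 65 2 2] m₂).int 65 =
          m₂.int 2 + m₂.int 2 := by
        intro m₂
        simp [Instr.exec]
      rcases lt_trichotomy (m₁.int 33) j with hlt | heq | hgt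
      · have c : Test.Holds m₁ (.intLT 33 61) := by rwa [Test.Holds, s7]
        rw [if_pos c, if_neg (by
          rw [Test.Holds, hx _ 61 (by norm_num), hx _ 33 (by norm_num), s7]; omega)]
        refine key _ (s2.execs rfl) (fun a _ _ => hx _ a (by omega)) ?_
        rw [hy, G2, if_neg (by omega)]
      · have c : ¬ Test.Holds m₁ (.intLT 33 61) := by rw [Test.Holds, s7]; omega
        rw [if_neg c, if_neg (by rw [Test.Holds, s7]; omega)]
        exact key _ s2 (fun _ _ _ => rfl) (by rw [s4, if_pos heq])
      · have c : ¬ Test.Holds m₁ (.intLT 33 61) := by rw [Test.Holds, s7]; omega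
        rw [if_neg c, if_pos (by rwa [Test.Holds, s7])]
        refine key _ (s2.execs rfl) (fun a _ _ => hx _ a (by omega)) ?_
        rw [hy, G2, if_neg (by omega)]
    · refine ⟨(Frame.refl m').execs rfl, ?_, ?_, ?_⟩
      · simp [Instr.exec, E2, h1 90]
      · simp [Instr.exec, h5]
      · simp [Instr.exec, E2, hW, assigned]
    · rintro m'' ⟨q1, q2, q3, q4⟩
      obtain ⟨F1, F2, F3, -⟩ := (q1.env hm').all
      refine wp_block ?_
      have hex : execs sh [Instr.intAdd 66 61 61, Instr.intAdd 66 66 3, Instr.intAdd 66 66 1,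
          Instr.intStore 66 62] m'' = (execs sh [Instr.intAdd 66 61 61, Instr.intAdd 66 66 3,
          Instr.intAdd 66 66 1] m'').setInt (101 + 2 * j) (W j (p.g * p.k)) := by
        simp [Instr.exec, F1, F3, q3, q4]
        congr 1
        · omega
      rw [hex]
      set m₂ := execs sh [Instr.intAdd 66 61 61, Instr.intAdd 66 66 3, Instr.intAdd 66 66 1] m''
        with hm₂
      have q5 : Frame 70 40 m' m₂ := q1.execs rfl
      refine ⟨⟨fun a ha => ?_, ?_, ?_, fun i hi => ?_⟩, ?_⟩
      · rw [Memory.setInt_int, if_neg (by omega), q5.int a (by omega), h1 a ha]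
      · rw [Memory.setInt_real, q5.real 0 (by norm_num), h2]
      · rw [← h3]
        funext i
        simp only [Memory.centers, Memory.setInt_int]
        rw [if_neg (by omega), q5.int _ (by omega)]
      · rw [Memory.setInt_int]
        split_ifs with h
        · rw [show i = j by omega]
        · rw [q5.int _ (by omega), h4 i (by omega)]
      · rw [Memory.setInt_int, if_neg (by omega), hm₂]
        simp [Instr.exec, q3]
  · exact ⟨fun _ _ => rfl, er, rfl, fun i hi => absurd hi (Nat.not_lt_zero _)⟩
  · exact fun m' h => h

/-- The address of node `q` of level `t` in the shared memory. -/
def Par.addr (p : Par) (t q : ℕ) : ℕ := 4 + (t * (p.g * (p.Q * p.N)) + q) * (2 * p.k)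

/-- In round `r` (cell `81`), a processor merges the children of its node of level `t + 1`, where
`t` is in cell `80`, and leaves the result in the integer cells from `100` on. -/
def nodeS : Stmt :=
  .block [.intMul 70 81 7, .intAdd 70 70 0, .intMul 71 80 13, .intMul 72 9 70, .intAdd 71 71 72,
    .intMul 71 71 14, .intAdd 90 16 71] ;;
  .forLT 12 60 sweepS ;; weightsS

/-- The centers are not initialized: the search starts from whatever the cells from `100` on
contain. This is harmless, as the analysis of the swaps allows any initial centers. -/
theorem wp_nodeS {sh m : Memory} {p : Par} (hm : Env p m) (hk : 0 < p.k) (hg : 0 < p.g) :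
    wp sh p.val nodeS (fun m' => (∀ a, a < 20 ∨ 80 ≤ a ∧ a < 90 → m'.int a = m.int a) ∧
      m'.real 0 = 0 ∧ IsReduction (sqd sh p.d) p.k (p.g * p.k)
        (fun x => sh.int (p.addr (m.int 80) (p.g * (m.int 81 * p.N + m.int 0)) + x))
        (fun x => m'.int (100 + x))) m := by
  have er := hm.real
  set m₀ := execs sh [.intMul 70 81 7, .intAdd 70 70 0, .intMul 71 80 13, .intMul 72 9 70,
    .intAdd 71 71 72, .intMul 71 71 14, .intAdd 90 16 71] m with hm₀
  have f1 : ∀ a, a < 70 ∨ 80 ≤ a ∧ a < 90 → m₀.int a = m.int a := fun a ha => by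
    simp only [hm₀, execs_cons, execs_nil, Instr.exec, Memory.setInt_int]
    repeat rw [if_neg (by omega)]
  have f2 : Env p m₀ := hm.congr (fun a ha => f1 a (by omega)) (by simp [hm₀, Instr.exec])
  have f3 : m₀.int 90 = p.addr (m.int 80) (p.g * (m.int 81 * p.N + m.int 0)) := by
    have := hm.int
    simp [hm₀, Instr.exec, this, Par.val, Par.addr]
  set F : ℕ → ℕ := fun x =>
    sh.int (p.addr (m.int 80) (p.g * (m.int 81 * p.N + m.int 0)) + x) with hF
  have hit : ∀ m' : Memory, m'.int 90 = m₀.int 90 → items sh m' = F := by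
    intro m' h
    funext x
    rw [items, h, f3]
  refine wp_seq (wp_block (wp_seq (wp_forLT (by norm_num) (fun i m' =>
    (∀ a, a < 20 ∨ 61 ≤ a ∧ a < 100 → m'.int a = m₀.int a) ∧ m'.real 0 = 0 ∧
    ∃ s : ℕ → ℕ → ℕ, s i = m'.centers ∧
      ∀ t < i, BestSwap (sqd sh p.d) p.k (p.g * p.k) F (s t) (s (t + 1)))
    (fun i m' h => f2.congr (fun a ha => h.1 a (.inl ha)) (h.2.1.trans f2.real.symm))
    ?_ ?_ ?_ ?_)))
  · rintro j m' v ⟨h1, h2, h3⟩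
    refine ⟨fun a ha => ?_, h2, ?_⟩
    · rw [Memory.setInt_int, if_neg (by omega), h1 a ha]
    · rwa [centers_setInt_of_lt (by norm_num)]
  · rintro i - m' ⟨h1, h2, s, h3, h4⟩ h5
    have hm' : Env p m' := f2.congr (fun a ha => h1 a (.inl ha)) (h2.trans f2.real.symm)
    refine (wp_sweepS hm' hk hg).mono ?_
    rintro m₁ ⟨q1, q2, q3⟩
    rw [hit m' (h1 90 (by norm_num))] at q3
    refine ⟨⟨fun a ha => by rw [q1 a (by omega), h1 a ha], q2,
      Function.update s (i + 1) m₁.centers, Function.update_self .., fun t ht => ?_⟩,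
      by rw [q1 60 (by norm_num), h5]⟩
    rw [Function.update_of_ne (by omega)]
    rcases Nat.lt_succ_iff_lt_or_eq.1 ht with ht | rfl
    · rw [Function.update_of_ne (by omega)]
      exact h4 t ht
    · rwa [Function.update_self, h3]
  · exact ⟨fun _ _ => rfl, f2.real, fun _ => m₀.centers, rfl,
      fun t ht => absurd ht (Nat.not_lt_zero _)⟩
  · rintro m' ⟨h1, h2, s, h3, h4⟩
    have hm' : Env p m' := f2.congr (fun a ha => h1 a (.inl ha)) (h2.trans f2.real.symm)
    refine (wp_weightsS hm' hk).mono ?_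
    rintro m₁ ⟨q1, q2, q3, q4⟩
    rw [hit m' (h1 90 (by norm_num)), ← h3] at q4
    refine ⟨fun a ha => by rw [q1 a (by omega), h1 a (by omega), f1 a (by omega)], q2, s, h4,
      fun j hj => ⟨?_, ?_⟩⟩
    · change m₁.centers j = s (p.val 12) j
      rw [q3, h3]
    · have := q4 j hj
      rw [show 101 + 2 * j = 100 + (2 * j + 1) by ring] at this
      exact this

/-- In round `r` (cell `81`), a processor prepares its leaf. -/
def leafS : Stmt :=
  .block [.intMul 70 81 7, .intAdd 70 70 0, .intAdd 71 3 1, .intStore 3 70, .intAdd 72 2 2] ;;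
  .cond (.intLT 70 4) [.intAdd 72 1 2] ;; .block [.intStore 71 72]

/-- A node number of at least `n` yields a leaf of weight `0`, so surplus processors do the same
work as the others. -/
theorem wp_leafS {sh m : Memory} {p : Par} (hm : Env p m) :
    wp sh p.val leafS (fun m' =>
      (∀ a, a < 20 ∨ 80 ≤ a ∧ a < 90 ∨ 102 ≤ a → m'.int a = m.int a) ∧ m'.real 0 = 0 ∧
      m'.int 100 = m.int 81 * p.N + m.int 0 ∧
      m'.int 101 = if m.int 81 * p.N + m.int 0 < p.n then 1 else 0) m := by
  classical
  obtain ⟨e1, e2, e3, e4, e5, e6, e7, -⟩ := hm.all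
  have er := hm.real
  refine wp_seq (wp_block (wp_seq (wp_cond (wp_block ?_))))
  set q := m.int 81 * p.N + m.int 0 with hq
  have hT : Test.Holds (execs sh [Instr.intMul 70 81 7, Instr.intAdd 70 70 0, Instr.intAdd 71 3 1,
      Instr.intStore 3 70, Instr.intAdd 72 2 2] m) (Test.intLT 70 4) ↔ q < p.n := by
    simp [Test.Holds, Instr.exec, e1, e3, e4, e7, hq]
  simp only [hT]
  split_ifs with h
  all_goals
    refine ⟨fun a ha => ?_, ?_, ?_, ?_⟩
    · simp [Instr.exec, e1, e2, e3, e7]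
      repeat rw [if_neg (by omega)]
    all_goals simp [Instr.exec, e1, e2, e3, e7, er, hq]

end PRAM

/-! ### Computing the parameters and producing distinct centers -/

namespace PRAM

open Finset KMeans

/-- Read the sizes of the input and compute the parameters. -/
def setupS : Stmt :=
  .block [.intConst 1 1, .intConst 3 100, .intConst 16 4, .intConst 17 2, .intConst 20 2,
    .intConst 21 3, .intRead 4 2, .intRead 5 1, .intRead 6 20, .intRead 7 21, .realRead 1 2,
    .realOfInt 2 1] ;;
  .loop 8 (.realLT 3 2) (.block [.intAdd 8 8 1, .realOfInt 4 8, .realMul 3 4 1]) ;;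
  .loop 9 (.intLT 22 4) (.block [.intAdd 9 9 1, .intConst 22 1, .intConst 23 0] ;;
    .loop 8 (.intLT 23 8) (.block [.intMul 22 22 9, .intAdd 23 23 1])) ;;
  .loop 10 (.intLT 24 4) (.block [.intAdd 10 10 1, .intAdd 24 24 7]) ;;
  .block [.intMul 11 9 6, .intAdd 12 11 6, .intMul 12 11 12, .intAdd 12 12 1, .intMul 25 16 6,
    .intMul 25 25 11, .intMul 12 12 25, .intMul 13 10 7, .intMul 13 9 13, .intMul 14 17 6,
    .intMul 15 6 5]

/-- The parameters fit the input: `L = ⌈1 / ε⌉`, `g = ⌈n ^ (1 / L)⌉` and `Q = ⌈n / N⌉`. -/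
structure Par.Fits (p : Par) (ε : ℝ) : Prop where
  L_pos : 0 < p.L
  L_lt : ∀ i < p.L, (i : ℝ) * ε < 1
  L_le : 1 ≤ (p.L : ℝ) * ε
  g_lt : ∀ i < p.g, i ^ p.L < p.n
  g_le : p.n ≤ p.g ^ p.L
  Q_lt : ∀ i < p.Q, i * p.N < p.n
  Q_le : p.n ≤ p.Q * p.N

/-- Reals cannot be rounded to integers, so `L`, `g` and `Q` are found by counting up. Their
minimality, recorded in `Fits`, makes each search loop run exactly as often as its parameter says.
-/
theorem wp_setupS {sh : Memory} {p : Par} {ε : ℝ} (hp : p.Fits ε) (h0 : sh.int 0 = p.n)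
    (h1 : sh.int 1 = p.d) (h2 : sh.int 2 = p.k) (h3 : sh.int 3 = p.N) (hε : sh.real 0 = ε)
    (i : ℕ) :
    wp sh p.val setupS (fun m => Env p m ∧ m.int 0 = i ∧ ∀ a, 26 ≤ a → m.int a = 0)
      { int := fun a => if a = 0 then i else 0, real := fun _ => 0 } := by
  set m := execs sh [.intConst 1 1, .intConst 3 100, .intConst 16 4, .intConst 17 2,
    .intConst 20 2, .intConst 21 3, .intRead 4 2, .intRead 5 1, .intRead 6 20, .intRead 7 21,
    .realRead 1 2, .realOfInt 2 1] { int := fun a => if a = 0 then i else 0, real := fun _ => 0 }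
    with hm
  have hi : ∀ a, m.int a = if a = 7 then p.N else if a = 6 then p.k else if a = 5 then p.d else
      if a = 4 then p.n else if a = 21 then 3 else if a = 20 then 2 else if a = 17 then 2 else
      if a = 16 then 4 else if a = 3 then 100 else if a = 1 then 1 else
      if a = 0 then i else 0 := by
    intro a
    simp [hm, Instr.exec, h0, h1, h2, h3]
  have hr : m.real 0 = 0 ∧ m.real 1 = ε ∧ m.real 2 = 1 ∧ m.real 3 = 0 := by
    simp [hm, Instr.exec, hε]
  refine wp_seq (wp_block ?_)
  rw [← hm]
  clear_value m
  refine wp_seq (wp_loop (fun t m' => (∀ a, a ≠ 8 → m'.int a = m.int a) ∧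
    m'.int 8 = t ∧ m'.real 0 = 0 ∧ m'.real 1 = ε ∧ m'.real 2 = 1 ∧ m'.real 3 = t * ε)
    ?_ ?_ ?_ ?_)
  · rintro t ht m' ⟨q1, q2, q3, q4, q5, q6⟩
    refine ⟨?_, wp_block ⟨fun a ha => ?_, ?_⟩⟩
    · rw [Test.Holds, q5, q6]
      exact hp.L_lt t ht
    · simp [Instr.exec, ha, q1]
    · have : m'.int 1 = 1 := by rw [q1 1 (by norm_num), hi]; simp
      simp [Instr.exec, q2, q3, q4, q5, this]
  · rintro m' ⟨q1, q2, q3, q4, q5, q6⟩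
    rw [Test.Holds, q5, q6, not_lt]
    exact hp.L_le
  · exact ⟨fun _ _ => rfl, by rw [hi]; simp, hr.1, hr.2.1, hr.2.2.1, by simp [hr.2.2.2]⟩
  clear hm
  rintro m₁ ⟨q1, q2, q3, -⟩
  refine wp_seq (wp_loop (fun t m' => (∀ a, a ≠ 9 → a ≠ 22 → a ≠ 23 → m'.int a = m₁.int a) ∧
    m'.int 9 = t ∧ m'.int 22 = t ^ p.L ∧ m'.real 0 = 0) ?_ ?_ ?_ ?_)
  · rintro t ht m' ⟨r1, r2, r3, r4⟩
    refine ⟨?_, wp_seq (wp_block ?_)⟩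
    · rw [Test.Holds, r3, r1 4 (by norm_num) (by norm_num) (by norm_num), q1 4 (by norm_num), hi]
      simpa using hp.g_lt t ht
    · refine wp_loop (fun s m' => (∀ a, a ≠ 9 → a ≠ 22 → a ≠ 23 → m'.int a = m₁.int a) ∧
        m'.int 9 = t + 1 ∧ m'.int 22 = (t + 1) ^ s ∧ m'.int 23 = s ∧ m'.real 0 = 0) ?_ ?_ ?_ ?_
      · rintro s hs m' ⟨s1, s2, s3, s4, s5⟩
        have e8 : m'.int 8 = p.L := by
          rw [s1 8 (by norm_num) (by norm_num) (by norm_num), q2]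
          rfl
        have e1 : m'.int 1 = 1 := by
          rw [s1 1 (by norm_num) (by norm_num) (by norm_num), q1 1 (by norm_num), hi]
          simp
        refine ⟨?_, wp_block ⟨fun a h9 h22 h23 => ?_, ?_⟩⟩
        · rw [Test.Holds, s4, e8]
          exact hs
        · simp [Instr.exec, h22, h23, s1 a h9 h22 h23]
        · simp [Instr.exec, s2, s3, s4, s5, e1, pow_succ]
      · rintro m' ⟨s1, s2, s3, s4, s5⟩
        have e8 : m'.int 8 = p.val 8 := by
          rw [s1 8 (by norm_num) (by norm_num) (by norm_num), q2]
        rw [Test.Holds, s4, e8]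
        exact lt_irrefl _
      · have e1 : m'.int 1 = 1 := by
          rw [r1 1 (by norm_num) (by norm_num) (by norm_num), q1 1 (by norm_num), hi]
          simp
        refine ⟨fun a h9 h22 h23 => ?_, ?_⟩
        · simp [Instr.exec, h9, h22, h23, r1 a h9 h22 h23]
        · simp [Instr.exec, r2, e1, r4]
      · rintro m' ⟨s1, s2, s3, -, s5⟩
        exact ⟨s1, s2, s3, s5⟩
  · rintro m' ⟨r1, r2, r3, r4⟩
    rw [Test.Holds, r3, r1 4 (by norm_num) (by norm_num) (by norm_num), q1 4 (by norm_num), hi]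
    simpa [Par.val] using hp.g_le
  · refine ⟨fun _ _ _ _ => rfl, ?_, ?_, q3⟩
    · rw [q1 9 (by norm_num), hi]
      simp
    -- The power in cell `22` starts as `0 = 0 ^ L`, which needs `0 < L`.
    · rw [q1 22 (by norm_num), hi, zero_pow hp.L_pos.ne']
      simp
  rintro m₂ ⟨r1, r2, -, r4⟩
  refine wp_seq (wp_loop (fun t m' => (∀ a, a ≠ 10 → a ≠ 24 → m'.int a = m₂.int a) ∧
    m'.int 10 = t ∧ m'.int 24 = t * p.N ∧ m'.real 0 = 0) ?_ ?_ ?_ ?_)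
  · rintro t ht m' ⟨s1, s2, s3, s4⟩
    have e1 : m'.int 1 = 1 := by
      rw [s1 1 (by norm_num) (by norm_num), r1 1 (by norm_num) (by norm_num) (by norm_num),
        q1 1 (by norm_num), hi]
      simp
    have e7 : m'.int 7 = p.N := by
      rw [s1 7 (by norm_num) (by norm_num), r1 7 (by norm_num) (by norm_num) (by norm_num),
        q1 7 (by norm_num), hi]
      simp
    refine ⟨?_, wp_block ⟨fun a h10 h24 => ?_, ?_⟩⟩
    · rw [Test.Holds, s3, s1 4 (by norm_num) (by norm_num),
        r1 4 (by norm_num) (by norm_num) (by norm_num), q1 4 (by norm_num), hi]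
      simpa using hp.Q_lt t ht
    · simp [Instr.exec, h10, h24, s1 a h10 h24]
    · simp [Instr.exec, s2, s3, s4, e1, e7, add_mul]
  · rintro m' ⟨s1, s2, s3, s4⟩
    rw [Test.Holds, s3, s1 4 (by norm_num) (by norm_num),
      r1 4 (by norm_num) (by norm_num) (by norm_num), q1 4 (by norm_num), hi]
    simpa [Par.val] using hp.Q_le
  · refine ⟨fun _ _ _ => rfl, ?_, ?_, r4⟩
    · rw [r1 10 (by norm_num) (by norm_num) (by norm_num), q1 10 (by norm_num), hi]
      simp
    · rw [r1 24 (by norm_num) (by norm_num) (by norm_num), q1 24 (by norm_num), hi]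
      simp
  rintro m₃ ⟨s1, s2, -, s4⟩
  have key : ∀ a, a ≠ 8 → a ≠ 9 → a ≠ 10 → a ≠ 22 → a ≠ 23 → a ≠ 24 → m₃.int a = m.int a :=
    fun a h8 h9 h10 h22 h23 h24 => by rw [s1 a h10 h24, r1 a h9 h22 h23, q1 a h8]
  have e9 : m₃.int 9 = p.g := by
    rw [s1 9 (by norm_num) (by norm_num), r2]
    rfl
  have e8 : m₃.int 8 = p.L := by
    rw [s1 8 (by norm_num) (by norm_num), r1 8 (by norm_num) (by norm_num) (by norm_num), q2]
    rfl
  have e10 : m₃.int 10 = p.Q := s2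
  refine wp_block ⟨⟨fun a ha ha' => ?_, by simp [Instr.exec, s4]⟩, ?_, fun a ha => ?_⟩
  · interval_cases a <;> simp [Instr.exec, key, hi, Par.val, e8, e9, e10, numSwaps]
  · simp [Instr.exec, key, hi]
  · simp only [execs_cons, execs_nil, Instr.exec, Memory.setInt_int]
    repeat rw [if_neg (by omega)]
    rw [key a (by omega) (by omega) (by omega) (by omega) (by omega) (by omega), hi]
    repeat rw [if_neg (by omega)]

/-- Needed because the cells behind the `k` centers hold unrelated values. -/
theorem near_congr {D D' : ℕ → ℝ} {k : ℕ} (h : ∀ j < k, D j = D' j) : near D k = near D' k := by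
  induction k with
  | zero => rfl
  | succ k ih =>
    have ih := ih fun j hj => h j (by omega)
    simp only [near]
    by_cases hk : k = 0
    · simp [hk]
    · rw [← ih, h k (by omega), h (near D k) (Nat.lt_succ_of_lt (near_spec D (by omega)).1)]

/-- Leave the coordinates of the centers of the root in the real cells from `100` on, replacing
repeated centers by fresh points. -/
def outS : Stmt :=
  .block [.intMul 70 8 13, .intMul 70 70 14, .intAdd 70 16 70, .intAdd 71 3 2, .realAdd 41 0 0] ;;
  .forLT 6 72 (.block [.intRead 73 70, .intStore 71 73, .intAdd 70 70 17, .intAdd 71 71 17,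
    .intMul 74 73 5, .intAdd 74 1 74, .realRead 42 74, .realMul 42 42 42, .realAdd 41 41 42]) ;;
  .block [.intAdd 71 3 2, .intAdd 75 3 2] ;;
  .forLT 6 72 (.block [.intLoad 40 71, .intAdd 71 71 17] ;; nearS ;;
    .block [.intMul 74 40 5, .intAdd 74 1 74, .intAdd 76 75 2] ;;
    .forLT 5 77 (.block [.realRead 42 74, .realStore 75 42, .intAdd 74 74 1, .intAdd 75 75 1]) ;;
    .block [.realOfInt 43 72, .realAdd 43 43 41, .realOfInt 42 1, .realAdd 43 43 42] ;;
    .cond (.intLT 33 72) [.realStore 76 43])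

/-- Coordinate `l` of output center `j`, for the centers with indices `c`. -/
noncomputable def outValue (sh : Memory) (d k : ℕ) (c : ℕ → ℕ) (j l : ℕ) : ℝ :=
  open Classical in
  if l = 0 ∧ near (fun i => sqd sh d (c j) (c i)) k < j then
    j + (∑ i ∈ range k, sh.real (1 + c i * d) * sh.real (1 + c i * d)) + 1
  else sh.real (1 + (c j * d + l))

/-- The first pass copies the root's center indices and sums the squares of their first coordinates
in real cell `41`. The second pass writes coordinates to real cells only, so the indices stay
available to `nearS`; cell `76` keeps the address of coordinate `0`, the only one changed for a
repeated center. -/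
theorem wp_outS {sh m : Memory} {p : Par} (hm : Env p m) (hk : 0 < p.k) :
    wp sh p.val outS (fun m' => (∀ a < 20, m'.int a = m.int a) ∧ m'.real 0 = 0 ∧
      ∀ j < p.k, ∀ l < p.d, m'.real (100 + (j * p.d + l)) =
        outValue sh p.d p.k (fun j => sh.int (p.addr p.L 0 + 2 * j)) j l) m := by
  classical
  have er := hm.real
  set c : ℕ → ℕ := fun j => sh.int (p.addr p.L 0 + 2 * j) with hc
  obtain ⟨e1, e2, e3, e4, e5, e6, e7, e8, e9, e10, e11, e12, e13, e14, e15, e16, e17, -⟩ := hm.all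
  refine wp_seq (wp_block (wp_seq (wp_forLT (by norm_num) (fun j m' =>
    (∀ a < 20, m'.int a = m.int a) ∧ m'.real 0 = 0 ∧ m'.int 70 = p.addr p.L 0 + 2 * j ∧
    m'.int 71 = 100 + 2 * j ∧ (∀ i < j, m'.centers i = c i) ∧
    m'.real 41 = ∑ i ∈ range j, sh.real (1 + c i * p.d) * sh.real (1 + c i * p.d))
    (fun i m' h => hm.congr h.1 (h.2.1.trans er.symm)) ?_ ?_ ?_ ?_)))
  · rintro j m' v ⟨h1, h2, h3, h4, h5, h6⟩
    refine ⟨fun a ha => ?_, h2, by simpa using h3, by simpa using h4, fun i hi => ?_, h6⟩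
    · rw [Memory.setInt_int, if_neg (by omega), h1 a ha]
    · rw [centers_setInt_of_lt (by norm_num), h5 i hi]
  · rintro j - m' ⟨h1, h2, h3, h4, h5, h6⟩ h7
    have hm' : Env p m' := hm.congr h1 (h2.trans er.symm)
    obtain ⟨e1, -, -, -, e5, -, -, -, -, -, -, -, -, -, -, -, e17, -⟩ := hm'.all
    set m₁ := (m'.setInt 73 (c j)).setInt (100 + 2 * j) (c j) with hm₁
    have hlt : ∀ a < 100, a ≠ 73 → m₁.int a = m'.int a := fun a ha ha' => by
      rw [hm₁, Memory.setInt_int, if_neg (by omega), Memory.setInt_int, if_neg ha']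
    have h73 : m₁.int 73 = c j := by
      rw [hm₁, Memory.setInt_int, if_neg (by omega), Memory.setInt_int, if_pos rfl]
    have hreal : m₁.real = m'.real := rfl
    have hcen : m₁.centers = Function.update m'.centers j (c j) := by
      rw [hm₁, centers_setInt, centers_setInt_of_lt (by norm_num)]
    have hex : execs sh [.intRead 73 70, .intStore 71 73, .intAdd 70 70 17, .intAdd 71 71 17,
        .intMul 74 73 5, .intAdd 74 1 74, .realRead 42 74, .realMul 42 42 42, .realAdd 41 41 42] m'
        = execs sh [.intAdd 70 70 17, .intAdd 71 71 17, .intMul 74 73 5, .intAdd 74 1 74,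
          .realRead 42 74, .realMul 42 42 42, .realAdd 41 41 42] m₁ := by
      simp only [execs_cons, Instr.exec, h3, hm₁, hc, Memory.setInt_int, h4]
      simp
    refine wp_block ?_
    rw [hex]
    clear_value m₁
    refine ⟨⟨fun a ha => ?_, ?_, ?_, ?_, fun i hi => ?_, ?_⟩, ?_⟩
    · rw [← h1 a ha, ← hlt a (by omega) (by omega)]
      simp only [execs_cons, execs_nil, Instr.exec, Memory.setInt_int, Memory.setReal_int]
      repeat rw [if_neg (by omega)]
    · simp [Instr.exec, hreal, h2]
    · simp [Instr.exec, hlt, h3, e17, mul_add, add_assoc]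
    · simp [Instr.exec, hlt, h4, e17, mul_add, add_assoc]
    · have : (execs sh [.intAdd 70 70 17, .intAdd 71 71 17, .intMul 74 73 5, .intAdd 74 1 74,
          .realRead 42 74, .realMul 42 42 42, .realAdd 41 41 42] m₁).centers i = m₁.centers i := by
        simp only [Memory.centers, execs_cons, execs_nil, Instr.exec, Memory.setInt_int,
          Memory.setReal_int]
        repeat rw [if_neg (by omega)]
      rw [this, hcen, Function.update_apply]
      split_ifs with h
      · rw [h]
      · exact h5 i (by omega)
    · simp [Instr.exec, hlt, h73, hreal, h6, e1, e5, sum_range_succ]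
    · simp [Instr.exec, hlt, h7]
  · refine ⟨fun a ha => ?_, ?_, ?_, ?_, fun i hi => absurd hi (Nat.not_lt_zero _), ?_⟩
    · simp only [execs_cons, execs_nil, Instr.exec, Memory.setInt_int, Memory.setReal_int]
      repeat rw [if_neg (by omega)]
    · simp [Instr.exec, er]
    · simp [Instr.exec, e8, e13, e14, e16, Par.addr]
    · simp [Instr.exec, e3, e2]
    · simp [Instr.exec, er]
  rintro m₀ ⟨h1, h2, -, -, h5, h6⟩
  have hm₀ : Env p m₀ := hm.congr h1 (h2.trans er.symm)
  have h5' : ∀ i < p.k, m₀.centers i = c i := h5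
  set S := ∑ i ∈ range p.k, sh.real (1 + c i * p.d) * sh.real (1 + c i * p.d) with hS
  have h6' : m₀.real 41 = S := h6
  clear h5 h6
  set V := outValue sh p.d p.k c with hV
  obtain ⟨f1, f2, f3, -⟩ := hm₀.all
  refine wp_seq (wp_block (wp_forLT (by norm_num) (fun j m' =>
    (∀ a, a < 20 ∨ 100 ≤ a → m'.int a = m₀.int a) ∧ m'.real 0 = 0 ∧ m'.real 41 = S ∧
    m'.int 71 = 100 + 2 * j ∧ m'.int 75 = 100 + j * p.d ∧
    ∀ i < j, ∀ l < p.d, m'.real (100 + (i * p.d + l)) = V i l)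
    (fun i m' h => hm₀.congr (fun a ha => h.1 a (.inl ha)) (h.2.1.trans h2.symm)) ?_ ?_ ?_ ?_))
  · rintro j m' v ⟨q1, q2, q3, q4, q5, q6⟩
    refine ⟨fun a ha => ?_, q2, q3, by simpa using q4, by simpa using q5, q6⟩
    rw [Memory.setInt_int, if_neg (by omega), q1 a ha]
  · rintro j hj m' ⟨q1, q2, q3, q4, q5, q6⟩ q7
    have hj : j < p.k := hj
    have hm' : Env p m' := hm₀.congr (fun a ha => q1 a (.inl ha)) (q2.trans h2.symm)
    have g17 := hm'.int 17 (by norm_num) (by norm_num)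
    set m₁ := execs sh [Instr.intLoad 40 71, Instr.intAdd 71 71 17] m' with hm₁
    have r1 : ∀ a, a ≠ 40 → a ≠ 71 → m₁.int a = m'.int a := fun a h h' => by
      simp [hm₁, Instr.exec, h, h']
    have r40 : m₁.int 40 = c j := by
      rw [← h5' j hj]
      simp [hm₁, Instr.exec, q4, Memory.centers, q1]
    have r71 : m₁.int 71 = 100 + 2 * (j + 1) := by
      simp [hm₁, Instr.exec, q4, g17, Par.val]
      ring
    have rreal : m₁.real = m'.real := by simp [hm₁, Instr.exec]
    have hm₁' : Env p m₁ := hm'.congr (fun a ha => r1 a (by omega) (by omega)) (by rw [rreal])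
    have hcen : ∀ i < p.k, m₁.centers i = c i := fun i hi => by
      rw [← h5' i hi, Memory.centers, r1 _ (by omega) (by omega), q1 _ (by omega), Memory.centers]
    refine wp_seq (wp_block (wp_seq ((wp_nearS hm₁' hk).mono ?_)))
    rintro m₂ ⟨s1, s2, -⟩
    rw [r40, near_congr (D' := fun i => sqd sh p.d (c j) (c i))
      (fun i hi => by rw [hcen i hi])] at s2
    have hm₂ := s1.env hm₁'
    obtain ⟨g1, g2, -, -, g5, -⟩ := hm₂.all
    have t75 : m₂.int 75 = 100 + j * p.d := by
      rw [s1.int 75 (by norm_num), r1 75 (by norm_num) (by norm_num), q5]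
    set m₃ := execs sh [.intMul 74 40 5, .intAdd 74 1 74, .intAdd 76 75 2] m₂ with hm₃
    have u1 : ∀ a, a ≠ 74 → a ≠ 76 → m₃.int a = m₂.int a := fun a h h' => by
      simp [hm₃, Instr.exec, h, h']
    have u74 : m₃.int 74 = 1 + (c j * p.d + 0) := by
      simp [hm₃, Instr.exec, g1, g5, s1.int 40, r40]
    have u76 : m₃.int 76 = 100 + j * p.d := by
      simp [hm₃, Instr.exec, t75, g2]
    have ureal : m₃.real = m₂.real := by simp [hm₃, Instr.exec]
    have hm₃' : Env p m₃ := hm₂.congr (fun a ha => u1 a (by omega) (by omega)) (by rw [ureal])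
    have old : ∀ i < j, ∀ l < p.d, m₃.real (100 + (i * p.d + l)) = V i l := fun i hi l hl => by
      rw [ureal, s1.real _ (by omega), rreal, q6 i hi l hl]
    have u41 : m₃.real 41 = S := by rw [ureal, s1.real _ (by omega), rreal, q3]
    have below : ∀ i < j, ∀ l < p.d, i * p.d + l < j * p.d := fun i hi l hl => by
      calc i * p.d + l < (i + 1) * p.d := by linarith
        _ ≤ j * p.d := Nat.mul_le_mul_right _ hi
    refine wp_seq (wp_block (wp_seq (wp_forLT (by norm_num) (fun l m' =>
      (∀ a, a ≠ 74 → a ≠ 75 → a ≠ 77 → m'.int a = m₃.int a) ∧ m'.real 0 = 0 ∧ m'.real 41 = S ∧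
      m'.int 74 = 1 + (c j * p.d + l) ∧ m'.int 75 = 100 + (j * p.d + l) ∧
      (∀ i < j, ∀ l < p.d, m'.real (100 + (i * p.d + l)) = V i l) ∧
      ∀ l' < l, m'.real (100 + (j * p.d + l')) = sh.real (1 + (c j * p.d + l')))
      (fun i m' h => hm₃'.congr (fun a ha => h.1 a (by omega) (by omega) (by omega))
        (h.2.1.trans hm₃'.real.symm)) ?_ ?_ ?_ ?_)))
    · rintro l m' v ⟨v1, v2, v3, v4, v5, v6, v7⟩
      refine ⟨fun a h h' h'' => ?_, v2, v3, by simpa using v4, by simpa using v5, v6, v7⟩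
      rw [Memory.setInt_int, if_neg h'', v1 a h h' h'']
    · rintro l - m' ⟨v1, v2, v3, v4, v5, v6, v7⟩ v8
      have k1 : m'.int 1 = 1 := by
        rw [v1 1 (by norm_num) (by norm_num) (by norm_num), u1 1 (by norm_num) (by norm_num), g1]
      refine wp_block ⟨⟨fun a h h' h'' => ?_, ?_, ?_, ?_, ?_, fun i hi l' hl' => ?_,
        fun l' hl' => ?_⟩, ?_⟩
      · simp [Instr.exec, h, h', v1 a h h' h'']
      · simp [Instr.exec, v2, v5]
        omega
      · simp [Instr.exec, v3, v5]
        omega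
      · simp [Instr.exec, v4, k1, add_assoc]
      · simp [Instr.exec, v5, k1, add_assoc]
      · have := below i hi l' hl'
        simp only [execs_cons, execs_nil, Instr.exec, Memory.setInt_real, Memory.setReal_real,
          Memory.setReal_int]
        rw [if_neg (by omega), if_neg (by omega), v6 i hi l' hl']
      · simp only [execs_cons, execs_nil, Instr.exec, Memory.setInt_real, Memory.setReal_real,
          Memory.setReal_int, v4, v5, if_true]
        split_ifs with h
        · rw [show l' = l by omega]
        · omega
        · exact v7 l' (by omega)
      · simp [Instr.exec, v8]
    · exact ⟨fun _ _ _ _ => rfl, hm₃'.real, u41, u74, by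
        rw [u1 75 (by norm_num) (by norm_num), t75, add_zero], old,
        fun l' h => absurd h (Nat.not_lt_zero _)⟩
    rintro m₄ ⟨v1, v2, v3, -, v5, v6, v7⟩
    set m₅ := execs sh [.realOfInt 43 72, .realAdd 43 43 41, .realOfInt 42 1, .realAdd 43 43 42] m₄
      with hm₅
    have w1 : m₅.int = m₄.int := by simp [hm₅, Instr.exec]
    have w2 : ∀ a, a ≠ 43 → a ≠ 42 → m₅.real a = m₄.real a := fun a h h' => by
      simp [hm₅, Instr.exec, h, h']
    have w72 : m₄.int 72 = j := by
      rw [v1 72 (by norm_num) (by norm_num) (by norm_num), u1 72 (by norm_num) (by norm_num),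
        s1.int 72 (by norm_num), r1 72 (by norm_num) (by norm_num), q7]
    have w33 : m₄.int 33 = near (fun i => sqd sh p.d (c j) (c i)) p.k := by
      rw [v1 33 (by norm_num) (by norm_num) (by norm_num), u1 33 (by norm_num) (by norm_num), s2]
    have w76 : m₄.int 76 = 100 + j * p.d := by
      rw [v1 76 (by norm_num) (by norm_num) (by norm_num), u76]
    have w43 : m₅.real 43 = j + S + 1 := by
      have : m₄.int 1 = 1 := by
        rw [v1 1 (by norm_num) (by norm_num) (by norm_num), u1 1 (by norm_num) (by norm_num), g1]
      simp [hm₅, Instr.exec, w72, v3, this]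
    have hint : ∀ a, a < 20 ∨ 100 ≤ a → m₅.int a = m₀.int a := fun a ha => by
      rw [w1, v1 a (by omega) (by omega) (by omega), u1 a (by omega) (by omega),
        s1.int a (by omega), r1 a (by omega) (by omega), q1 a ha]
    have h71 : m₅.int 71 = 100 + 2 * (j + 1) := by
      rw [w1, v1 71 (by norm_num) (by norm_num) (by norm_num), u1 71 (by norm_num) (by norm_num),
        s1.int 71 (by norm_num), r71]
    have h75 : m₅.int 75 = 100 + (j + 1) * p.d := by
      rw [w1, v5, add_mul, one_mul]
      rfl
    have hjl : ∀ l < p.d, m₅.real (100 + (j * p.d + l)) = sh.real (1 + (c j * p.d + l)) :=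
      fun l hl => by rw [w2 _ (by omega) (by omega), v7 l hl]
    have hold : ∀ i < j, ∀ l < p.d, m₅.real (100 + (i * p.d + l)) = V i l := fun i hi l hl => by
      rw [w2 _ (by omega) (by omega), v6 i hi l hl]
    have hsplit : ∀ i, i < j + 1 → i < j ∨ i = j := fun i hi => by omega
    refine wp_seq (wp_block (wp_cond ?_))
    split_ifs with hcase
    · rw [Test.Holds, w1, w33, w72] at hcase
      have hex : execs sh [Instr.realStore 76 43] m₅ = m₅.setReal (100 + j * p.d) (j + S + 1) := by
        simp [Instr.exec, w1, w76, w43]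
      rw [hex]
      refine ⟨⟨hint, ?_, ?_, h71, h75, fun i hi l hl => ?_⟩, by rw [Memory.setReal_int, w1, w72]⟩
      · rw [Memory.setReal_real, if_neg (by omega), w2 0 (by norm_num) (by norm_num), v2]
      · rw [Memory.setReal_real, if_neg (by omega), w2 41 (by norm_num) (by norm_num), v3]
      · rw [Memory.setReal_real]
        rcases hsplit i hi with hi | rfl
        · have := below i hi l hl
          rw [if_neg (by omega), hold i hi l hl]
        · simp only [hV, outValue, hcase, and_true]
          by_cases hl0 : l = 0
          · rw [if_pos (by omega), if_pos hl0]
          · rw [if_neg (by omega), if_neg hl0, hjl l hl]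
    · rw [Test.Holds, w1, w33, w72] at hcase
      refine ⟨⟨hint, ?_, ?_, h71, h75, fun i hi l hl => ?_⟩, by rw [w1, w72]⟩
      · rw [w2 0 (by norm_num) (by norm_num), v2]
      · rw [w2 41 (by norm_num) (by norm_num), v3]
      · rcases hsplit i hi with hi | rfl
        · exact hold i hi l hl
        · simp only [hV, outValue, hcase, and_false, if_false]
          exact hjl l hl
  · refine ⟨fun a ha => ?_, ?_, ?_, ?_, ?_, fun i hi => absurd hi (Nat.not_lt_zero _)⟩
    · simp only [execs_cons, execs_nil, Instr.exec, Memory.setInt_int]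
      repeat rw [if_neg (by omega)]
    · simp [Instr.exec, h2]
    · simp [Instr.exec, h6']
    · simp [Instr.exec, f2, f3]
    · simp [Instr.exec, f2, f3]
  · rintro m' ⟨q1, q2, -, -, -, q6⟩
    exact ⟨fun a ha => by rw [q1 a (.inl ha), h1 a ha], q2, q6⟩

end PRAM

/-! ### The program of all processors -/

namespace PRAM

open Finset KMeans

section

variable {N : ℕ} {p : Par} {Q : (Fin N → Memory) → Memory → Prop} {ms : Fin N → Memory}
  {sh : Memory}

theorem cwp_block {β : ℕ → ℕ} {l : List Instr} (h : Q (fun i => execs sh l (ms i)) sh)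
    (hl : l.all Instr.isLocal = true := by rfl) : cwp β (.block l) Q ms sh :=
  cwp_lift (fun i m' => m' = execs sh l (ms i)) (fun _ => wp_block rfl hl) fun ms' h' => by
    rwa [funext h']

theorem cwp_forLT {κ r : ℕ} {s : Stmt} (hκ : 1 ≤ κ ∧ κ < 20)
    (I : ℕ → (Fin N → Memory) → Memory → Prop)
    (hE : ∀ i ms sh, I i ms sh → ∀ j, Env p (ms j))
    (hset : ∀ i ms sh v, I i ms sh → I i (fun j => (ms j).setInt r v) sh)
    (hbody : ∀ i < p.val κ, ∀ ms sh, I i ms sh → (∀ j, (ms j).int r = i) →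
      cwp p.val s (fun ms' sh' => I (i + 1) ms' sh' ∧ ∀ j, (ms' j).int r = i) ms sh)
    (h0 : I 0 ms sh) (hQ : ∀ ms' sh', I (p.val κ) ms' sh' → Q ms' sh') :
    cwp p.val (.forLT κ r s) Q ms sh := by
  refine cwp_seq (cwp_block ?_)
  refine cwp_loop (fun i ms sh => I i ms sh ∧ ∀ j, (ms j).int r = i) ?_ ?_ ?_
    fun ms sh h => hQ ms sh h.1
  · rintro i hi ms sh ⟨h₁, h₂⟩
    refine ⟨fun j => ?_, cwp_seq ((hbody i hi ms sh h₁ h₂).mono ?_)⟩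
    · simp only [Test.Holds, h₂, (hE i ms sh h₁ j).int κ hκ.1 hκ.2, hi]
    · rintro ms' sh' ⟨h₃, h₄⟩
      have : ∀ j, execs sh' [.intAdd r r 1] (ms' j) = (ms' j).setInt r (i + 1) := fun j => by
        simp [Instr.exec, h₄, (hE _ _ _ h₃ j).all.1]
      refine cwp_block ?_
      simp only [this]
      exact ⟨hset _ _ _ _ h₃, by simp⟩
  · rintro ms sh ⟨h₁, h₂⟩ j
    simp only [Test.Holds, h₂, (hE _ ms sh h₁ j).int κ hκ.1 hκ.2, lt_irrefl, not_false_eq_true]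
  · exact ⟨hset _ _ _ _ h0, by simp [Instr.exec]⟩

theorem mul_add_inj {B a b x y : ℕ} (hx : x < B) (hy : y < B) (h : a * B + x = b * B + y) :
    a = b ∧ x = y := by
  have hB : 0 < B := by omega
  have h1 := congrArg (· / B) h
  simp only [mul_comm _ B, Nat.mul_add_div hB, Nat.div_eq_of_lt hx, Nat.div_eq_of_lt hy] at h1
  have : a = b := by omega
  subst this
  exact ⟨rfl, by omega⟩

/-- Nodes of a level occupy disjoint blocks of `2 * k` cells; the exclusive-write rule rests on
this. -/
theorem Par.addr_inj {t q q' x y : ℕ} (hx : x < 2 * p.k) (hy : y < 2 * p.k)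
    (h : p.addr t q + x = p.addr t q' + y) : q = q' ∧ x = y := by
  unfold Par.addr at h
  have := mul_add_inj hx hy (by omega :
    (t * (p.g * (p.Q * p.N)) + q) * (2 * p.k) + x = (t * (p.g * (p.Q * p.N)) + q') * (2 * p.k) + y)
  omega

/-- Copy a node from the integer cells from `100` on to its place on level `t` (cell `82`) in the
shared memory. -/
def copyS : Stmt :=
  .block [.intMul 83 82 13, .intMul 84 81 7, .intAdd 84 84 0, .intAdd 83 83 84, .intMul 83 83 14,
    .intAdd 83 16 83, .intAdd 84 3 2] ;;
  .forLT 14 85 (.block [.intLoad 86 84] ;; .instr (.intWrite 83 86) ;;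
    .block [.intAdd 83 83 1, .intAdd 84 84 1])

/-- In round `r` processor `i` owns node `r * N + i`, and at each moment all processors write at the
same offset of their own nodes. -/
theorem cwp_copyS (hN : p.N = N) {r t : ℕ} (hE : ∀ i, Env p (ms i)) (h0 : ∀ i, (ms i).int 0 = i)
    (h81 : ∀ i, (ms i).int 81 = r) (h82 : ∀ i, (ms i).int 82 = t) :
    cwp p.val copyS (fun ms' sh' =>
      (∀ i a, a < 83 ∨ 87 ≤ a → (ms' i).int a = (ms i).int a) ∧
      (∀ i, (ms' i).real = (ms i).real) ∧ sh'.real = sh.real ∧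
      (∀ (i : Fin N), ∀ x < 2 * p.k,
        sh'.int (p.addr t (r * N + i) + x) = (ms i).int (100 + x)) ∧
      ∀ a, (∀ (i : Fin N), ∀ x < 2 * p.k, a ≠ p.addr t (r * N + i) + x) →
        sh'.int a = sh.int a) ms sh := by
  refine cwp_seq (cwp_block (cwp_forLT (by norm_num) (fun x ms' sh' =>
      (∀ i a, a < 83 ∨ 87 ≤ a → (ms' i).int a = (ms i).int a) ∧
      (∀ i, (ms' i).real = (ms i).real) ∧ sh'.real = sh.real ∧
      (∀ i, (ms' i).int 83 = p.addr t (r * N + i) + x) ∧ (∀ i, (ms' i).int 84 = 100 + x) ∧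
      (∀ (i : Fin N), ∀ y < x, sh'.int (p.addr t (r * N + i) + y) = (ms i).int (100 + y)) ∧
      ∀ a, (∀ (i : Fin N), ∀ y < x, a ≠ p.addr t (r * N + i) + y) → sh'.int a = sh.int a)
      (fun x ms' sh' h j => (hE j).congr (fun a ha => h.1 j a (by omega)) (by rw [h.2.1 j]))
      ?_ ?_ ?_ ?_))
  · rintro x ms' sh' v ⟨h1, h2, h3, h4, h5, h6, h7⟩
    refine ⟨fun i a ha => ?_, h2, h3, by simpa using h4, by simpa using h5, h6, h7⟩
    rw [Memory.setInt_int, if_neg (by omega), h1 i a ha]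
  · rintro x hx ms' sh' ⟨h1, h2, h3, h4, h5, h6, h7⟩ h8
    have hx : x < 2 * p.k := hx
    refine cwp_seq (cwp_block ?_)
    have hex : ∀ i, execs sh' [Instr.intLoad 86 84] (ms' i) =
        (ms' i).setInt 86 ((ms i).int (100 + x)) := fun i => by
      simp only [execs_cons, execs_nil, Instr.exec, h5 i]
      rw [h1 i _ (by omega)]
    simp only [hex]
    have g83 : ∀ i, ((ms' i).setInt 86 ((ms i).int (100 + x))).int 83 =
        p.addr t (r * N + i) + x := fun i => by simp [h4 i]
    refine cwp_seq (cwp_intWrite (fun i j hij => ?_) fun f hf hf' => cwp_block ?_)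
    · simp only [g83] at hij
      have := (Par.addr_inj hx hx hij).1
      exact Fin.ext (by omega)
    · simp only [g83] at hf hf'
      have one : ∀ i, (ms' i).int 1 = 1 := fun i => by
        rw [h1 i 1 (by norm_num), (hE i).all.1]
      refine ⟨⟨fun i a ha => ?_, fun i => ?_, h3, fun i => ?_, fun i => ?_, fun i y hy => ?_,
        fun a ha => ?_⟩, fun i => ?_⟩
      · simp only [execs_cons, execs_nil, Instr.exec, Memory.setInt_int]
        repeat rw [if_neg (by omega)]
        exact h1 i a ha
      · simpa [Instr.exec] using h2 i
      · simp [Instr.exec, h4, one, add_assoc]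
      · simp [Instr.exec, h5, one, add_assoc]
      · change f _ = _
        rcases Nat.lt_succ_iff_lt_or_eq.1 hy with hy | rfl
        · rw [hf', h6 i y hy]
          intro j hj
          have := (Par.addr_inj hx (hy.trans hx) hj).2
          omega
        · rw [hf i]
          simp
      · exact (hf' a fun i => (ha i x (by omega)).symm).trans
          (h7 a fun i y hy => ha i y (by omega))
      · simp [Instr.exec, h8]
  · refine ⟨fun i a ha => ?_, fun i => by simp [Instr.exec], rfl, fun i => ?_, fun i => ?_,
      fun i y hy => absurd hy (Nat.not_lt_zero _), fun _ _ => rfl⟩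
    · simp only [execs_cons, execs_nil, Instr.exec, Memory.setInt_int]
      repeat rw [if_neg (by omega)]
    · obtain ⟨e1, e2, e3, e4, e5, e6, e7, e8, e9, e10, e11, e12, e13, e14, e15, e16, e17, -⟩ :=
        (hE i).all
      simp [Instr.exec, h0, h81, h82, e7, e13, e14, e16, Par.addr, hN]
    · obtain ⟨e1, e2, e3, -⟩ := (hE i).all
      simp [Instr.exec, e2, e3]
  · rintro ms' sh' ⟨h1, h2, h3, -, -, h6, h7⟩
    exact ⟨h1, h2, h3, h6, h7⟩

/-- Copy the centers from the real cells from `100` on to the shared memory; only those of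
processor `0` matter. -/
def copyOutS : Stmt :=
  .block [.intMul 83 4 5, .intAdd 83 1 83, .intMul 84 0 15, .intAdd 83 83 84, .intAdd 84 3 2] ;;
  .forLT 15 85 (.block [.realLoad 42 84] ;; .instr (.realWrite 83 42) ;;
    .block [.intAdd 83 83 1, .intAdd 84 84 1])

/-- In lockstep every processor has to write its copy of the result. Shifting the copies by
multiples of `k * d` keeps the writes exclusive and puts that of processor `0` into the output
cells. -/
theorem cwp_copyOutS (hE : ∀ i, Env p (ms i)) (h0 : ∀ i, (ms i).int 0 = i) :
    cwp p.val copyOutS (fun _ sh' => ∀ (i : Fin N), ∀ x < p.k * p.d,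
        sh'.real (1 + p.n * p.d + (i * (p.k * p.d) + x)) = (ms i).real (100 + x)) ms sh := by
  refine cwp_seq (cwp_block (cwp_forLT (by norm_num) (fun x ms' sh' =>
      (∀ i a, a < 20 → (ms' i).int a = (ms i).int a) ∧
      (∀ i a, a ≠ 42 → (ms' i).real a = (ms i).real a) ∧
      (∀ i, (ms' i).int 83 = 1 + p.n * p.d + (i * (p.k * p.d) + x)) ∧
      (∀ i, (ms' i).int 84 = 100 + x) ∧
      (∀ (i : Fin N), ∀ y < x, sh'.real (1 + p.n * p.d + (i * (p.k * p.d) + y)) =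
        (ms i).real (100 + y)))
      (fun x ms' sh' h j => (hE j).congr (fun a ha => h.1 j a (by omega))
        (h.2.1 j 0 (by norm_num))) ?_ ?_ ?_ ?_))
  · rintro x ms' sh' v ⟨h1, h2, h3, h4, h5⟩
    refine ⟨fun i a ha => ?_, h2, by simpa using h3, by simpa using h4, h5⟩
    rw [Memory.setInt_int, if_neg (by omega), h1 i a ha]
  · rintro x hx ms' sh' ⟨h1, h2, h3, h4, h5⟩ h6
    have hx : x < p.k * p.d := hx
    refine cwp_seq (cwp_block ?_)
    have hex : ∀ i, execs sh' [Instr.realLoad 42 84] (ms' i) =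
        (ms' i).setReal 42 ((ms i).real (100 + x)) := fun i => by
      simp only [execs_cons, execs_nil, Instr.exec, h4 i]
      rw [h2 i _ (by omega)]
    simp only [hex]
    refine cwp_seq (cwp_realWrite (fun i j hij => ?_) fun f hf hf' => cwp_block ?_)
    · simp only [Memory.setReal_int, h3] at hij
      have := (mul_add_inj hx hx (Nat.add_left_cancel hij)).1
      exact Fin.ext this
    · simp only [Memory.setReal_int, h3] at hf hf'
      have one : ∀ i, (ms' i).int 1 = 1 := fun i => by
        rw [h1 i 1 (by norm_num), (hE i).all.1]
      refine ⟨⟨fun i a ha => ?_, fun i a ha => ?_, fun i => ?_, fun i => ?_, fun i y hy => ?_⟩,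
        fun i => ?_⟩
      · simp only [execs_cons, execs_nil, Instr.exec, Memory.setInt_int, Memory.setReal_int]
        repeat rw [if_neg (by omega)]
        exact h1 i a ha
      · simp [Instr.exec, ha, h2 i a ha]
      · simp [Instr.exec, h3, one, add_assoc]
      · simp [Instr.exec, h4, one, add_assoc]
      · change f _ = _
        rcases Nat.lt_succ_iff_lt_or_eq.1 hy with hy | rfl
        · rw [hf', h5 i y hy]
          intro j hj
          have := (mul_add_inj hx (hy.trans hx) (Nat.add_left_cancel hj)).2
          omega
        · rw [hf i]
          simp
      · simp [Instr.exec, h6]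
  · refine ⟨fun i a ha => ?_, fun i a _ => by simp [Instr.exec], fun i => ?_, fun i => ?_,
      fun i y hy => absurd hy (Nat.not_lt_zero _)⟩
    · simp only [execs_cons, execs_nil, Instr.exec, Memory.setInt_int]
      repeat rw [if_neg (by omega)]
    · obtain ⟨e1, e2, e3, e4, e5, e6, e7, e8, e9, e10, e11, e12, e13, e14, e15, e16, e17, -⟩ :=
        (hE i).all
      simp [Instr.exec, h0, e1, e4, e5, e15]
    · obtain ⟨e1, e2, e3, -⟩ := (hE i).all
      simp [Instr.exec, e2, e3]
  · rintro ms' sh' ⟨-, -, -, -, h5⟩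
    exact h5

/-- All nodes of a level are handled in `Q` rounds. -/
theorem cwp_rounds (hN : p.N = N) {s : Stmt} {t : ℕ} {ok : ℕ → (ℕ → ℕ) → Prop}
    {J : Fin N → Memory → Prop}
    (hok : ∀ q f f', (∀ x < 2 * p.k, f' x = f x) → ok q f → ok q f')
    (hJ : ∀ i m, J i m → Env p m ∧ m.int 0 = i ∧ m.int 82 = t)
    (hJ' : ∀ i m m', J i m → (∀ a, a < 81 ∨ a = 82 ∨ 87 ≤ a → m'.int a = m.int a) →
      m'.real = m.real → J i m')
    (hs : ∀ r < p.Q, ∀ i m sh', J i m → m.int 81 = r → sh'.real = sh.real →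
      (∀ a < p.addr t 0, sh'.int a = sh.int a) →
      wp sh' p.val s (fun m' => J i m' ∧ m'.int 81 = r ∧
        ok (r * N + i) fun x => m'.int (100 + x)) m)
    (h0 : ∀ i, J i (ms i)) :
    cwp p.val (.forLT 10 81 (s ;; copyS)) (fun ms' sh' => (∀ i, J i (ms' i)) ∧
      sh'.real = sh.real ∧ (∀ q < p.Q * N, ok q fun x => sh'.int (p.addr t q + x)) ∧
      ∀ a, (∀ q < p.Q * N, ∀ x < 2 * p.k, a ≠ p.addr t q + x) → sh'.int a = sh.int a) ms sh := by
  refine cwp_forLT (by norm_num) (fun r ms' sh' => (∀ i, J i (ms' i)) ∧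
      sh'.real = sh.real ∧ (∀ q < r * N, ok q fun x => sh'.int (p.addr t q + x)) ∧
      ∀ a, (∀ q < r * N, ∀ x < 2 * p.k, a ≠ p.addr t q + x) → sh'.int a = sh.int a)
    (fun r ms' sh' h j => (hJ j _ (h.1 j)).1) ?_ ?_ ?_ ?_
  · rintro r ms' sh' v ⟨h1, h2⟩
    refine ⟨fun i => hJ' i _ _ (h1 i) (fun a ha => ?_) rfl, h2⟩
    rw [Memory.setInt_int, if_neg (by omega)]
  · rintro r hr ms' sh' ⟨h1, h2, h3, h4⟩ h5
    -- Earlier rounds have written on level `t` only, so the levels that are read remain unchanged.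
    have hlow : ∀ a < p.addr t 0, sh'.int a = sh.int a := fun a ha => h4 a fun q _ x _ h => by
      have : p.addr t 0 ≤ p.addr t q := by
        unfold Par.addr
        exact Nat.add_le_add_left (Nat.mul_le_mul_right _ (Nat.add_le_add_left (Nat.zero_le q) _)) _
      omega
    refine cwp_seq (cwp_lift _ (fun i => hs r hr i (ms' i) sh' (h1 i) (h5 i) h2 hlow) ?_)
    intro ms₁ h6
    refine (cwp_copyS hN (r := r) (fun i => (hJ i _ (h6 i).1).1) (fun i => (hJ i _ (h6 i).1).2.1)
      (fun i => (h6 i).2.1) (fun i => (hJ i _ (h6 i).1).2.2)).mono ?_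
    rintro ms₂ sh₂ ⟨q1, q2, q3, q4, q5⟩
    have hlt : ∀ i : Fin N, r * N + i < (r + 1) * N := fun i => by
      rw [add_mul, one_mul]
      exact Nat.add_lt_add_left i.2 _
    refine ⟨⟨fun i => hJ' i _ _ (h6 i).1 (fun a ha => q1 i a (by omega)) (q2 i), q3.trans h2,
      fun q hq => ?_, fun a ha => ?_⟩, fun i => ?_⟩
    · rcases lt_or_ge q (r * N) with hq' | hq'
      · refine hok q _ _ (fun x hx => ?_) (h3 q hq')
        refine q5 _ fun i y hy h => ?_
        have := (Par.addr_inj hx hy h).1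
        omega
      · obtain ⟨i, rfl⟩ := Nat.exists_eq_add_of_le hq'
        have hi : i < N := by
          rw [add_mul, one_mul] at hq
          omega
        exact hok _ _ _ (fun x hx => q4 ⟨i, hi⟩ x hx) (h6 ⟨i, hi⟩).2.2
    · rw [q5 a fun i x hx => ha _ (hlt i) x hx, h4 a fun q hq x hx => ha q ?_ x hx]
      rw [add_mul]
      omega
    · rw [q1 i 81 (by norm_num), (h6 i).2.1]
  · exact ⟨h0, rfl, fun q hq => absurd hq (by simp), fun _ _ => rfl⟩
  · exact fun ms' sh' h => h

end

end PRAM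

/-! ### Correctness of the tree of summaries -/

namespace PRAM

open Finset KMeans

/-- The point with index `a`. -/
noncomputable def point (d : ℕ) (real : ℕ → ℝ) (a : ℕ) : EuclideanSpace ℝ (Fin d) :=
  WithLp.toLp 2 fun l => real (1 + (a * d + l))

theorem sqd_eq_dist (sh : Memory) (d : ℕ) :
    sqd sh d = fun a b => dist (point d sh.real a) (point d sh.real b) ^ 2 := by
  funext a b
  rw [EuclideanSpace.dist_eq, Real.sq_sqrt (sum_nonneg fun _ _ => sq_nonneg _), sqd, sum_range]
  exact sum_congr rfl fun l _ => by rw [Real.dist_eq, sq_abs]; rfl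

/-- The indices of the points below node `q` of level `t`. -/
def leaves (p : Par) (t q : ℕ) : Finset ℕ := {i ∈ range p.n | i / p.g ^ t = q}

/-- All nodes of level `t` have been computed, and the cells for the later levels are empty. -/
structure LevelDone (p : Par) (real : ℕ → ℝ) (t : ℕ) (sh : Memory) : Prop where
  sh_real : sh.real = real
  node : ∀ q < p.g * (p.Q * p.N), IsSummary (point p.d real) p.k p.k (2626 ^ t - 1)
    (leaves p t q) fun x => sh.int (p.addr t q + x)
  empty : ∀ a, p.addr (t + 1) 0 ≤ a → sh.int a = 0

theorem Par.addr_add_lt {p : Par} {t q x : ℕ} (hq : q < p.g * (p.Q * p.N)) (hx : x < 2 * p.k) :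
    p.addr t q + x < p.addr (t + 1) 0 := by
  unfold Par.addr
  have : (t * (p.g * (p.Q * p.N)) + q + 1) * (2 * p.k) ≤
      ((t + 1) * (p.g * (p.Q * p.N)) + 0) * (2 * p.k) :=
    Nat.mul_le_mul_right _ (by rw [add_mul]; omega)
  rw [add_mul _ 1] at this
  omega

theorem Par.addr_zero_le (p : Par) (t q : ℕ) : p.addr t 0 ≤ p.addr t q := by
  unfold Par.addr
  exact Nat.add_le_add_left (Nat.mul_le_mul_right _ (Nat.add_le_add_left (Nat.zero_le q) _)) _

theorem Par.addr_le_succ (p : Par) (t : ℕ) : p.addr t 0 ≤ p.addr (t + 1) 0 := by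
  unfold Par.addr
  exact Nat.add_le_add_left (Nat.mul_le_mul_right _ (Nat.add_le_add_right
    (Nat.mul_le_mul_right _ (Nat.le_succ t)) 0)) _

/-- A level has room for `g * (Q * N)` nodes, so that the `Q * N` nodes computed one level higher
find all their children. Nodes beyond `Q * N` have numbers of at least `n`, hence no leaves, and
their untouched zero cells are correct summaries. -/
theorem LevelDone.of_nodes {p : Par} {real : ℕ → ℝ} {t : ℕ} {sh sh' : Memory} (hg : 0 < p.g)
    (hQ : p.n ≤ p.Q * p.N) (hreal : sh'.real = real)
    (hnode : ∀ q < p.Q * p.N, q < p.g * (p.Q * p.N) →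
      IsSummary (point p.d real) p.k p.k (2626 ^ t - 1)
      (leaves p t q) fun x => sh'.int (p.addr t q + x))
    (hsame : ∀ a, (∀ q < p.Q * p.N, ∀ x < 2 * p.k, a ≠ p.addr t q + x) → sh'.int a = sh.int a)
    (hempty : ∀ a, p.addr t 0 ≤ a → sh.int a = 0) : LevelDone p real t sh' := by
  have hle : p.Q * p.N ≤ p.g * (p.Q * p.N) := Nat.le_mul_of_pos_left _ hg
  refine ⟨hreal, fun q hq => ?_, fun a ha => ?_⟩
  · rcases lt_or_ge q (p.Q * p.N) with h | h
    · exact hnode q h hq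
    · have : leaves p t q = ∅ := filter_eq_empty_iff.2 fun i hi h' => by
        have := mem_range.1 hi
        have := Nat.div_le_self i (p.g ^ t)
        omega
      rw [this]
      refine isSummary_empty fun j hj => ?_
      rw [hsame, hempty _ ((p.addr_zero_le t q).trans (Nat.le_add_right _ _))]
      intro q' hq' x hx heq
      have := (Par.addr_inj (by omega) hx heq).1
      omega
  · rw [hsame, hempty a ((p.addr_le_succ t).trans ha)]
    intro q hq x hx h
    have := Par.addr_add_lt (p := p) (t := t) (hq.trans_le hle) hx
    omega

/-- A reduction of the concatenated children of a node summarizes the leaves below the node. -/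
theorem LevelDone.isSummary {p : Par} {real : ℕ → ℝ} {t q : ℕ} {sh : Memory} (hk : 0 < p.k)
    (hg : 0 < p.g) (h : LevelDone p real t sh) (hq : q < p.Q * p.N) {F f : ℕ → ℕ}
    (hF : ∀ x < 2 * (p.g * p.k), F x = sh.int (p.addr t (p.g * q) + x))
    (hf : IsReduction (sqd sh p.d) p.k (p.g * p.k) F f) :
    IsSummary (point p.d real) p.k p.k (2626 ^ (t + 1) - 1) (leaves p (t + 1) q) f := by
  rw [sqd_eq_dist, h.sh_real] at hf
  have hdiv : ∀ i ∈ leaves p (t + 1) q, i / p.g ^ t / p.g = q := fun i hi => by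
    rw [Nat.div_div_eq_div_mul, ← pow_succ]
    exact (mem_filter.1 hi).2
  have hc : ∀ i ∈ leaves p (t + 1) q, p.g * q ≤ i / p.g ^ t ∧ i / p.g ^ t < p.g * q + p.g := by
    intro i hi
    have h1 := hdiv i hi
    have h2 := Nat.div_add_mod (i / p.g ^ t) p.g
    have h3 := Nat.mod_lt (i / p.g ^ t) hg
    rw [h1] at h2
    omega
  have hcat : IsSummary (point p.d real) p.k (p.g * p.k) (2626 ^ t - 1) (leaves p (t + 1) q) F := by
    refine IsSummary.concat (fun i => i / p.g ^ t - p.g * q)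
      (fun i hi => by have := hc i hi; omega) fun r hr => ?_
    have hr' : p.g * q + r < p.g * (p.Q * p.N) := by
      calc p.g * q + r < p.g * (q + 1) := by rw [mul_add, mul_one]; omega
        _ ≤ _ := Nat.mul_le_mul_left _ hq
    have := h.node _ hr'
    have hset : {i ∈ leaves p (t + 1) q | i / p.g ^ t - p.g * q = r} =
        leaves p t (p.g * q + r) := by
      ext i
      rw [mem_filter]
      constructor
      · rintro ⟨h1, h2⟩
        have := hc i h1
        exact mem_filter.2 ⟨(mem_filter.1 h1).1, by omega⟩
      · intro h1
        have h2 := mem_filter.1 h1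
        refine ⟨mem_filter.2 ⟨h2.1, ?_⟩, by omega⟩
        rw [pow_succ, ← Nat.div_div_eq_div_mul, h2.2, Nat.mul_add_div hg, Nat.div_eq_of_lt hr,
          add_zero]
    rw [hset]
    refine this.congr fun x hx => ?_
    have h1 : (r + 1) * p.k ≤ p.g * p.k := Nat.mul_le_mul_right _ hr
    rw [add_mul, one_mul] at h1
    rw [hF _ (by omega)]
    congr 1
    unfold Par.addr
    ring
  -- `2626 * (2626 ^ t - 1) + 2624 ≤ 2626 ^ (t + 1) - 1`.
  refine (hf.isSummary hk (Nat.mul_pos hg hk) hcat).mono ?_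
  rw [pow_succ]
  linarith

/-- The complete program. -/
def mainS : Stmt :=
  setupS ;; .block [.intConst 82 0] ;; .forLT 10 81 (leafS ;; copyS) ;;
  .forLT 8 80 (.block [.intAdd 82 80 1] ;; .forLT 10 81 (nodeS ;; copyS)) ;; outS ;; copyOutS

/-- The loop over the levels has `LevelDone` as its invariant. Until the final `copyOutS` only
integer cells of the shared memory are written, so the points stay intact. -/
theorem cwp_mainS {p : Par} {ε : ℝ} {sh : Memory} (hp : p.Fits ε) (hn : 0 < p.n) (hk : 0 < p.k)
    (h0 : sh.int 0 = p.n) (h1 : sh.int 1 = p.d) (h2 : sh.int 2 = p.k) (h3 : sh.int 3 = p.N)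
    (h4 : ∀ a, 4 ≤ a → sh.int a = 0) (hε : sh.real 0 = ε) :
    cwp p.val mainS (fun _ sh' => ∃ f : ℕ → ℕ,
      IsSummary (point p.d sh.real) p.k p.k (2626 ^ p.L - 1) (range p.n) f ∧
      ∀ j < p.k, ∀ l < p.d, sh'.real (1 + p.n * p.d + (j * p.d + l)) =
        outValue sh p.d p.k (fun j => f (2 * j)) j l)
      (fun i : Fin p.N => { int := fun a => if a = 0 then i else 0, real := fun _ => 0 }) sh := by
  have hg : 0 < p.g := by
    by_contra h
    have := hp.g_le
    rw [show p.g = 0 by omega, zero_pow hp.L_pos.ne'] at this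
    omega
  have hQN : 0 < p.Q * p.N := hn.trans_le hp.Q_le
  have hN : 0 < p.N := Nat.pos_of_mul_pos_left hQN
  have hle : p.Q * p.N ≤ p.g * (p.Q * p.N) := Nat.le_mul_of_pos_left _ hg
  refine cwp_seq (cwp_lift _ (fun i => wp_setupS hp h0 h1 h2 h3 hε i) fun ms hms => ?_)
  refine cwp_seq (cwp_block (cwp_seq ?_))
  refine (cwp_rounds rfl (t := 0)
    (ok := fun q f => f 0 = q ∧ (f 1 = if q < p.n then 1 else 0) ∧
      ∀ x < 2 * p.k, 2 ≤ x → f x = 0)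
    (J := fun i m => Env p m ∧ m.int 0 = i ∧ m.int 82 = 0 ∧ ∀ a, 102 ≤ a → m.int a = 0)
    ?_ (fun i m h => ⟨h.1, h.2.1, h.2.2.1⟩) ?_ ?_ ?_).mono ?_
  · rintro q f f' hff ⟨q1, q2, q3⟩
    exact ⟨by rw [hff 0 (by omega), q1], by rw [hff 1 (by omega), q2],
      fun x hx hx' => by rw [hff x hx, q3 x hx hx']⟩
  · rintro i m m' ⟨q1, q2, q3, q4⟩ hint hreal
    exact ⟨q1.congr (fun a ha => hint a (by omega)) (by rw [hreal]),
      by rw [hint 0 (by norm_num), q2], by rw [hint 82 (by norm_num), q3],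
      fun a ha => by rw [hint a (by omega), q4 a ha]⟩
  · rintro r hr i m sh' ⟨q1, q2, q3, q4⟩ q5 - -
    refine (wp_leafS q1).mono ?_
    rintro m' ⟨r1, r2, r3, r4⟩
    rw [q2, q5] at r3 r4
    exact ⟨⟨q1.congr (fun a ha => r1 a (by omega)) (by rw [r2, q1.real]),
      by rw [r1 0 (by norm_num), q2], by rw [r1 82 (by norm_num), q3],
      fun a ha => by rw [r1 a (by omega), q4 a ha]⟩, by rw [r1 81 (by norm_num), q5], r3, r4,
      fun x _ hx => (r1 _ (by omega)).trans (q4 _ (by omega))⟩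
  · intro i
    obtain ⟨q1, q2, q3⟩ := hms i
    refine ⟨q1.congr (fun a ha => ?_) (by simp [Instr.exec]), by simp [Instr.exec, q2],
      by simp [Instr.exec], fun a ha => ?_⟩
    · simp only [execs_cons, execs_nil, Instr.exec, Memory.setInt_int]
      rw [if_neg (by omega)]
    · simp only [execs_cons, execs_nil, Instr.exec, Memory.setInt_int]
      rw [if_neg (by omega), q3 a (by omega)]
  clear hms
  rintro ms₁ sh₁ ⟨q1, q2, q3, q4⟩
  have hlevel : LevelDone p sh.real 0 sh₁ := by
    refine LevelDone.of_nodes hg hp.Q_le q2 (fun q hq _ => ?_) q4 fun a ha =>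
      h4 a ((by simp [Par.addr] : 4 = p.addr 0 0).trans_le ha)
    obtain ⟨r1, r2, r3⟩ := q3 q hq
    beta_reduce at r2
    by_cases hqn : q < p.n
    · rw [show leaves p 0 q = {q} by
        ext i
        simp only [leaves, pow_zero, Nat.div_one, mem_filter, mem_range, mem_singleton]
        omega]
      exact isSummary_singleton hk (by norm_num) r1 (by rw [r2, if_pos hqn])
        fun j hj hj0 => r3 _ (by omega) (by omega)
    · rw [show leaves p 0 q = ∅ from filter_eq_empty_iff.2 fun i hi h => by
        have := mem_range.1 hi
        rw [pow_zero, Nat.div_one] at h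
        omega]
      refine isSummary_empty fun j hj => ?_
      by_cases hj0 : j = 0
      · rw [hj0, mul_zero, zero_add, r2, if_neg hqn]
      · exact r3 _ (by omega) (by omega)
  refine cwp_seq (cwp_forLT (by norm_num) (fun t ms sh' => (∀ i, Env p (ms i)) ∧
    (∀ i, (ms i).int 0 = i) ∧ LevelDone p sh.real t sh') (fun t ms sh' h => h.1) ?_ ?_ ?_ ?_)
  · rintro t ms sh' v ⟨r1, r2, r3⟩
    refine ⟨fun i => (r1 i).congr (fun a ha => ?_) rfl, by simpa using r2, r3⟩
    rw [Memory.setInt_int, if_neg (by omega)]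
  · rintro t - ms sh' ⟨r1, r2, r3⟩ r4
    refine cwp_seq (cwp_block ?_)
    refine (cwp_rounds rfl (t := t + 1)
      (ok := fun q f => ∃ F : ℕ → ℕ,
        (∀ x < 2 * (p.g * p.k), F x = sh'.int (p.addr t (p.g * q) + x)) ∧
        IsReduction (sqd sh' p.d) p.k (p.g * p.k) F f)
      (J := fun i m => Env p m ∧ m.int 0 = i ∧ m.int 82 = t + 1 ∧ m.int 80 = t)
      ?_ (fun i m h => ⟨h.1, h.2.1, h.2.2.1⟩) ?_ ?_ ?_).mono ?_
    · rintro q f f' hff ⟨F, s1, s2⟩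
      exact ⟨F, s1, s2.congr hff⟩
    · rintro i m m' ⟨s1, s2, s3, s4⟩ hint hreal
      exact ⟨s1.congr (fun a ha => hint a (by omega)) (by rw [hreal]),
        by rw [hint 0 (by norm_num), s2], by rw [hint 82 (by norm_num), s3],
        by rw [hint 80 (by norm_num), s4]⟩
    · rintro r hr i m sh₂ ⟨s1, s2, s3, s4⟩ s5 s6 s7
      refine (wp_nodeS s1 hk hg).mono ?_
      rintro m' ⟨u1, u2, u3⟩
      rw [s2, s4, s5, show sqd sh₂ p.d = sqd sh' p.d by rw [sqd_eq_dist, sqd_eq_dist, s6]] at u3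
      refine ⟨⟨s1.congr (fun a ha => u1 a (by omega)) (by rw [u2, s1.real]),
        by rw [u1 0 (by norm_num), s2], by rw [u1 82 (by norm_num), s3],
        by rw [u1 80 (by norm_num), s4]⟩, by rw [u1 81 (by norm_num), s5], _, fun x hx => ?_, u3⟩
      -- All cells of the children lie on level `t`, before the first cell of level `t + 1`.
      refine s7 _ ?_
      have hq : r * p.N + i + 1 ≤ p.Q * p.N := by
        have h1 : (r + 1) * p.N ≤ p.Q * p.N := Nat.mul_le_mul_right _ hr
        have := i.2
        rw [add_mul, one_mul] at h1
        omega
      have h2 := Nat.mul_le_mul_left p.g hq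
      have h3 : (t * (p.g * (p.Q * p.N)) + p.g * (r * p.N + i + 1)) * (2 * p.k) ≤
          ((t + 1) * (p.g * (p.Q * p.N)) + 0) * (2 * p.k) :=
        Nat.mul_le_mul_right _ (by rw [add_mul t 1]; omega)
      unfold Par.addr
      linarith
    · intro i
      refine ⟨(r1 i).congr (fun a ha => ?_) (by simp [Instr.exec]), by simp [Instr.exec, r2],
        by simp [Instr.exec, r4, (r1 i).all.1], by simp [Instr.exec, r4]⟩
      simp only [execs_cons, execs_nil, Instr.exec, Memory.setInt_int]
      rw [if_neg (by omega)]
    · rintro ms₂ sh₂ ⟨s1, s2, s3, s4⟩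
      refine ⟨⟨fun i => (s1 i).1, fun i => (s1 i).2.1, ?_⟩, fun i => (s1 i).2.2.2⟩
      refine LevelDone.of_nodes hg hp.Q_le (s2.trans r3.sh_real) (fun q hq _ => ?_) s4 r3.empty
      obtain ⟨F, hF, hf⟩ := s3 q hq
      exact r3.isSummary hk hg hq hF hf
  · exact ⟨fun i => (q1 i).1, fun i => (q1 i).2.1, hlevel⟩
  rintro ms₂ sh₂ ⟨r1, r2, r3⟩
  have r3 : LevelDone p sh.real p.L sh₂ := r3
  refine cwp_seq (cwp_lift _ (fun i => wp_outS (r1 i) hk) fun ms₃ h₃ => ?_)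
  refine (cwp_copyOutS (fun i => (r1 i).congr (h₃ i).1 ((h₃ i).2.1.trans (r1 i).real.symm))
    (fun i => ((h₃ i).1 0 (by norm_num)).trans (r2 i))).mono ?_
  intro ms₄ sh₄ h₄
  refine ⟨fun x => sh₂.int (p.addr p.L 0 + x), ?_, fun j hj l hl => ?_⟩
  -- Since `n ≤ g ^ L`, all points lie below node `0` of level `L`.
  · have := r3.node 0 (hQN.trans_le hle)
    rwa [show leaves p p.L 0 = range p.n from filter_true_of_mem fun i hi =>
      Nat.div_eq_of_lt ((mem_range.1 hi).trans_le hp.g_le)] at this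
  · have hjl : j * p.d + l < p.k * p.d := by
      calc j * p.d + l < (j + 1) * p.d := by linarith
        _ ≤ _ := Nat.mul_le_mul_right _ hj
    have h5 := h₄ ⟨0, hN⟩ _ hjl
    rw [(h₃ ⟨0, hN⟩).2.2 j hj l hl] at h5
    simp only [zero_mul, zero_add] at h5
    rw [h5]
    unfold outValue
    rw [sqd_eq_dist, sqd_eq_dist, r3.sh_real]

end PRAM

/-! ### The running time -/

namespace PRAM

open Finset KMeans

/-- The names of the iteration counts of the loops. -/
def Stmt.keys : Stmt → List ℕ
  | seq a b => a.keys ++ b.keys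
  | loop κ _ s => κ :: s.keys
  | _ => []

def Stmt.size : Stmt → ℕ
  | block l => 2 * l.length + 1
  | instr _ => 1
  | seq a b => 1 + (a.size + b.size)
  | cond _ l => 1 + (2 * l.length + 1)
  | loop _ _ s => 2 + s.size

/-- The nesting depth of the loops that are not counted by parameter `10`. -/
def Stmt.depth : Stmt → ℕ
  | seq a b => max a.depth b.depth
  | loop κ _ s => if κ = 10 then s.depth else s.depth + 1
  | _ => 0

/-- The nesting depth of the loops that are counted by parameter `10`. -/
def Stmt.rounds : Stmt → ℕ
  | seq a b => max a.rounds b.rounds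
  | loop κ _ s => if κ = 10 then s.rounds + 1 else s.rounds
  | _ => 0

/-- A loop multiplies the time by its count, so the time is at most a constant of the program times
the counts along the nesting. Loops counted by parameter `10`, the number `Q` of rounds, are kept
apart: `Q` may enter the final bound only linearly, the other counts with any fixed power. -/
theorem Stmt.time_le {β : ℕ → ℕ} {M : ℕ} (hM : 1 ≤ M) (hQ : 1 ≤ β 10) (s : Stmt)
    (h : ∀ κ ∈ s.keys, κ ≠ 10 → β κ ≤ M) :
    s.time β ≤ s.size * (M ^ s.depth * β 10 ^ s.rounds) := by
  have pos : ∀ a b, 1 ≤ M ^ a * β 10 ^ b := fun a b =>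
    Nat.mul_pos (Nat.pow_pos hM) (Nat.pow_pos hQ)
  have mono : ∀ {a b c d}, a ≤ c → b ≤ d → M ^ a * β 10 ^ b ≤ M ^ c * β 10 ^ d := fun h₁ h₂ =>
    Nat.mul_le_mul (Nat.pow_le_pow_right hM h₁) (Nat.pow_le_pow_right hQ h₂)
  induction s with
  | block l => simp [time, size, depth, rounds]
  | instr i => simp [time, size, depth, rounds]
  | cond t l => simp [time, size, depth, rounds]
  | seq a b iha ihb =>
    have ha := iha fun κ hκ => h κ (List.mem_append_left _ hκ)
    have hb := ihb fun κ hκ => h κ (List.mem_append_right _ hκ)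
    have h1 := Nat.mul_le_mul_left a.size
      (mono (le_max_left a.depth b.depth) (le_max_left a.rounds b.rounds))
    have h2 := Nat.mul_le_mul_left b.size
      (mono (le_max_right a.depth b.depth) (le_max_right a.rounds b.rounds))
    have h3 := pos (max a.depth b.depth) (max a.rounds b.rounds)
    simp only [time, size, depth, rounds, add_mul, one_mul]
    omega
  | loop κ t s ih =>
    have hs := ih fun κ' hκ => h κ' (List.mem_cons_of_mem _ hκ)
    have h1 := pos s.depth s.rounds
    have key : ∀ B Y, B * (M ^ s.depth * β 10 ^ s.rounds) ≤ Y → β κ ≤ B → 1 ≤ Y →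
        β κ * (1 + s.time β) + 1 ≤ (2 + s.size) * Y := by
      intro B Y hY hB hY1
      calc β κ * (1 + s.time β) + 1
          ≤ B * ((1 + s.size) * (M ^ s.depth * β 10 ^ s.rounds)) + 1 := by
            refine Nat.add_le_add_right (Nat.mul_le_mul hB ?_) 1
            rw [add_mul, one_mul]
            omega
        _ = (1 + s.size) * (B * (M ^ s.depth * β 10 ^ s.rounds)) + 1 := by ring
        _ ≤ (1 + s.size) * Y + Y := Nat.add_le_add (Nat.mul_le_mul_left _ hY) hY1
        _ = _ := by ring
    simp only [time, size, depth, rounds]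
    split_ifs with hκ
    · refine key (β 10) _ (le_of_eq (by ring)) (by rw [hκ]) (pos _ _)
    · refine key M _ (le_of_eq (by ring)) (h κ List.mem_cons_self hκ) (pos _ _)

/-- The largest count is the number of swaps, of degree `7` in `h`: with `g, k ≤ h` it is at most
`4h⁷ + 4h⁶ + 4h³`. Loops over rounds are never nested, so `Q` occurs to the first power. -/
theorem time_mainS_le {p : Par} (hk : 0 < p.k) (hQ : 0 < p.Q) :
    mainS.time p.val ≤
      mainS.size * ((12 * (p.g + p.L + p.k + p.d) ^ 7) ^ mainS.depth * p.Q) := by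
  set h := p.g + p.L + p.k + p.d with hh
  have h1 : 1 ≤ h := by omega
  have hpow : ∀ a ≤ 7, h ^ a ≤ h ^ 7 := fun a ha => Nat.pow_le_pow_right h1 ha
  have h07 : 1 ≤ h ^ 7 := Nat.one_le_pow _ _ h1
  have e1 : h ≤ h ^ 7 := by simpa using hpow 1 (by norm_num)
  have hgk : p.g * p.k ≤ h * h := Nat.mul_le_mul (by omega) (by omega)
  have hkd : p.k * p.d ≤ h * h := Nat.mul_le_mul (by omega) (by omega)
  have e2 : h * h ≤ h ^ 7 := by simpa [sq] using hpow 2 (by norm_num)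
  have e3 : numSwaps p.k (p.g * p.k) ≤ 12 * h ^ 7 := by
    calc numSwaps p.k (p.g * p.k) ≤ (h * h * (h * h + h) + 1) * (4 * h * (h * h)) := by
          unfold numSwaps
          have hk' : p.k ≤ h := by omega
          gcongr
      _ = 4 * h ^ 7 + 4 * h ^ 6 + 4 * h ^ 3 := by ring
      _ ≤ 12 * h ^ 7 := by
          have := hpow 6 (by norm_num)
          have := hpow 3 (by norm_num)
          omega
  have key := mainS.time_le (β := p.val) (M := 12 * h ^ 7) (by omega) hQ ?_
  · rwa [show mainS.rounds = 1 from by decide, pow_one] at key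
  · have hkeys : ∀ κ ∈ mainS.keys, κ ∈ [5, 6, 8, 9, 10, 11, 12, 14, 15] := by decide
    intro κ hκ hne
    have := hkeys κ hκ
    simp only [List.mem_cons, List.not_mem_nil, or_false] at this
    rcases this with rfl | rfl | rfl | rfl | rfl | rfl | rfl | rfl | rfl <;>
    simp only [Par.val] <;> omega

/-- Minimality of `g` gives `g - 1 ≤ n^(1/L)`, and `1/L ≤ ε`. For `Q`, write `n = n^ε * (n^(1-ε)/N)
* N` and round both factors up. -/
theorem exists_fits {ε : ℝ} (hε : 0 < ε) (hε1 : ε < 1) {n N : ℕ} (k d : ℕ) (hn : 1 ≤ n)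
    (hN : 1 ≤ N) :
    ∃ p : Par, p.Fits ε ∧ p.n = n ∧ p.k = k ∧ p.d = d ∧ p.N = N ∧ 0 < p.Q ∧
      (p.L : ℝ) ≤ 1 / ε + 1 ∧ (p.g : ℝ) ≤ (n : ℝ) ^ ε + 1 ∧
      (p.Q : ℝ) ≤ ((n : ℝ) ^ ε + 1) * (⌈(n : ℝ) ^ (1 - ε) / (N : ℝ)⌉₊ : ℝ) := by
  classical
  have hn' : (1 : ℝ) ≤ n := by exact_mod_cast hn
  have hN' : (1 : ℝ) ≤ N := by exact_mod_cast hN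
  have hL : ∃ L : ℕ, 1 ≤ (L : ℝ) * ε := by
    obtain ⟨L, hL⟩ := exists_nat_ge (1 / ε)
    exact ⟨L, by rwa [div_le_iff₀ hε] at hL⟩
  set L := Nat.find hL with hLdef
  have hL1 : 1 ≤ (L : ℝ) * ε := Nat.find_spec hL
  have hL2 : ∀ i < L, (i : ℝ) * ε < 1 := fun i hi => not_le.1 (Nat.find_min hL hi)
  have hL0 : 0 < L := Nat.pos_of_ne_zero fun h => by
    rw [h] at hL1
    norm_num at hL1
  have hg : ∃ g : ℕ, n ≤ g ^ L := ⟨n, Nat.le_self_pow hL0.ne' n⟩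
  set g := Nat.find hg with hgdef
  have hg1 : n ≤ g ^ L := Nat.find_spec hg
  have hg2 : ∀ i < g, i ^ L < n := fun i hi => not_le.1 (Nat.find_min hg hi)
  have hQ : ∃ Q : ℕ, n ≤ Q * N := ⟨n, Nat.le_mul_of_pos_right _ hN⟩
  set Q := Nat.find hQ with hQdef
  have hQ1 : n ≤ Q * N := Nat.find_spec hQ
  have hQ2 : ∀ i < Q, i * N < n := fun i hi => not_le.1 (Nat.find_min hQ hi)
  refine ⟨⟨n, d, k, N, L, g, Q⟩, ⟨hL0, hL2, hL1, hg2, hg1, hQ2, hQ1⟩, rfl, rfl, rfl, rfl,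
    Nat.pos_of_ne_zero fun h => ?_, ?_, ?_, ?_⟩
  · have : Q = 0 := h
    rw [this] at hQ1
    omega
  · have := hL2 (L - 1) (by omega)
    rw [Nat.cast_sub hL0, Nat.cast_one, ← lt_div_iff₀ hε] at this
    change (L : ℝ) ≤ _
    linarith
  · change (g : ℝ) ≤ _
    rcases Nat.eq_zero_or_pos g with h | h
    · rw [h, Nat.cast_zero]
      positivity
    · have h1 : ((g - 1 : ℕ) : ℝ) ^ L ≤ n := by exact_mod_cast (hg2 (g - 1) (by omega)).le
      have h2 : ((g - 1 : ℕ) : ℝ) ≤ (n : ℝ) ^ ε := by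
        calc ((g - 1 : ℕ) : ℝ) = (((g - 1 : ℕ) : ℝ) ^ L) ^ ((L : ℝ)⁻¹) :=
              (Real.pow_rpow_inv_natCast (Nat.cast_nonneg _) hL0.ne').symm
          _ ≤ (n : ℝ) ^ ((L : ℝ)⁻¹) := Real.rpow_le_rpow (by positivity) h1 (by positivity)
          _ ≤ (n : ℝ) ^ ε := by
              refine Real.rpow_le_rpow_of_exponent_le hn' ?_
              rw [inv_le_iff_one_le_mul₀ (by exact_mod_cast hL0), mul_comm]
              exact hL1
      rw [Nat.cast_sub h, Nat.cast_one] at h2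
      linarith
  · change (Q : ℝ) ≤ _
    set a := ⌈(n : ℝ) ^ (1 - ε) / (N : ℝ)⌉₊
    have h1 : n ≤ ⌈(n : ℝ) ^ ε⌉₊ * a * N := by
      have h2 : (n : ℝ) ≤ ⌈(n : ℝ) ^ ε⌉₊ * a * N := by
        calc (n : ℝ) = (n : ℝ) ^ ε * ((n : ℝ) ^ (1 - ε) / N) * N := by
              have : (n : ℝ) ^ ε * (n : ℝ) ^ (1 - ε) = n := by
                rw [← Real.rpow_add (by linarith), add_sub_cancel, Real.rpow_one]
              field_simp
              exact this.symm
          _ ≤ _ := by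
              gcongr
              · exact Nat.le_ceil _
              · exact Nat.le_ceil _
      exact_mod_cast h2
    have h3 : Q ≤ ⌈(n : ℝ) ^ ε⌉₊ * a := Nat.find_min' hQ h1
    calc (Q : ℝ) ≤ ⌈(n : ℝ) ^ ε⌉₊ * a := by exact_mod_cast h3
      _ ≤ _ := by
        gcongr
        exact (Nat.ceil_lt_add_one (by positivity)).le

/-! ### From the summary at the root to a solution -/

theorem point_input {n d N k : ℕ} {ε : ℝ} (X : Fin n → EuclideanSpace ℝ (Fin d)) (i : Fin n) :
    point d (input N k ε X).real i = X i := by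
  ext l
  have h : (i : ℕ) * d + l < n * d := by
    calc (i : ℕ) * d + l < (i + 1) * d := by
          have := l.2
          linarith
      _ ≤ n * d := Nat.mul_le_mul_right _ i.2
  have e : (⟨i * d + l, h⟩ : Fin (n * d)) = finProdFinEquiv (i, l) := by
    ext
    simp [finProdFinEquiv]
    ring
  change (input N k ε X).real (1 + (i * d + l)) = X i l
  rw [add_comm 1]
  simp only [input, dif_pos h, e, Equiv.symm_apply_apply]

/-- Replacing repeated centers by fresh points yields distinct centers and increases no cost. -/
theorem outValue_spec {sh : Memory} {d k : ℕ} (hk : 0 < k) (hd : 0 < d) (c : ℕ → ℕ)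
    {C : Fin k → EuclideanSpace ℝ (Fin d)} (hC : ∀ j l, C j l = outValue sh d k c j l) :
    Function.Injective C ∧ ∀ j < k, ∃ j', C j' = point d sh.real (c j) := by
  set D : ℕ → ℕ → ℝ := fun j i => sqd sh d (c j) (c i) with hD
  have hD0 : ∀ j i, D j i = 0 ↔ point d sh.real (c j) = point d sh.real (c i) := fun j i => by
    simp only [hD, sqd_eq_dist]
    rw [sq_eq_zero_iff, dist_eq_zero]
  have hself : ∀ j, D j j = 0 := fun j => (hD0 j j).2 rfl
  have hnn : ∀ j i, 0 ≤ D j i := fun j i => sqd_nonneg _ _ _ _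
  have hnear := fun j => near_spec (D j) hk
  have hle : ∀ j < k, near (D j) k ≤ j := fun j hj => by
    by_contra! h
    have := (hnear j).2.2 j h
    rw [hself j] at this
    exact (hnn _ _).not_gt this
  have hz : ∀ j < k, D j (near (D j) k) = 0 := fun j hj =>
    le_antisymm (((hnear j).2.1 j hj).trans (hself j).le) (hnn _ _)
  have hdup : ∀ j : Fin k, near (D j) k < j → C j ⟨0, hd⟩ =
      j + (∑ i ∈ range k, sh.real (1 + c i * d) * sh.real (1 + c i * d)) + 1 := fun j hj => by
    rw [hC, outValue, if_pos ⟨rfl, hj⟩]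
  have hkeep : ∀ j : Fin k, ¬ near (D j) k < j → C j = point d sh.real (c j) := fun j hj => by
    ext l
    rw [hC, outValue, if_neg fun h => hj h.2]
    rfl
  set S := ∑ i ∈ range k, sh.real (1 + c i * d) * sh.real (1 + c i * d) with hS
  -- A fresh point has first coordinate `j' + S + 1`, beyond that of every old center because `x <
  -- x² + 1 ≤ S + 1`; different `j'` give different fresh points.
  have hlt : ∀ j j' : Fin k, point d sh.real (c j) ⟨0, hd⟩ < j' + S + 1 := fun j j' => by
    have h1 : sh.real (1 + c j * d) * sh.real (1 + c j * d) ≤ S :=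
      single_le_sum (f := fun i => sh.real (1 + c i * d) * sh.real (1 + c i * d))
        (fun i _ => mul_self_nonneg _) (mem_range.2 j.2)
    have h2 : (0 : ℝ) ≤ (j' : ℕ) := Nat.cast_nonneg _
    change sh.real (1 + (c j * d + 0)) < _
    rw [add_zero]
    nlinarith [sq_nonneg (sh.real (1 + c j * d) - 1 / 2)]
  have hinj : ∀ j j' : Fin k, (j : ℕ) < j' → C j ≠ C j' := by
    intro j j' hjj h
    have h0 := congrArg (fun v : EuclideanSpace ℝ (Fin d) => v ⟨0, hd⟩) h
    beta_reduce at h0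
    by_cases a : near (D j) k < j <;> by_cases b : near (D j') k < j'
    · rw [hdup j a, hdup j' b] at h0
      have : (j : ℝ) = j' := by linarith
      exact hjj.ne (by exact_mod_cast this)
    · rw [hdup j a, hkeep j' b] at h0
      exact (hlt j' j).ne h0.symm
    · rw [hkeep j a, hdup j' b] at h0
      exact (hlt j j').ne h0
    · rw [hkeep j a, hkeep j' b] at h
      have h1 : near (D j') k = j' := le_antisymm (hle _ j'.2) (not_lt.1 b)
      have h2 := (hnear j').2.2 j (by rw [h1]; exact hjj)
      rw [(hD0 _ _).2 h.symm] at h2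
      exact (hnn _ _).not_gt h2
  refine ⟨fun j j' h => ?_, fun j hj => ?_⟩
  · rcases lt_trichotomy (j : ℕ) j' with h' | h' | h'
    · exact absurd h (hinj j j' h')
    · exact Fin.ext h'
    · exact absurd h.symm (hinj j' j h')
  -- The first copy `b` of a repeated center is kept, so no center gets lost.
  · set b := near (D j) k with hb
    have h1 := (hD0 j b).1 (hz j hj)
    have h2 : D b = D j := by
      funext i
      simp only [hD, sqd_eq_dist, h1]
    refine ⟨⟨b, (hnear j).1⟩, ?_⟩
    rw [hkeep _ (by change ¬ near (D b) k < b; rw [h2]; exact lt_irrefl _), h1]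

theorem cost_eq_sum_sqDist {n k d : ℕ} (C : Fin k → EuclideanSpace ℝ (Fin d))
    (X : Fin n → EuclideanSpace ℝ (Fin d)) : cost C X = ∑ i, sqDist C (X i) := by
  simp only [cost, sqDist, dist_eq_norm]

/-- The assignment `σ` bounds the cost from above, since the nearest center is at most as far as the
assigned one. The summary competes with arbitrary `k` centers, hence with all those in the infimum
`opt`. -/
theorem isApproxSolution_of_isSummary {n k d : ℕ} {sh : Memory} {α α' : ℝ} (hk : 0 < k)
    (hd : 0 < d) {X : Fin n → EuclideanSpace ℝ (Fin d)} (hX : ∀ i : Fin n, point d sh.real i = X i)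
    {f : ℕ → ℕ} (hf : IsSummary (point d sh.real) k k α (range n) f)
    {C : Fin k → EuclideanSpace ℝ (Fin d)}
    (hC : ∀ j l, C j l = outValue sh d k (fun j => f (2 * j)) j l) (hα : α ≤ α') (hα' : 0 < α') :
    IsApproxSolution α' X C := by
  obtain ⟨hinj, hmem⟩ := outValue_spec hk hd (fun j => f (2 * j)) hC
  obtain ⟨σ, h1, -, h3⟩ := hf
  refine ⟨hinj, ?_⟩
  have : Nonempty {C : Fin k → EuclideanSpace ℝ (Fin d) // Function.Injective C} := ⟨⟨C, hinj⟩⟩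
  rw [← div_le_iff₀' hα']
  refine le_ciInf fun C' => ?_
  rw [div_le_iff₀' hα']
  have h4 : cost C X ≤ α * cost C'.1 X := by
    rw [cost_eq_sum_sqDist, cost_eq_sum_sqDist]
    have h5 := h3 C'.1
    rw [sum_range, sum_range] at h5
    simp only [hX] at h5
    refine le_trans (sum_le_sum fun i _ => ?_) h5
    obtain ⟨j, hj⟩ := hmem (σ i) (h1 i (mem_range.2 i.2))
    rw [← hj]
    exact sqDist_le C (X i) j
  refine h4.trans (mul_le_mul_of_nonneg_right hα ?_)
  rw [cost_eq_sum_sqDist]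
  exact sum_nonneg fun _ _ => sqDist_nonneg _ _

end PRAM

theorem mainTheorem9 :
    ∃ (c₀ : ℝ) (p : MvPolynomial (Fin 4) ℝ) (A : PRAM.Program), 0 < c₀ ∧
      ∀ ε : ℝ, 0 < ε → ε < 1 →
      ∀ n k d N : ℕ, 1 ≤ n → 1 ≤ k → 1 ≤ d → 1 ≤ N →
      ∀ X : Fin n → EuclideanSpace ℝ (Fin d),
        ∃ (T : ℕ) (m : PRAM.Memory),
          (T : ℝ) ≤ MvPolynomial.eval ![(n : ℝ) ^ ε, (k : ℝ), (d : ℝ), 1 / ε] p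
            * (⌈(n : ℝ) ^ (1 - ε) / (N : ℝ)⌉₊ : ℝ) ∧
          PRAM.ComputesInTime A N (KMeans.input N k ε X) T m ∧
          KMeans.IsApproxSolution (c₀ ^ (1 / ε)) X (KMeans.output n k d m) := by
  open PRAM KMeans MvPolynomial in
  -- The square comes from `L ≤ 1/ε + 1 ≤ 2/ε`. The polynomial is the bound of `time_mainS_le` after
  -- `g + L ≤ n^ε + 1/ε + 2`, and its factor `X 0 + 1` comes from the bound on `Q`.
  refine ⟨2626 ^ (2 : ℝ), C (mainS.size : ℝ) *
    ((C 12 * (X 0 + X 1 + X 2 + X 3 + C 2) ^ 7) ^ mainS.depth * (X 0 + C 1)), mainS.code,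
    by positivity, ?_⟩
  intro ε hε hε1 n k d N hn hk hd hN X
  obtain ⟨p, hp, rfl, rfl, rfl, rfl, hQ, hL, hg, hQle⟩ := exists_fits hε hε1 k d hn hN
  obtain ⟨m, ms', hrun, f, hf, hout⟩ := ComputesInTime.of_cwp (cwp_mainS (sh := input p.N p.k ε X)
    hp hn hk rfl rfl rfl rfl (fun a ha => by
      obtain ⟨b, rfl⟩ := Nat.exists_eq_add_of_le ha
      rw [add_comm]
      rfl) rfl)
  refine ⟨_, m, ?_, hrun, isApproxSolution_of_isSummary hk hd (point_input X) hf
    (fun j l => hout j j.2 l l.2) ?_ (by positivity)⟩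
  · have h1 : (mainS.time p.val : ℝ) ≤
        mainS.size * ((12 * ((p.g : ℝ) + p.L + p.k + p.d) ^ 7) ^ mainS.depth * p.Q) := by
      exact_mod_cast time_mainS_le hk hQ
    refine h1.trans ?_
    simp only [map_mul, map_pow, map_add, MvPolynomial.eval_C, MvPolynomial.eval_X]
    simp only [Matrix.cons_val]
    rw [mul_assoc, mul_assoc]
    have hnn : (0 : ℝ) ≤ (p.n : ℝ) ^ ε := by positivity
    have hinv : 0 < 1 / ε := by positivity
    have hsum : (p.g : ℝ) + p.L + p.k + p.d ≤ (p.n : ℝ) ^ ε + p.k + p.d + 1 / ε + 2 := by linarith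
    exact mul_le_mul_of_nonneg_left (mul_le_mul (pow_le_pow_left₀ (by positivity)
      (mul_le_mul_of_nonneg_left (pow_le_pow_left₀ (by positivity) hsum _) (by norm_num)) _)
      hQle (by positivity) (by positivity)) (by positivity)
  · have h1 : (2626 : ℝ) ^ p.L ≤ (2626 ^ (2 : ℝ)) ^ (1 / ε) := by
      rw [← Real.rpow_natCast, ← Real.rpow_mul (by norm_num)]
      refine Real.rpow_le_rpow_of_exponent_le (by norm_num) ?_
      have : 1 ≤ 1 / ε := by
        rw [le_div_iff₀ hε]
        linarith
      linarith
    linarith
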